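/- Let $m,n,p$ be positive integers with $p\le\min\{m,n\}$, let $\mathcal M_p=\{X\in\mathbb R^{m\times n}:\operatorname{rank}X=p\}$ (an embedded submanifold of $\mathbb R^{m\times n}$), $\mathrm{St}(p,m)=\{M\in\mathbb R^{m\times p}:M^TM=I_p\}$, $\mathbb R_*^{n\times p}=\{N\in\mathbb R^{n\times p}:\operatorname{rank}N=p\}$, $\overline{\mathcal M}=\mathrm{St}(p,m)\times\mathbb R_*^{n\times p}$ and $\pi:\overline{\mathcal M}\to\mathcal M_p$, $\pi(M,N)=MN^T$. Endow $\overline{\mathcal M}$ with the Euclidean metric $\bar g((\dot M,\dot N),(\check M,\check N))=\operatorname{tr}(\dot M^T\check M+\dot N^T\check N)$. At $z=(M,N)\in\overline{\mathcal M}$ let the vertical space $\mathcal V_z$ be the tangent space to the fiber $\pi^{-1}(MN^T)$, let the horizontal space $\mathcal H_z$ be its $\bar g$-orthogonal complement in $T_z\overline{\mathcal M}$, and let $P^h_z$ be the projection of $T_z\overline{\mathcal M}$ onto $\mathcal H_z$ along $\mathcal V_z$. The horizontal lift at $z$ of $\xi\in T_{\pi(z)}\mathcal M_p$ is the $\xi_z\in\mathcal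 H_z$ with $\mathrm D\pi(z)[\xi_z]=\xi$. Then the following hold. (1) $\bar g$ is a Riemannian metric, $\pi$ is onto, $\mathrm D\pi(z)$ maps $\mathcal H_z$ bijectively onto $T_{\pi(z)}\mathcal M_p$ (so lifts exist and are unique), and $g_{\pi(z)}(\xi,\zeta)=\bar g(\xi_z,\zeta_z)$ is independent of the point $z$ of the fiber and defines a (smooth) Riemannian metric $g$ on $\mathcal M_p$. (2) For $(\dot M,\dot N)\in T_{(M,N)}\overline{\mathcal M}$, $P^h_{(M,N)}(\dot M,\dot N)=(\dot M+M\Omega,\dot N+N\Omega)$, where $\Omega=-\Omega^T$ is the unique skew-symmetric solution of $(N^TN+I)\Omega+\Omega(N^TN+I)=\dot M^TM-M^T\dot M+\dot N^TN-N^T\dot N$. (3) Let $P_{(M,N)}(A,B)=\big((I-MM^T)A+\tfrac12M(M^TA-A^TM),\,B\big)$. Then $\bar\nabla_{\dot X}\dot Y=P_{(M,N)}(\partial_{\dot X}\dot Y)$ is the Levi-Civita connection of $(\overline{\mathcal M},\bar g)$. (4) For $\eta=(\dot M,\dot N)\in T_{(M,N)}\overline{\mathcal M}$, the Riemannian exponential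 of $(\overline{\mathcal M},\bar g)$ at $\eta$ is defined if and only if $\operatorname{rank}(N+t\dot N)=p$ for all $t\in[0,1]$, and then $$\operatorname{Exp}_{(M,N)}(\dot M,\dot N)=\left(\begin{bmatrix}M&\dot M\end{bmatrix}\exp\begin{bmatrix}A&-S\\ I&A\end{bmatrix}\begin{bmatrix}I_p\\0\end{bmatrix}\exp(-A),\;N+\dot N\right),\quad A=M^T\dot M,\; S=\dot M^T\dot M.\qquad(*)$$ (5) $(\mathcal M_p,g)$ has a Levi-Civita connection $\nabla$. For $z\in\overline{\mathcal M}$ and $\xi\in T_{\pi(z)}\mathcal M_p$ with horizontal lift $\xi_z=(\dot M,\dot N)$ at $z=(M,N)$, the Riemannian exponential of $(\mathcal M_p,g)$ at $\xi$ is defined if and only if $\operatorname{rank}(N+t\dot N)=p$ for all $t\in[0,1]$, and then $\operatorname{Exp}_{\pi(z)}(\xi)=\pi(\operatorname{Exp}_z(\xi_z))$ with $\operatorname{Exp}_z$ given by $(*)$. (6) Let $f:\mathcal M_p\to\mathbb R$ be smooth, let $\bar f=f\circ\pi$ on $\overline{\mathcal M}$ and let $(M,N)\in\overline{\mathcal M}$.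 Then $\operatorname{grad}\bar f(M,N)=P_{(M,N)}$ applied to the Euclidean gradient at $(M,N)$ of $(M,N)\mapsto f(MN^T)$ on $\mathbb R_*^{m\times p}\times\mathbb R_*^{n\times p}$. A vector $\xi\in T_{MN^T}\mathcal M_p$ solves the Newton equation $\nabla_\xi\operatorname{grad}f=-\operatorname{grad}f(MN^T)$ if and only if its horizontal lift $X=\xi_{(M,N)}\in\mathcal H_{(M,N)}$ solves the lifted Newton equation $$P^h_{(M,N)}\big(\bar\nabla_{X}\operatorname{grad}\bar f\big)=-\operatorname{grad}\bar f(M,N).$$ The pure Riemannian Newton iteration for $f$ on $(\mathcal M_p,g)$ (Levi-Civita connection, exponential retraction) sends $MN^T$ to $\pi(\operatorname{Exp}_{(M,N)}(\dot X_M,\dot X_N))$ with $\operatorname{Exp}$ as in $(*)$, where $(\dot X_M,\dot X_N)\in\mathcal H_{(M,N)}$ is the solution of the lifted Newton equation. Precisely: a matrix $Y$ equals $\operatorname{Exp}_{MN^T}(\xi)$ for some solution $\xi$ of the Newton equation at which the exponential is defined if and only if $Y=\pi(\operatorname{Exp}_{(M,N)}(\dot X_M,\dot X_N))$ for some horizontal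 solution $(\dot X_M,\dot X_N)$ of the lifted Newton equation with $\operatorname{rank}(N+t\dot X_N)=p$ for all $t\in[0,1]$. -/

import Mathlib

open scoped ContDiff Matrix Topology

-- The entrywise sup norm only serves to express smoothness and derivatives of maps between matrix
-- spaces (all norms are equivalent there); the Riemannian metrics below are defined by traces.
attribute [local instance] Matrix.normedAddCommGroup Matrix.normedSpace

noncomputable section

namespace FixedRank

/-! ### Riemannian geometry of an embedded submanifold `S` of a finite-dimensional space `E`

Smoothness of a map on `S` is `ContDiffOn ℝ ∞ · S`; for an embedded submanifold this is the same as
having local smooth extensions to open subsets of `E`.  For a tangent vector `ξ` at `x ∈ S`,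
`fderivWithin ℝ φ S x ξ` is the derivative at `x` of the map `φ` on `S` in the direction `ξ`
(derivatives within `S` are uniquely determined in tangent directions). -/

section General

variable {E : Type*} [NormedAddCommGroup E] [NormedSpace ℝ E]

/-- The tangent space `T_x S`: velocities at time `0` of smooth curves in `S` through `x`. -/
def tangent (S : Set E) (x : E) : Set E :=
  {v | ∃ (c : ℝ → E) (ε : ℝ), 0 < ε ∧ ContDiffOn ℝ ∞ c (Set.Ioo (-ε) ε) ∧
    (∀ t ∈ Set.Ioo (-ε) ε, c t ∈ S) ∧ c 0 = x ∧ HasDerivAt c v 0}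

/-- Smooth tangent vector fields on `S` (values off `S` are irrelevant). -/
def IsField (S : Set E) (V : E → E) : Prop :=
  ContDiffOn ℝ ∞ V S ∧ ∀ x ∈ S, V x ∈ tangent S x

/-- `g` is a (smooth) Riemannian metric on `S`; `g x` is only relevant on `T_x S × T_x S`. -/
structure IsRiemannianMetric (S : Set E) (g : E → E → E → ℝ) : Prop where
  add_left : ∀ x ∈ S, ∀ ξ ∈ tangent S x, ∀ ζ ∈ tangent S x, ∀ η ∈ tangent S x,
    g x (ξ + ζ) η = g x ξ η + g x ζ η
  smul_left : ∀ x ∈ S, ∀ (a : ℝ), ∀ ξ ∈ tangent S x, ∀ η ∈ tangent S x,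
    g x (a • ξ) η = a * g x ξ η
  symm : ∀ x ∈ S, ∀ ξ ∈ tangent S x, ∀ η ∈ tangent S x, g x ξ η = g x η ξ
  pos : ∀ x ∈ S, ∀ ξ ∈ tangent S x, ξ ≠ 0 → 0 < g x ξ ξ
  smooth : ∀ V W : E → E, IsField S V → IsField S W →
    ContDiffOn ℝ ∞ (fun x => g x (V x) (W x)) S

/-- `nabla` is the Levi-Civita (Riemannian) connection of `(S, g)`: an affine connection that is
torsion-free and compatible with the metric.  `nabla x ξ V` stands for `(∇_ξ V)_x`, with
`ξ ∈ T_x S` and `V` a smooth tangent vector field on `S`. -/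
structure IsLeviCivita (S : Set E) (g : E → E → E → ℝ) (nabla : E → E → (E → E) → E) :
    Prop where
  mem_tangent : ∀ x ∈ S, ∀ ξ ∈ tangent S x, ∀ V, IsField S V → nabla x ξ V ∈ tangent S x
  smooth : ∀ V W, IsField S V → IsField S W → ContDiffOn ℝ ∞ (fun x => nabla x (V x) W) S
  congr : ∀ x ∈ S, ∀ ξ ∈ tangent S x, ∀ V W, IsField S V → IsField S W → Set.EqOn V W S →
    nabla x ξ V = nabla x ξ W
  add_left : ∀ x ∈ S, ∀ ξ ∈ tangent S x, ∀ ζ ∈ tangent S x, ∀ V, IsField S V →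
    nabla x (ξ + ζ) V = nabla x ξ V + nabla x ζ V
  smul_left : ∀ x ∈ S, ∀ (a : ℝ), ∀ ξ ∈ tangent S x, ∀ V, IsField S V →
    nabla x (a • ξ) V = a • nabla x ξ V
  add_right : ∀ x ∈ S, ∀ ξ ∈ tangent S x, ∀ V W, IsField S V → IsField S W →
    nabla x ξ (fun y => V y + W y) = nabla x ξ V + nabla x ξ W
  leibniz : ∀ x ∈ S, ∀ ξ ∈ tangent S x, ∀ (φ : E → ℝ) (V : E → E), ContDiffOn ℝ ∞ φ S →
    IsField S V →
    nabla x ξ (fun y => φ y • V y) = fderivWithin ℝ φ S x ξ • V x + φ x • nabla x ξ V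
  torsion_free : ∀ x ∈ S, ∀ V W, IsField S V → IsField S W →
    nabla x (V x) W - nabla x (W x) V = VectorField.lieBracketWithin ℝ V W S x
  metric : ∀ x ∈ S, ∀ ξ ∈ tangent S x, ∀ V W, IsField S V → IsField S W →
    fderivWithin ℝ (fun y => g y (V y) (W y)) S x ξ =
      g x (nabla x ξ V) (W x) + g x (V x) (nabla x ξ W)

/-- Smooth vector fields along the curve `γ` in `S`, on the open set `J` of parameters. -/
def IsFieldAlong (S : Set E) (γ : ℝ → E) (J : Set ℝ) (Z : ℝ → E) : Prop :=
  ContDiffOn ℝ ∞ Z J ∧ ∀ t ∈ J, Z t ∈ tangent S (γ t)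

/-- `D` is the covariant derivative `D/dt` along `γ` induced by the connection `nabla`. -/
structure IsCovDerivAlong (S : Set E) (nabla : E → E → (E → E) → E) (γ : ℝ → E) (J : Set ℝ)
    (D : (ℝ → E) → ℝ → E) : Prop where
  field : ∀ Z, IsFieldAlong S γ J Z → IsFieldAlong S γ J (D Z)
  add : ∀ Y Z, IsFieldAlong S γ J Y → IsFieldAlong S γ J Z → ∀ t ∈ J,
    D (fun s => Y s + Z s) t = D Y t + D Z t
  leibniz : ∀ (φ : ℝ → ℝ) (Z : ℝ → E), ContDiffOn ℝ ∞ φ J → IsFieldAlong S γ J Z → ∀ t ∈ J,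
    D (fun s => φ s • Z s) t = deriv φ t • Z t + φ t • D Z t
  comp : ∀ V, IsField S V → ∀ t ∈ J,
    D (fun s => V (γ s)) t = nabla (γ t) (deriv γ t) V

/-- `γ : J → S` is a geodesic: its acceleration `(D/dt) γ'` vanishes. -/
def IsGeodesic (S : Set E) (nabla : E → E → (E → E) → E) (γ : ℝ → E) (J : Set ℝ) : Prop :=
  ContDiffOn ℝ ∞ γ J ∧ (∀ t ∈ J, γ t ∈ S) ∧
    ∃ D, IsCovDerivAlong S nabla γ J D ∧ ∀ t ∈ J, D (deriv γ) t = 0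

/-- The exponential `Exp_x ξ` is defined and equal to `y`: there is a geodesic, on an open interval
containing `[0, 1]`, with initial point `x`, initial velocity `ξ` and value `y` at time `1`. -/
def HasExp (S : Set E) (nabla : E → E → (E → E) → E) (x ξ y : E) : Prop :=
  ∃ (γ : ℝ → E) (J : Set ℝ), IsOpen J ∧ J.OrdConnected ∧ Set.Icc 0 1 ⊆ J ∧
    IsGeodesic S nabla γ J ∧ γ 0 = x ∧ deriv γ 0 = ξ ∧ γ 1 = y

/-- The Riemannian gradient of `f` at `x`: the vector `v ∈ T_x S` with `g_x(v, ξ) = D f(x)[ξ]` for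
all `ξ ∈ T_x S`. -/
def rgrad (S : Set E) (g : E → E → E → ℝ) (f : E → ℝ) (x : E) : E :=
  Classical.epsilon fun v => v ∈ tangent S x ∧ ∀ ξ ∈ tangent S x, g x v ξ = fderivWithin ℝ f S x ξ

/-- `ξ ∈ T_x S` solves the Riemannian Newton equation `∇_ξ grad f = - grad f(x)`. -/
def IsNewtonVector (S : Set E) (g : E → E → E → ℝ) (nabla : E → E → (E → E) → E) (f : E → ℝ)
    (x ξ : E) : Prop :=
  ξ ∈ tangent S x ∧ nabla x ξ (rgrad S g f) = -rgrad S g f x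

/-- `y` is obtained from `x` by one step of the pure Riemannian Newton method for `f`:
`y = Exp_x ξ` with `ξ` a solution of the Newton equation at `x`. -/
def IsNewtonStep (S : Set E) (g : E → E → E → ℝ) (nabla : E → E → (E → E) → E) (f : E → ℝ)
    (x y : E) : Prop :=
  ∃ ξ, IsNewtonVector S g nabla f x ξ ∧ HasExp S nabla x ξ y

end General

/-! ### The manifold of matrices of rank `p` and the total space -/

/-- The ambient space `ℝ^{m×p} × ℝ^{n×p}` of the total space. -/
abbrev Pair (m n p : ℕ) : Type := Matrix (Fin m) (Fin p) ℝ × Matrix (Fin n) (Fin p) ℝ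

/-- The set `M_p` of `m × n` matrices of rank `p`. -/
def Mp (m n p : ℕ) : Set (Matrix (Fin m) (Fin n) ℝ) := {X | X.rank = p}

/-- The Stiefel manifold `St(p, m)`. -/
def Stiefel (m p : ℕ) : Set (Matrix (Fin m) (Fin p) ℝ) := {M | Mᵀ * M = 1}

/-- The total space `St(p, m) × ℝ_*^{n×p}`. -/
def SRp (m n p : ℕ) : Set (Pair m n p) := {z | z.1 ∈ Stiefel m p ∧ z.2.rank = p}

variable {m n p : ℕ}

/-- The map `π : (M, N) ↦ M Nᵀ`. -/
def proj (z : Pair m n p) : Matrix (Fin m) (Fin n) ℝ := z.1 * z.2ᵀ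

/-- The differential `Dπ(z)[η]`. -/
def dproj (z η : Pair m n p) : Matrix (Fin m) (Fin n) ℝ := fderiv ℝ proj z η

/-- The Euclidean metric on the total space. -/
def gBar (_z η ζ : Pair m n p) : ℝ := (η.1ᵀ * ζ.1 + η.2ᵀ * ζ.2).trace

/-- The vertical space at `z`: the tangent space to the fiber of `π` through `z`. -/
def vertical (z : Pair m n p) : Set (Pair m n p) :=
  tangent {w | w ∈ SRp m n p ∧ proj w = proj z} z

/-- The horizontal space at `z`: the orthogonal complement of the vertical space in the tangent
space to the total space. -/
def horizontal (z : Pair m n p) : Set (Pair m n p) :=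
  {η | η ∈ tangent (SRp m n p) z ∧ ∀ v ∈ vertical z, gBar z η v = 0}

/-- The horizontal lift at `z` of a tangent vector `ξ` to `M_p` at `π(z)`. -/
def lift (z : Pair m n p) (ξ : Matrix (Fin m) (Fin n) ℝ) : Pair m n p :=
  Classical.epsilon fun η => η ∈ horizontal z ∧ dproj z η = ξ

/-- The projection `P^h` at `z` of a tangent vector onto the horizontal space along the vertical
space. -/
def hproj (z η : Pair m n p) : Pair m n p :=
  Classical.epsilon fun h => h ∈ horizontal z ∧ η - h ∈ vertical z

/-- The quotient metric on `M_p`: the inner product of the horizontal lifts at some point of the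
fiber. (That the choice of this point does not matter is part of the theorem.) -/
def quotMetric (p : ℕ) (X ξ ζ : Matrix (Fin m) (Fin n) ℝ) : ℝ :=
  let z : Pair m n p := Classical.epsilon fun z => z ∈ SRp m n p ∧ proj z = X
  gBar z (lift z ξ) (lift z ζ)

/-- The orthogonal projection of `ℝ^{m×p} × ℝ^{n×p}` onto the tangent space to the total space at
`z = (M, N)`: `(A, B) ↦ ((I - M Mᵀ) A + M skew(Mᵀ A), B)`. -/
def tproj (z η : Pair m n p) : Pair m n p :=
  ((1 - z.1 * z.1ᵀ) * η.1 + z.1 * ((1 / 2 : ℝ) • (z.1ᵀ * η.1 - (z.1ᵀ * η.1)ᵀ)), η.2)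

/-- The connection on the total space: the orthogonal projection of the directional derivative. -/
def nablaBar (z η : Pair m n p) (V : Pair m n p → Pair m n p) : Pair m n p :=
  tproj z (fderivWithin ℝ V (SRp m n p) z η)

/-- The Euclidean gradient (matrices of partial derivatives) of `F` on `ℝ^{m×p} × ℝ^{n×p}`. -/
def euclGrad (F : Pair m n p → ℝ) (z : Pair m n p) : Pair m n p :=
  (Matrix.of fun i j => fderiv ℝ F z (Matrix.single i j 1, 0),
    Matrix.of fun i j => fderiv ℝ F z (0, Matrix.single i j 1))

/-- The closed form of the exponential on the total space: with `A = Mᵀ Ṁ` and `S = Ṁᵀ Ṁ`,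
`([M Ṁ] exp([A, -S; I, A]) [I; 0] exp(-A), N + Ṅ)`. -/
def expTotal (z η : Pair m n p) : Pair m n p :=
  (Matrix.fromCols z.1 η.1 *
      NormedSpace.exp (Matrix.fromBlocks (z.1ᵀ * η.1) (-(η.1ᵀ * η.1)) 1 (z.1ᵀ * η.1)) *
      Matrix.fromRows (1 : Matrix (Fin p) (Fin p) ℝ) (0 : Matrix (Fin p) (Fin p) ℝ) *
      NormedSpace.exp (-(z.1ᵀ * η.1)),
    z.2 + η.2)

/-- The straight line `N + t Ṅ`, `0 ≤ t ≤ 1`, stays in the set of matrices of rank `p`. -/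
def StaysFullRank (z η : Pair m n p) : Prop :=
  ∀ t ∈ Set.Icc (0 : ℝ) 1, (z.2 + t • η.2).rank = p

/-- The gradient of `f ∘ π` on the total space. -/
def gradBar (f : Matrix (Fin m) (Fin n) ℝ → ℝ) : Pair m n p → Pair m n p :=
  rgrad (SRp m n p) gBar fun z => f (proj z)

/-- `η` is a horizontal solution of the lifted Newton equation
`P^h (∇̄_η grad (f ∘ π)) = - grad (f ∘ π)` at `z`. -/
def IsLiftedNewtonVector (f : Matrix (Fin m) (Fin n) ℝ → ℝ) (z η : Pair m n p) : Prop :=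
  η ∈ horizontal z ∧ hproj z (nablaBar z η (gradBar f)) = -gradBar f z

end FixedRank

end

open FixedRank

/-! The orthogonal group `O(p)` acts on the total space by `(M, N) ↦ (M Q, N Q)`, isometrically for
`gBar`, and its orbits are exactly the fibers of `proj` (`exists_act_eq`). Hence the vertical
vectors are `(M Ω, N Ω)` with `Ω` skew, and a tangent vector is horizontal when `Ṁᵀ M + Ṅᵀ N` is
symmetric. Removing the vertical part is then a Sylvester equation, uniquely solvable because `Nᵀ N
+ 1` is positive definite. Horizontal lifts, the metric and the derivatives of lifted fields are
equivariant, so whatever is defined on `M_p` through a point of the fiber does not depend on that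
point. Smoothness descends along smooth local sections of `proj` (`exists_section`).

The connection of `M_p` is `Dπ` applied to `nablaBar` of horizontal lifts. It satisfies the axioms
because the lifts are `π`-related to the original fields, and the Koszul-type symmetry argument
`IsLeviCivita.unique` extends the formula to every Levi-Civita connection (`nabla_proj`).

On the total space the geodesic equation is `M'' = -M M'ᵀ M'`, `N'' = 0`. The closed form solves it,
and uniqueness for ordinary differential equations gives the exponential; since `N` moves on a line,
the domain is a rank condition on that line. A geodesic with horizontal initial velocity stays
horizontal, so its projection is a geodesic of `M_p`. For the converse no horizontal lift over the
whole interval is built: near each time a lift with horizontal velocity at that one time suffices,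
because the `O(p)`-invariants `M Nᵀ, Ṁ Nᵀ, M Ṅᵀ, Ṁ Ṅᵀ, M Ṁᵀ, Ṁ Ṁᵀ` of position and lifted velocity
obey a closed polynomial equation, to which uniqueness applies.

For Newton's method, `f ∘ π` is constant on fibers, so its gradient is horizontal and is the lift of
the gradient of `f`. The two Newton equations correspond because `Dπ` is injective on horizontal
vectors and kills the vertical ones. -/

noncomputable section

namespace FixedRank

set_option linter.unusedSectionVars false

/-! ### Derivatives and smoothness of matrix expressions and of the matrix exponential. -/

section MatrixCalculus

variable {l m n : Type*} [Fintype l] [Fintype m] [Fintype n]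

theorem hasDerivAt_matrix_iff {A : ℝ → Matrix l m ℝ} {A' : Matrix l m ℝ} {t : ℝ} :
    HasDerivAt A A' t ↔ ∀ i j, HasDerivAt (fun s => A s i j) (A' i j) t :=
  hasDerivAt_pi.trans (forall_congr' fun _ => hasDerivAt_pi)

theorem hasDerivAt_matrix_mul {A : ℝ → Matrix l m ℝ} {B : ℝ → Matrix m n ℝ}
    {A' : Matrix l m ℝ} {B' : Matrix m n ℝ} {t : ℝ} (hA : HasDerivAt A A' t)
    (hB : HasDerivAt B B' t) : HasDerivAt (fun s => A s * B s) (A' * B t + A t * B') t := by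
  rw [hasDerivAt_matrix_iff] at *
  intro i j
  simp only [Matrix.add_apply, Matrix.mul_apply, ← Finset.sum_add_distrib]
  exact HasDerivAt.fun_sum fun k _ => (hA i k).mul (hB k j)

theorem hasDerivAt_transpose {A : ℝ → Matrix l m ℝ} {A' : Matrix l m ℝ} {t : ℝ}
    (hA : HasDerivAt A A' t) : HasDerivAt (fun s => (A s)ᵀ) A'ᵀ t := by
  rw [hasDerivAt_matrix_iff] at *
  exact fun i j => hA j i

theorem hasDerivAt_trace {A : ℝ → Matrix l l ℝ} {A' : Matrix l l ℝ} {t : ℝ}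
    (hA : HasDerivAt A A' t) : HasDerivAt (fun s => (A s).trace) A'.trace t := by
  rw [hasDerivAt_matrix_iff] at hA
  exact HasDerivAt.fun_sum fun k _ => hA k k

/-- The sup norm in force on matrices is not submultiplicative. The facts are therefore proved in an
abstract normed algebra and applied to matrices with an operator norm, differentiability depending
only on the topology. The commutation relation comes from comparing the left and right forms of the
same derivative. -/
theorem hasDerivAt_exp_smul_of_finiteDimensional {𝔸 : Type*} [NormedRing 𝔸] [NormedAlgebra ℝ 𝔸]
    [FiniteDimensional ℝ 𝔸] (A : 𝔸) (t : ℝ) :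
    HasDerivAt (fun s : ℝ => NormedSpace.exp (s • A)) (NormedSpace.exp (t • A) * A) t ∧
      NormedSpace.exp (t • A) * A = A * NormedSpace.exp (t • A) := by
  have : CompleteSpace 𝔸 := FiniteDimensional.complete ℝ _
  exact ⟨hasDerivAt_exp_smul_const (𝕂 := ℝ) A t, (hasDerivAt_exp_smul_const (𝕂 := ℝ) A t).unique
    (hasDerivAt_exp_smul_const' (𝕂 := ℝ) A t)⟩

theorem hasDerivAt_exp_smul_matrix [DecidableEq n] (A : Matrix n n ℝ) (t : ℝ) :
    HasDerivAt (fun s : ℝ => NormedSpace.exp (s • A)) (NormedSpace.exp (t • A) * A) t :=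
  (@hasDerivAt_exp_smul_of_finiteDimensional _ (Matrix.linftyOpNormedRing (n := n) (α := ℝ))
    (Matrix.linftyOpNormedAlgebra (R := ℝ) (n := n) (α := ℝ)) inferInstance A t).1

theorem hasDerivAt_exp_neg_smul_matrix [DecidableEq n] (A : Matrix n n ℝ) (t : ℝ) :
    HasDerivAt (fun s : ℝ => NormedSpace.exp (-(s • A))) (-(NormedSpace.exp (-(t • A)) * A)) t := by
  simpa using hasDerivAt_exp_smul_matrix (-A) t

theorem commute_exp_smul [DecidableEq n] (A : Matrix n n ℝ) (t : ℝ) :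
    NormedSpace.exp (t • A) * A = A * NormedSpace.exp (t • A) :=
  (@hasDerivAt_exp_smul_of_finiteDimensional _ (Matrix.linftyOpNormedRing (n := n) (α := ℝ))
    (Matrix.linftyOpNormedAlgebra (R := ℝ) (n := n) (α := ℝ)) inferInstance A t).2

variable {E : Type*} [NormedAddCommGroup E] [NormedSpace ℝ E] {s : Set E} {x : E} {k : ℕ∞ω}

theorem contDiffWithinAt_matrix_iff {A : E → Matrix l m ℝ} :
    ContDiffWithinAt ℝ k A s x ↔ ∀ i j, ContDiffWithinAt ℝ k (fun y => A y i j) s x :=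
  contDiffWithinAt_pi.trans (forall_congr' fun _ => contDiffWithinAt_pi)

@[fun_prop]
theorem contDiffWithinAt_mul {A : E → Matrix l m ℝ} {B : E → Matrix m n ℝ}
    (hA : ContDiffWithinAt ℝ k A s x) (hB : ContDiffWithinAt ℝ k B s x) :
    ContDiffWithinAt ℝ k (fun y => A y * B y) s x := by
  rw [contDiffWithinAt_matrix_iff] at *
  intro i j
  simp only [Matrix.mul_apply]
  exact ContDiffWithinAt.sum fun r _ => (hA i r).mul (hB r j)

@[fun_prop]
theorem contDiffAt_mul {A : E → Matrix l m ℝ} {B : E → Matrix m n ℝ}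
    (hA : ContDiffAt ℝ k A x) (hB : ContDiffAt ℝ k B x) :
    ContDiffAt ℝ k (fun y => A y * B y) x :=
  contDiffWithinAt_univ.1 (contDiffWithinAt_mul hA hB)

@[fun_prop]
theorem contDiffOn_mul {A : E → Matrix l m ℝ} {B : E → Matrix m n ℝ}
    (hA : ContDiffOn ℝ k A s) (hB : ContDiffOn ℝ k B s) :
    ContDiffOn ℝ k (fun y => A y * B y) s :=
  fun y hy => contDiffWithinAt_mul (hA y hy) (hB y hy)

@[fun_prop]
theorem contDiff_mul {A : E → Matrix l m ℝ} {B : E → Matrix m n ℝ}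
    (hA : ContDiff ℝ k A) (hB : ContDiff ℝ k B) :
    ContDiff ℝ k (fun y => A y * B y) :=
  contDiffOn_univ.1 (contDiffOn_mul hA.contDiffOn hB.contDiffOn)

@[fun_prop]
theorem contDiffWithinAt_transpose {A : E → Matrix l m ℝ}
    (hA : ContDiffWithinAt ℝ k A s x) : ContDiffWithinAt ℝ k (fun y => (A y)ᵀ) s x := by
  rw [contDiffWithinAt_matrix_iff] at *
  exact fun i j => hA j i

@[fun_prop]
theorem contDiffAt_transpose {A : E → Matrix l m ℝ}
    (hA : ContDiffAt ℝ k A x) : ContDiffAt ℝ k (fun y => (A y)ᵀ) x :=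
  contDiffWithinAt_univ.1 (contDiffWithinAt_transpose hA)

@[fun_prop]
theorem contDiffOn_transpose {A : E → Matrix l m ℝ}
    (hA : ContDiffOn ℝ k A s) : ContDiffOn ℝ k (fun y => (A y)ᵀ) s :=
  fun y hy => contDiffWithinAt_transpose (hA y hy)

@[fun_prop]
theorem contDiff_transpose {A : E → Matrix l m ℝ}
    (hA : ContDiff ℝ k A) : ContDiff ℝ k (fun y => (A y)ᵀ) :=
  contDiffOn_univ.1 (contDiffOn_transpose hA.contDiffOn)

theorem contDiffWithinAt_trace {A : E → Matrix l l ℝ}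
    (hA : ContDiffWithinAt ℝ k A s x) : ContDiffWithinAt ℝ k (fun y => (A y).trace) s x := by
  rw [contDiffWithinAt_matrix_iff] at *
  exact ContDiffWithinAt.sum fun i _ => hA i i

theorem contDiffWithinAt_det [DecidableEq l] {A : E → Matrix l l ℝ}
    (hA : ContDiffWithinAt ℝ k A s x) : ContDiffWithinAt ℝ k (fun y => (A y).det) s x := by
  rw [contDiffWithinAt_matrix_iff] at hA
  simp only [Matrix.det_apply]
  refine ContDiffWithinAt.sum fun σ _ => ContDiffWithinAt.const_smul _ ?_
  exact contDiffWithinAt_prod fun i _ => hA _ _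

theorem contDiffWithinAt_inv [DecidableEq l] {A : E → Matrix l l ℝ}
    (hA : ContDiffWithinAt ℝ k A s x) (hx : IsUnit (A x).det) :
    ContDiffWithinAt ℝ k (fun y => (A y)⁻¹) s x := by
  simp only [Matrix.inv_def, Ring.inverse_eq_inv']
  refine ((contDiffWithinAt_det hA).inv hx.ne_zero).smul ?_
  rw [contDiffWithinAt_matrix_iff] at *
  intro i j
  simp only [Matrix.adjugate_apply]
  refine contDiffWithinAt_det (contDiffWithinAt_matrix_iff.2 fun a b => ?_)
  -- An adjugate entry is the determinant of the matrix with one row replaced by a constant row, so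
  -- each entry is either constant or an entry of `A`.
  by_cases h : a = j
  · subst h
    simpa using contDiffWithinAt_const
  · simpa [h] using hA a b

theorem continuous_det' [DecidableEq l] : Continuous fun A : Matrix l l ℝ => A.det :=
  continuous_id.matrix_det

/-- Differentiating `exp(sA) B` gives `exp(sA) (A B)`, an expression of the same shape. Carrying an
arbitrary right factor `B` therefore lets the induction on the order of smoothness close. -/
theorem contDiff_exp_smul [DecidableEq n] (A : Matrix n n ℝ) :
    ContDiff ℝ ∞ (fun s : ℝ => NormedSpace.exp (s • A)) := by
  have hd : ∀ B : Matrix n n ℝ, deriv (fun s : ℝ => NormedSpace.exp (s • A) * B) =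
      fun s : ℝ => NormedSpace.exp (s • A) * (A * B) := fun B => funext fun t => by
    have := hasDerivAt_matrix_mul (hasDerivAt_exp_smul_matrix A t) (hasDerivAt_const t B)
    exact this.deriv.trans (by simp [Matrix.mul_assoc])
  have hk : ∀ (k : ℕ) (B : Matrix n n ℝ),
      ContDiff ℝ k (fun s : ℝ => NormedSpace.exp (s • A) * B) := by
    intro k
    have hdiff : ∀ B : Matrix n n ℝ, Differentiable ℝ
        (fun s : ℝ => NormedSpace.exp (s • A) * B) := fun B t =>
      (hasDerivAt_matrix_mul (hasDerivAt_exp_smul_matrix A t)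
        (hasDerivAt_const t B)).differentiableAt
    induction k with
    | zero => exact fun B => contDiff_zero.2 (hdiff B).continuous
    | succ k ih =>
      intro B
      have := (contDiff_succ_iff_deriv (n := (k : ℕ∞ω)) (𝕜 := ℝ)
        (f := fun s : ℝ => NormedSpace.exp (s • A) * B)).2
        ⟨hdiff B, by simp, by
          have h := ih (A * B)
          rw [← hd B] at h
          exact h⟩
      exact_mod_cast this
  refine contDiff_infty.2 fun k => by simpa using hk k 1

theorem exp_transpose_mul_exp [DecidableEq n] {A : Matrix n n ℝ} (hA : Aᵀ = -A) :
    (NormedSpace.exp A)ᵀ * NormedSpace.exp A = 1 := by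
  rw [← Matrix.exp_transpose, hA, Matrix.exp_neg]
  exact Matrix.nonsing_inv_mul _ ((Matrix.isUnit_iff_isUnit_det _).1 (Matrix.isUnit_exp A))

end MatrixCalculus

/-! ### Curves in a set, and uniqueness for autonomous differential equations. -/

section Curves

variable {E F : Type*} [NormedAddCommGroup E] [NormedSpace ℝ E] [NormedAddCommGroup F]
  [NormedSpace ℝ F] {S : Set E}

theorem hasDerivAt_comp_curve {φ : E → F} {c : ℝ → E} {v : E} {t : ℝ}
    (hφ : DifferentiableWithinAt ℝ φ S (c t)) (hc : HasDerivAt c v t)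
    (hS : ∀ᶠ s in 𝓝 t, c s ∈ S) :
    HasDerivAt (fun s => φ (c s)) (fderivWithin ℝ φ S (c t) v) t :=
  hφ.hasFDerivWithinAt.comp_hasDerivAt t hc hS

theorem contDiffOn_differentiableWithinAt {φ : E → F} (h : ContDiffOn ℝ ∞ φ S) {x : E}
    (hx : x ∈ S) : DifferentiableWithinAt ℝ φ S x :=
  (h x hx).differentiableWithinAt (by simp)

theorem exists_curve_of_mem_tangent {x v : E} (hv : v ∈ tangent S x) :
    ∃ c : ℝ → E, c 0 = x ∧ HasDerivAt c v 0 ∧ (∀ᶠ t in 𝓝 0, c t ∈ S) ∧ ContDiffAt ℝ ∞ c 0 := by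
  obtain ⟨c, ε, hε, hc, hS, h0, hd⟩ := hv
  have : Set.Ioo (-ε) ε ∈ 𝓝 (0 : ℝ) := Ioo_mem_nhds (by linarith) hε
  exact ⟨c, h0, hd, Filter.mem_of_superset this hS, hc.contDiffAt this⟩

theorem mem_tangent_of_curve {c : ℝ → E} {v : E} {t : ℝ}
    (hd : HasDerivAt c v t) (hS : ∀ᶠ s in 𝓝 t, c s ∈ S)
    (hn : ∀ᶠ s in 𝓝 t, ContDiffAt ℝ ∞ c s) : v ∈ tangent S (c t) := by
  obtain ⟨ε, hε, h⟩ := Metric.eventually_nhds_iff_ball.1 (hS.and hn)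
  have key : ∀ s ∈ Set.Ioo (-ε) ε, t + s ∈ Metric.ball t ε := fun s hs => by
    simpa [abs_lt] using hs
  refine ⟨fun s => c (t + s), ε, hε, fun s hs => ?_, fun s hs => (h _ (key s hs)).1, by simp, ?_⟩
  · have h1 : ContDiffAt ℝ ∞ (fun s : ℝ => t + s) s := by fun_prop
    exact (ContDiffAt.comp s (h _ (key s hs)).2 h1).contDiffWithinAt
  · have h1 : HasDerivAt (fun s : ℝ => t + s) 1 0 := (hasDerivAt_id (0 : ℝ)).const_add t
    have hd' : HasDerivAt c v (t + 0) := by simpa using hd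
    have := hd'.scomp (0 : ℝ) h1
    rw [one_smul] at this
    exact this

/-- Solutions of an autonomous equation with a smooth right-hand side are unique. -/
theorem eqOn_of_hasDerivAt [FiniteDimensional ℝ E] {Φ : E → E} (hΦ : ContDiff ℝ 1 Φ)
    {f g : ℝ → E} (hf : ∀ t ∈ Set.Icc (0 : ℝ) 1, HasDerivAt f (Φ (f t)) t)
    (hg : ∀ t ∈ Set.Icc (0 : ℝ) 1, HasDerivAt g (Φ (g t)) t) (h0 : f 0 = g 0) :
    Set.EqOn f g (Set.Icc 0 1) := by
  have hfc : ContinuousOn f (Set.Icc 0 1) := fun t ht => (hf t ht).continuousAt.continuousWithinAt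
  have hgc : ContinuousOn g (Set.Icc 0 1) := fun t ht => (hg t ht).continuousAt.continuousWithinAt
  -- Both trajectories over `[0, 1]` lie in one closed ball. It is compact and convex, so a bound on
  -- the derivative there makes `Φ` Lipschitz on it.
  have hb := (isCompact_Icc.image_of_continuousOn hfc).isBounded.union
    (isCompact_Icc.image_of_continuousOn hgc).isBounded
  obtain ⟨R, hR⟩ := hb.subset_closedBall 0
  have := FiniteDimensional.proper ℝ E
  have hK : IsCompact (Metric.closedBall (0 : E) R) := isCompact_closedBall 0 R
  obtain ⟨C, hC⟩ := hK.exists_bound_of_continuousOn (hΦ.continuous_fderiv one_ne_zero).continuousOn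
  have hL : LipschitzOnWith C.toNNReal Φ (Metric.closedBall (0 : E) R) := by
    refine Convex.lipschitzOnWith_of_nnnorm_fderiv_le (𝕜 := ℝ)
      (fun x _ => hΦ.differentiable one_ne_zero x) (fun x hx => ?_) (convex_closedBall 0 R)
    rw [← NNReal.coe_le_coe, coe_nnnorm]
    exact (hC x hx).trans (Real.le_coe_toNNReal C)
  refine ODE_solution_unique_of_mem_Icc_right (v := fun _ => Φ)
    (s := fun _ => Metric.closedBall (0 : E) R) (fun _ _ => hL) hfc
    (fun t ht => (hf t (Set.Ico_subset_Icc_self ht)).hasDerivWithinAt)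
    (fun t ht => hR (Or.inl ⟨t, Set.Ico_subset_Icc_self ht, rfl⟩)) hgc
    (fun t ht => (hg t (Set.Ico_subset_Icc_self ht)).hasDerivWithinAt)
    (fun t ht => hR (Or.inr ⟨t, Set.Ico_subset_Icc_self ht, rfl⟩)) h0

end Curves

/-! ### Rank factorisations, the orthogonal action and the Sylvester equation. -/

section LinearAlgebra

theorem trace_transpose_mul_self_eq {k l : Type*} [Fintype k] [Fintype l] (A : Matrix k l ℝ) :
    (Aᵀ * A).trace = ∑ j, ∑ i, A i j ^ 2 := by
  simp [Matrix.trace, Matrix.mul_apply, sq]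

theorem trace_transpose_mul_self_nonneg {k l : Type*} [Fintype k] [Fintype l] (A : Matrix k l ℝ) :
    0 ≤ (Aᵀ * A).trace := by
  rw [trace_transpose_mul_self_eq]
  positivity

theorem eq_zero_of_trace_transpose_mul_self {k l : Type*} [Fintype k] [Fintype l]
    {A : Matrix k l ℝ} (h : (Aᵀ * A).trace ≤ 0) : A = 0 := by
  have h0 := le_antisymm h (trace_transpose_mul_self_nonneg A)
  rw [trace_transpose_mul_self_eq, Finset.sum_eq_zero_iff_of_nonneg
    (fun _ _ => Finset.sum_nonneg fun _ _ => sq_nonneg _)] at h0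
  ext i j
  have := (Finset.sum_eq_zero_iff_of_nonneg (fun _ _ => sq_nonneg _)).1 (h0 j (Finset.mem_univ j))
    i (Finset.mem_univ i)
  simpa using this

variable {m n p : ℕ}

theorem isUnit_det_of_rank {A : Matrix (Fin p) (Fin p) ℝ} (h : A.rank = p) : IsUnit A.det := by
  rw [← Matrix.isUnit_iff_isUnit_det, ← Matrix.mulVec_surjective_iff_isUnit]
  have : LinearMap.range A.mulVecLin = ⊤ := by
    apply Submodule.eq_top_of_finrank_eq
    simpa [Matrix.rank] using h
  exact LinearMap.range_eq_top.1 this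

/-- Full rank becomes the nonvanishing of a polynomial, which yields openness, and an invertible
Gram matrix, which yields the right inverse `N (Nᵀ N)⁻¹` of `Nᵀ`. -/
theorem rank_eq_iff_isUnit_gram {N : Matrix (Fin n) (Fin p) ℝ} :
    N.rank = p ↔ IsUnit (Nᵀ * N).det := by
  rw [← Matrix.rank_transpose_mul_self]
  refine ⟨isUnit_det_of_rank, fun h => ?_⟩
  rw [Matrix.rank_of_isUnit _ ((Matrix.isUnit_iff_isUnit_det _).2 h), Fintype.card_fin]

theorem isOpen_rank_eq : IsOpen {N : Matrix (Fin n) (Fin p) ℝ | N.rank = p} := by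
  have : {N : Matrix (Fin n) (Fin p) ℝ | N.rank = p} =
      (fun N : Matrix (Fin n) (Fin p) ℝ => (Nᵀ * N).det) ⁻¹' {0}ᶜ := by
    ext N
    simp [rank_eq_iff_isUnit_gram]
  rw [this]
  refine IsOpen.preimage ?_ isOpen_compl_singleton
  exact Continuous.matrix_det (by fun_prop)

theorem gram_mul_inv {N : Matrix (Fin n) (Fin p) ℝ} (h : N.rank = p) :
    (Nᵀ * N) * (Nᵀ * N)⁻¹ = 1 := Matrix.mul_nonsing_inv _ (rank_eq_iff_isUnit_gram.1 h)

theorem rank_of_stiefel {M : Matrix (Fin m) (Fin p) ℝ} (h : Mᵀ * M = 1) : M.rank = p := by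
  rw [rank_eq_iff_isUnit_gram, h]
  simp

/-- `N (Nᵀ N)⁻¹` is a right inverse of `Nᵀ`, so `M` is recovered from `M Nᵀ` by right multiplication
and the rank cannot drop. -/
theorem rank_mul_transpose {M : Matrix (Fin m) (Fin p) ℝ} {N : Matrix (Fin n) (Fin p) ℝ}
    (hM : M.rank = p) (hN : N.rank = p) : (M * Nᵀ).rank = p := by
  refine le_antisymm ((Matrix.rank_mul_le_left _ _).trans hM.le) ?_
  have h1 : M = M * Nᵀ * (N * (Nᵀ * N)⁻¹) := by
    rw [Matrix.mul_assoc, ← Matrix.mul_assoc Nᵀ, gram_mul_inv hN, Matrix.mul_one]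
  calc p = M.rank := hM.symm
    _ = (M * Nᵀ * (N * (Nᵀ * N)⁻¹)).rank := by rw [← h1]
    _ ≤ _ := Matrix.rank_mul_le_left _ _

theorem proj_mem {z : Pair m n p} (hz : z ∈ SRp m n p) : proj z ∈ Mp m n p :=
  rank_mul_transpose (rank_of_stiefel hz.1) hz.2

theorem rank_of_rank_mul_transpose {M : Matrix (Fin m) (Fin p) ℝ} {N : Matrix (Fin n) (Fin p) ℝ}
    (h : (M * Nᵀ).rank = p) : N.rank = p := by
  refine le_antisymm ((Matrix.rank_le_card_width _).trans (by simp)) ?_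
  calc p = (M * Nᵀ).rank := h.symm
    _ ≤ Nᵀ.rank := Matrix.rank_mul_le_right _ _
    _ = N.rank := Matrix.rank_transpose _

/-- Let the columns of `M` be an orthonormal basis of the column space of `X`. Then `M Mᵀ` fixes
`X`, and `N = Xᵀ M` completes the factorisation. -/
theorem exists_proj_eq {X : Matrix (Fin m) (Fin n) ℝ} (hX : X ∈ Mp m n p) :
    ∃ z ∈ SRp m n p, proj z = X := by
  let R := LinearMap.range (Matrix.toEuclideanLin X)
  have hR : Module.finrank ℝ R = p := by
    rw [← show X.rank = p from hX, Matrix.rank_eq_finrank_range_toLin X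
      (EuclideanSpace.basisFun (Fin m) ℝ).toBasis (EuclideanSpace.basisFun (Fin n) ℝ).toBasis]
    rw [← Matrix.toEuclideanLin_eq_toLin_orthonormal]
  let b := (stdOrthonormalBasis ℝ R).reindex (finCongr hR)
  let M : Matrix (Fin m) (Fin p) ℝ := Matrix.of fun i k => (b k : EuclideanSpace ℝ (Fin m)) i
  have hM : Mᵀ * M = 1 := by
    ext i j
    have := orthonormal_iff_ite.1 b.orthonormal i j
    rw [Submodule.coe_inner, PiLp.inner_apply] at this
    rw [Matrix.mul_apply, Matrix.one_apply, ← this]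
    exact Finset.sum_congr rfl fun k _ => mul_comm _ _
  have hMX : M * (Mᵀ * X) = X := by
    ext i j
    have hm : Matrix.toEuclideanLin X (EuclideanSpace.single j 1) ∈ R := LinearMap.mem_range_self _ _
    have hs := b.sum_repr ⟨_, hm⟩
    have hs' := congrArg (fun v : R => (v : EuclideanSpace ℝ (Fin m)) i) hs
    have hx : ∀ i, (Matrix.toEuclideanLin X (EuclideanSpace.single j 1)) i = X i j := fun i => by
      simp [Matrix.toLpLin_apply]
    have hc : ∀ k, b.repr ⟨_, hm⟩ k = (Mᵀ * X) k j := fun k => by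
      rw [b.repr_apply_apply, Submodule.coe_inner, PiLp.inner_apply, Matrix.mul_apply]
      refine Finset.sum_congr rfl fun i _ => ?_
      rw [hx]
      exact mul_comm _ _
    rw [hx, Submodule.coe_sum, WithLp.ofLp_sum, Finset.sum_apply] at hs'
    rw [← hs', Matrix.mul_apply]
    refine Finset.sum_congr rfl fun k _ => ?_
    rw [hc]
    exact mul_comm _ _
  refine ⟨(M, Xᵀ * M), ⟨hM, ?_⟩, ?_⟩
  · refine rank_of_rank_mul_transpose (M := M) ?_
    rw [Matrix.transpose_mul, Matrix.transpose_transpose, hMX]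
    exact hX
  · simp only [proj]
    rw [Matrix.transpose_mul, Matrix.transpose_transpose, hMX]

/-- The right action of a matrix on both factors. -/
def act (z : Pair m n p) (Q : Matrix (Fin p) (Fin p) ℝ) : Pair m n p := (z.1 * Q, z.2 * Q)

theorem act_mem {z : Pair m n p} (hz : z ∈ SRp m n p) {Q : Matrix (Fin p) (Fin p) ℝ}
    (hQ : Qᵀ * Q = 1) : act z Q ∈ SRp m n p := by
  have h := hz.1
  simp only [Stiefel, Set.mem_ofPred_eq] at h
  refine ⟨?_, ?_⟩
  · simp only [Stiefel, act, Set.mem_ofPred_eq]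
    rw [Matrix.transpose_mul, Matrix.mul_assoc, ← Matrix.mul_assoc z.1ᵀ, h, Matrix.one_mul, hQ]
  · simp only [act]
    rw [Matrix.rank_mul_eq_left_of_isUnit_det]
    · exact hz.2
    · exact IsUnit.of_mul_eq_one_right Qᵀ.det (by rw [← Matrix.det_mul, hQ, Matrix.det_one])

theorem proj_act (z : Pair m n p) {Q : Matrix (Fin p) (Fin p) ℝ} (hQ : Qᵀ * Q = 1) :
    proj (act z Q) = proj z := by
  have hQ' : Q * Qᵀ = 1 := mul_eq_one_comm.1 hQ
  simp only [proj, act]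
  rw [Matrix.transpose_mul, Matrix.mul_assoc, ← Matrix.mul_assoc Q, hQ', Matrix.one_mul]

/-- Cancelling `w.2ᵀ` by its right inverse puts the columns of `w.1` in the column space of `z.1`.
The change of basis `z.1ᵀ * w.1` between two orthonormal systems spanning the same space is
orthogonal. -/
theorem exists_act_eq {z w : Pair m n p} (hz : z ∈ SRp m n p) (hw : w ∈ SRp m n p)
    (h : proj w = proj z) : ∃ Q : Matrix (Fin p) (Fin p) ℝ, Qᵀ * Q = 1 ∧ w = act z Q := by
  have hz1 : z.1ᵀ * z.1 = 1 := hz.1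
  have hw1 : w.1ᵀ * w.1 = 1 := hw.1
  simp only [proj] at h
  have hw' : w.1 = z.1 * (z.2ᵀ * (w.2 * (w.2ᵀ * w.2)⁻¹)) := by
    rw [← Matrix.mul_assoc, ← h, Matrix.mul_assoc, ← Matrix.mul_assoc w.2ᵀ, gram_mul_inv hw.2,
      Matrix.mul_one]
  have hQ : z.1 * (z.1ᵀ * w.1) = w.1 := by
    rw [hw', ← Matrix.mul_assoc z.1ᵀ, hz1, Matrix.one_mul]
  refine ⟨z.1ᵀ * w.1, ?_, Prod.ext hQ.symm ?_⟩
  · rw [Matrix.transpose_mul, Matrix.transpose_transpose, Matrix.mul_assoc, hQ, hw1]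
  · simp only [act]
    apply Matrix.transpose_injective
    rw [Matrix.transpose_mul, Matrix.transpose_mul, Matrix.transpose_transpose, Matrix.mul_assoc, ← h,
      ← Matrix.mul_assoc, hw1, Matrix.one_mul]

/-- Pairing the equation with `Ω` in the trace inner product gives `‖N Ω‖² + ‖N Ωᵀ‖² + 2 ‖Ω‖² = 0`.
-/
theorem sylvester_injective (N : Matrix (Fin n) (Fin p) ℝ) {Ω : Matrix (Fin p) (Fin p) ℝ}
    (h : (Nᵀ * N + 1) * Ω + Ω * (Nᵀ * N + 1) = 0) : Ω = 0 := by
  have h1 : (Ωᵀ * ((Nᵀ * N + 1) * Ω + Ω * (Nᵀ * N + 1))).trace = 0 := by simp [h]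
  have e : (Ωᵀ * ((Nᵀ * N + 1) * Ω + Ω * (Nᵀ * N + 1))).trace =
      ((N * Ω)ᵀ * (N * Ω)).trace + (Ωᵀ * Ω).trace + ((N * Ωᵀ)ᵀ * (N * Ωᵀ)).trace
        + (Ωᵀ * Ω).trace := by
    have e3 : ((N * Ωᵀ)ᵀ * (N * Ωᵀ)).trace = (Ωᵀ * (Ω * (Nᵀ * N))).trace := by
      rw [Matrix.transpose_mul, Matrix.transpose_transpose, ← Matrix.mul_assoc,
        Matrix.trace_mul_comm, Matrix.mul_assoc Ω]
    rw [e3]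
    simp only [Matrix.transpose_mul, Matrix.mul_add, Matrix.add_mul, Matrix.trace_add,
      Matrix.mul_one, Matrix.one_mul, Matrix.mul_assoc]
    ring
  rw [e] at h1
  have a1 := trace_transpose_mul_self_nonneg (N * Ω)
  have a2 := trace_transpose_mul_self_nonneg (N * Ωᵀ)
  exact eq_zero_of_trace_transpose_mul_self (by linarith)

/-- The matrix of the operator `Ω ↦ GΩ + ΩG`. -/
def sylvesterMatrix (G : Matrix (Fin p) (Fin p) ℝ) :
    Matrix (Fin p × Fin p) (Fin p × Fin p) ℝ :=
  Matrix.of fun a b => G a.1 b.1 * (1 : Matrix (Fin p) (Fin p) ℝ) b.2 a.2 +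
    (1 : Matrix (Fin p) (Fin p) ℝ) a.1 b.1 * G b.2 a.2

/-- Vectorising the operator expresses the solution through a matrix inverse, so that its smooth
dependence on `N` and on the right-hand side can be read off from that of the inverse. -/
theorem sylvesterMatrix_mulVec (G Ω : Matrix (Fin p) (Fin p) ℝ) (a : Fin p × Fin p) :
    (sylvesterMatrix G).mulVec (fun b => Ω b.1 b.2) a = (G * Ω + Ω * G) a.1 a.2 := by
  have h : G * Ω + Ω * G = G * Ω * 1 + 1 * Ω * G := by simp
  rw [h, Matrix.mulVec, dotProduct, Fintype.sum_prod_type]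
  simp only [sylvesterMatrix, Matrix.of_apply, add_mul, Finset.sum_add_distrib, Matrix.add_apply]
  congr 1
  all_goals
    rw [Matrix.mul_apply, Finset.sum_comm]
    refine Finset.sum_congr rfl fun j _ => ?_
    rw [Matrix.mul_apply, Finset.sum_mul]
    refine Finset.sum_congr rfl fun i _ => ?_
    ring

theorem isUnit_sylvesterMatrix (N : Matrix (Fin n) (Fin p) ℝ) :
    IsUnit (sylvesterMatrix (Nᵀ * N + 1)).det := by
  rw [← Matrix.isUnit_iff_isUnit_det, ← Matrix.mulVec_injective_iff_isUnit]
  refine (injective_iff_map_eq_zero (Matrix.mulVecLin (sylvesterMatrix (Nᵀ * N + 1)))).2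
    fun v hv => ?_
  have h := sylvester_injective N (Ω := Matrix.of fun i j => v (i, j)) (by
    ext i j
    rw [← sylvesterMatrix_mulVec _ _ (i, j)]
    exact congrFun hv (i, j))
  funext a
  exact congrFun (congrFun h a.1) a.2

/-- The solution `Ω` of `(NᵀN + 1)Ω + Ω(NᵀN + 1) = C`. -/
def sylvester (N : Matrix (Fin n) (Fin p) ℝ) (C : Matrix (Fin p) (Fin p) ℝ) :
    Matrix (Fin p) (Fin p) ℝ :=
  Matrix.of fun i j => (sylvesterMatrix (Nᵀ * N + 1))⁻¹.mulVec (fun b => C b.1 b.2) (i, j)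

theorem sylvester_spec (N : Matrix (Fin n) (Fin p) ℝ) (C : Matrix (Fin p) (Fin p) ℝ) :
    (Nᵀ * N + 1) * sylvester N C + sylvester N C * (Nᵀ * N + 1) = C := by
  ext i j
  rw [← sylvesterMatrix_mulVec _ _ (i, j)]
  have : (fun b : Fin p × Fin p => sylvester N C b.1 b.2) =
    (sylvesterMatrix (Nᵀ * N + 1))⁻¹.mulVec (fun b => C b.1 b.2) := rfl
  rw [this, Matrix.mulVec_mulVec, Matrix.mul_nonsing_inv _ (isUnit_sylvesterMatrix N),
    Matrix.one_mulVec]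

theorem sylvester_unique {N : Matrix (Fin n) (Fin p) ℝ} {C Ω : Matrix (Fin p) (Fin p) ℝ}
    (h : (Nᵀ * N + 1) * Ω + Ω * (Nᵀ * N + 1) = C) : Ω = sylvester N C := by
  rw [← sub_eq_zero]
  refine sylvester_injective N ?_
  rw [Matrix.mul_sub, Matrix.sub_mul]
  rw [sub_add_sub_comm, h, sylvester_spec, sub_self]

/-- Transposing the equation shows that `-Ωᵀ` solves it as well; uniqueness identifies it with `Ω`.
-/
theorem sylvester_skew {N : Matrix (Fin n) (Fin p) ℝ} {C : Matrix (Fin p) (Fin p) ℝ}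
    (h : Cᵀ = -C) : (sylvester N C)ᵀ = -sylvester N C := by
  have h1 := congrArg Matrix.transpose (sylvester_spec N C)
  simp only [Matrix.transpose_add, Matrix.transpose_mul, Matrix.transpose_transpose,
    Matrix.transpose_one, h] at h1
  have h2 : (Nᵀ * N + 1) * (-(sylvester N C)ᵀ) + (-(sylvester N C)ᵀ) * (Nᵀ * N + 1) = C := by
    rw [Matrix.mul_neg, Matrix.neg_mul, ← neg_add, add_comm, h1, neg_neg]
  rw [← neg_eq_iff_eq_neg]
  exact sylvester_unique h2

variable {E : Type*} [NormedAddCommGroup E] [NormedSpace ℝ E] {s : Set E} {x : E}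

theorem contDiffWithinAt_sylvester {N : E → Matrix (Fin n) (Fin p) ℝ}
    {C : E → Matrix (Fin p) (Fin p) ℝ} (hN : ContDiffWithinAt ℝ ∞ N s x)
    (hC : ContDiffWithinAt ℝ ∞ C s x) :
    ContDiffWithinAt ℝ ∞ (fun y => sylvester (N y) (C y)) s x := by
  have hG : ContDiffWithinAt ℝ ∞ (fun y => (N y)ᵀ * N y + 1) s x := by fun_prop
  rw [contDiffWithinAt_matrix_iff] at hG hC ⊢
  have h1 : ContDiffWithinAt ℝ ∞ (fun y => sylvesterMatrix ((N y)ᵀ * N y + 1)) s x := by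
    rw [contDiffWithinAt_matrix_iff]
    intro a b
    exact ((hG _ _).mul contDiffWithinAt_const).add (contDiffWithinAt_const.mul (hG _ _))
  have h2 := contDiffWithinAt_matrix_iff.1 (contDiffWithinAt_inv h1 (isUnit_sylvesterMatrix (N x)))
  intro i j
  exact ContDiffWithinAt.sum fun b _ => (h2 (i, j) b).mul (hC b.1 b.2)

end LinearAlgebra

/-! ### The closed form of the geodesics of the total space. -/

section Geodesics

variable {m n p : ℕ}

/-- The generator of the one-parameter group in the closed form of the geodesics. -/
def geodGen (z η : Pair m n p) : Matrix (Fin p ⊕ Fin p) (Fin p ⊕ Fin p) ℝ :=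
  Matrix.fromBlocks (z.1ᵀ * η.1) (-(η.1ᵀ * η.1)) 1 (z.1ᵀ * η.1)

/-- The rotating frame of the closed form of the geodesics. -/
def geodFrame (z η : Pair m n p) (t : ℝ) : Matrix (Fin m) (Fin p ⊕ Fin p) ℝ :=
  Matrix.fromCols z.1 η.1 * NormedSpace.exp (t • geodGen z η)

/-- The geodesic of the total space with initial data `z`, `η`. -/
def geod (z η : Pair m n p) (t : ℝ) : Pair m n p :=
  (geodFrame z η t * Matrix.fromRows (1 : Matrix (Fin p) (Fin p) ℝ) (0 : Matrix (Fin p) (Fin p) ℝ) *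
    NormedSpace.exp (-(t • (z.1ᵀ * η.1))), z.2 + t • η.2)

/-- The velocity of `geod`. -/
def geodVel (z η : Pair m n p) (t : ℝ) : Pair m n p :=
  (geodFrame z η t * Matrix.fromRows (0 : Matrix (Fin p) (Fin p) ℝ) (1 : Matrix (Fin p) (Fin p) ℝ) *
    NormedSpace.exp (-(t • (z.1ᵀ * η.1))), η.2)

theorem geod_one (z η : Pair m n p) : geod z η 1 = expTotal z η := by
  simp [geod, geodFrame, geodGen, expTotal]

theorem geod_zero (z η : Pair m n p) : geod z η 0 = z := by
  ext1 <;> simp [geod, geodFrame, Matrix.fromCols_mul_fromRows]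

theorem geodVel_zero (z η : Pair m n p) : geodVel z η 0 = η := by
  ext1 <;> simp [geodVel, geodFrame, Matrix.fromCols_mul_fromRows]

theorem contDiff_geod (z η : Pair m n p) : ContDiff ℝ ∞ (geod z η) := by
  have h1 := contDiff_exp_smul (geodGen z η)
  have h2 : ContDiff ℝ ∞ (fun t : ℝ => NormedSpace.exp (-(t • (z.1ᵀ * η.1)))) := by
    simpa using contDiff_exp_smul (-(z.1ᵀ * η.1))
  unfold geod geodFrame
  fun_prop

theorem hasDerivAt_geodFrame (z η : Pair m n p) (t : ℝ) :
    HasDerivAt (geodFrame z η) (geodFrame z η t * geodGen z η) t := by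
  have := hasDerivAt_matrix_mul (hasDerivAt_const t (Matrix.fromCols z.1 η.1))
    (hasDerivAt_exp_smul_matrix (geodGen z η) t)
  rw [Matrix.zero_mul, zero_add, ← Matrix.mul_assoc] at this
  exact this

/-- The generator `B` is infinitesimally orthogonal for the Gram matrix `G` of the initial frame,
that is `Bᵀ G + G B = 0`, so the Gram matrix of the moving frame has zero derivative. -/
theorem geodFrame_gram {z η : Pair m n p} (hz : z.1ᵀ * z.1 = 1)
    (hη : z.1ᵀ * η.1 + η.1ᵀ * z.1 = 0) (t : ℝ) :
    (geodFrame z η t)ᵀ * geodFrame z η t =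
      Matrix.fromBlocks 1 (z.1ᵀ * η.1) (η.1ᵀ * z.1) (η.1ᵀ * η.1) := by
  set G := Matrix.fromBlocks 1 (z.1ᵀ * η.1) (η.1ᵀ * z.1) (η.1ᵀ * η.1) with hG
  set B := geodGen z η with hB
  have hA : η.1ᵀ * z.1 = -(z.1ᵀ * η.1) := by rw [add_comm] at hη; exact eq_neg_of_add_eq_zero_left hη
  have hG0 : (Matrix.fromCols z.1 η.1)ᵀ * Matrix.fromCols z.1 η.1 = G := by
    rw [Matrix.transpose_fromCols, Matrix.fromRows_mul_fromCols, hz]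
  have hBG : Bᵀ * G + G * B = 0 := by
    simp only [hB, geodGen, hG, Matrix.fromBlocks_transpose, Matrix.fromBlocks_multiply,
      Matrix.fromBlocks_add, Matrix.transpose_mul, Matrix.transpose_transpose,
      Matrix.transpose_neg, Matrix.transpose_one, hA, Matrix.mul_one, Matrix.one_mul,
      Matrix.neg_mul, Matrix.mul_neg]
    rw [← Matrix.fromBlocks_zero]
    congr 1 <;> abel
  have hd : ∀ s, HasDerivAt (fun s => (geodFrame z η s)ᵀ * geodFrame z η s) 0 s := fun s => by
    have hc := commute_exp_smul B s
    set e := NormedSpace.exp (s • B) with he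
    have h := hasDerivAt_matrix_mul (hasDerivAt_transpose (hasDerivAt_geodFrame z η s))
      (hasDerivAt_geodFrame z η s)
    convert h using 1
    have : geodFrame z η s = Matrix.fromCols z.1 η.1 * e := rfl
    rw [this, ← hB]
    calc (0 : Matrix _ _ ℝ) = eᵀ * (Bᵀ * G + G * B) * e := by rw [hBG]; simp
      _ = (B * e)ᵀ * G * e + eᵀ * G * (B * e) := by
          rw [Matrix.transpose_mul]; simp only [Matrix.mul_add, Matrix.add_mul, Matrix.mul_assoc]
      _ = _ := by
          rw [← hc, ← hG0]
          simp only [Matrix.transpose_mul, Matrix.mul_assoc]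
  have hconst := is_const_of_deriv_eq_zero (fun s => (hd s).differentiableAt)
    (fun s => (hd s).deriv) t 0
  rw [hconst]
  simpa [geodFrame] using hG0

variable {z η : Pair m n p}

theorem exp_neg_smul_orthogonal (hη : z.1ᵀ * η.1 + η.1ᵀ * z.1 = 0) (t : ℝ) :
    (NormedSpace.exp (-(t • (z.1ᵀ * η.1))))ᵀ * NormedSpace.exp (-(t • (z.1ᵀ * η.1))) = 1 := by
  refine exp_transpose_mul_exp ?_
  rw [Matrix.transpose_neg, Matrix.transpose_smul, Matrix.transpose_mul,
    Matrix.transpose_transpose, ← smul_neg]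
  rw [add_comm] at hη
  rw [eq_neg_of_add_eq_zero_left hη]
  simp

/-- The first block column of the generator is `[1; 0] A + [0; 1]`. The term in `A` cancels against
the derivative of `exp(-tA)`, which commutes with `A`, and only the second half of the frame
remains. -/
theorem hasDerivAt_geod (z η : Pair m n p) (t : ℝ) :
    HasDerivAt (geod z η) (geodVel z η t) t := by
  refine HasDerivAt.prodMk ?_ ?_
  · have h := hasDerivAt_matrix_mul (hasDerivAt_matrix_mul (hasDerivAt_geodFrame z η t)
      (hasDerivAt_const t (Matrix.fromRows (1 : Matrix (Fin p) (Fin p) ℝ)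
        (0 : Matrix (Fin p) (Fin p) ℝ)))) (hasDerivAt_exp_neg_smul_matrix (z.1ᵀ * η.1) t)
    refine h.congr_deriv ?_
    symm
    have hc := commute_exp_smul (-(z.1ᵀ * η.1)) t
    simp only [smul_neg, Matrix.mul_neg, Matrix.neg_mul, neg_inj] at hc
    rw [hc]
    have hB : geodGen z η * Matrix.fromRows (1 : Matrix (Fin p) (Fin p) ℝ)
        (0 : Matrix (Fin p) (Fin p) ℝ) =
        Matrix.fromRows (1 : Matrix (Fin p) (Fin p) ℝ) (0 : Matrix (Fin p) (Fin p) ℝ) *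
          (z.1ᵀ * η.1) + Matrix.fromRows (0 : Matrix (Fin p) (Fin p) ℝ)
            (1 : Matrix (Fin p) (Fin p) ℝ) := by
      rw [geodGen, Matrix.fromBlocks_mul_fromRows, Matrix.fromRows_mul]
      ext (i | i) j <;> simp
    rw [Matrix.mul_assoc (geodFrame z η t) (geodGen z η), hB]
    simp only [Matrix.mul_add, Matrix.add_mul, Matrix.mul_neg, Matrix.mul_zero, add_zero,
      Matrix.mul_assoc]
    abel
  · simpa using ((hasDerivAt_id t).smul_const η.2).const_add z.2

theorem geod_stiefel (hz : z.1ᵀ * z.1 = 1) (hη : z.1ᵀ * η.1 + η.1ᵀ * z.1 = 0) (t : ℝ) :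
    (geod z η t).1ᵀ * (geod z η t).1 = 1 := by
  have h := geodFrame_gram hz hη t
  have he := exp_neg_smul_orthogonal hη t
  simp only [geod]
  set e := NormedSpace.exp (-(t • (z.1ᵀ * η.1)))
  set F := geodFrame z η t
  set R := Matrix.fromRows (1 : Matrix (Fin p) (Fin p) ℝ) (0 : Matrix (Fin p) (Fin p) ℝ) with hR
  have : Rᵀ * (Fᵀ * F) * R = 1 := by
    rw [h, hR, Matrix.transpose_fromRows, Matrix.mul_assoc, Matrix.fromBlocks_mul_fromRows,
      Matrix.fromCols_mul_fromRows]
    simp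
  calc (F * R * e)ᵀ * (F * R * e) = eᵀ * (Rᵀ * (Fᵀ * F) * R) * e := by
        simp only [Matrix.transpose_mul, Matrix.mul_assoc]
    _ = 1 := by rw [this, Matrix.mul_one, he]

theorem geodVel_gram (hz : z.1ᵀ * z.1 = 1) (hη : z.1ᵀ * η.1 + η.1ᵀ * z.1 = 0) (t : ℝ) :
    (geodVel z η t).1ᵀ * (geodVel z η t).1 =
      (NormedSpace.exp (-(t • (z.1ᵀ * η.1))))ᵀ * (η.1ᵀ * η.1) *
        NormedSpace.exp (-(t • (z.1ᵀ * η.1))) := by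
  have h := geodFrame_gram hz hη t
  simp only [geodVel]
  set e := NormedSpace.exp (-(t • (z.1ᵀ * η.1)))
  set F := geodFrame z η t
  set R := Matrix.fromRows (0 : Matrix (Fin p) (Fin p) ℝ) (1 : Matrix (Fin p) (Fin p) ℝ) with hR
  have : Rᵀ * (Fᵀ * F) * R = η.1ᵀ * η.1 := by
    rw [h, hR, Matrix.transpose_fromRows, Matrix.mul_assoc, Matrix.fromBlocks_mul_fromRows,
      Matrix.fromCols_mul_fromRows]
    simp
  calc (F * R * e)ᵀ * (F * R * e) = eᵀ * (Rᵀ * (Fᵀ * F) * R) * e := by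
        simp only [Matrix.transpose_mul, Matrix.mul_assoc]
    _ = _ := by rw [this]

/-- The conserved quantity `Ṁᵀ M` of the geodesic flow, which later keeps velocities horizontal. It
is an off-diagonal block of the constant Gram matrix, conjugated by the orthogonal matrix `exp(-tA)`
that commutes with it. -/
theorem geodVel_mul_geod (hz : z.1ᵀ * z.1 = 1) (hη : z.1ᵀ * η.1 + η.1ᵀ * z.1 = 0) (t : ℝ) :
    (geodVel z η t).1ᵀ * (geod z η t).1 = η.1ᵀ * z.1 := by
  have h := geodFrame_gram hz hη t
  have he := exp_neg_smul_orthogonal hη t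
  have hc := commute_exp_smul (-(z.1ᵀ * η.1)) t
  simp only [smul_neg, Matrix.mul_neg, Matrix.neg_mul, neg_inj] at hc
  simp only [geodVel, geod]
  set e := NormedSpace.exp (-(t • (z.1ᵀ * η.1)))
  set F := geodFrame z η t
  set R := Matrix.fromRows (0 : Matrix (Fin p) (Fin p) ℝ) (1 : Matrix (Fin p) (Fin p) ℝ) with hR
  set R' := Matrix.fromRows (1 : Matrix (Fin p) (Fin p) ℝ) (0 : Matrix (Fin p) (Fin p) ℝ) with hR'
  have : Rᵀ * (Fᵀ * F) * R' = η.1ᵀ * z.1 := by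
    rw [h, hR, hR', Matrix.transpose_fromRows, Matrix.mul_assoc, Matrix.fromBlocks_mul_fromRows,
      Matrix.fromCols_mul_fromRows]
    simp
  have hA : η.1ᵀ * z.1 = -(z.1ᵀ * η.1) := by rw [add_comm] at hη; exact eq_neg_of_add_eq_zero_left hη
  calc (F * R * e)ᵀ * (F * R' * e) = eᵀ * (Rᵀ * (Fᵀ * F) * R') * e := by
        simp only [Matrix.transpose_mul, Matrix.mul_assoc]
    _ = _ := by
      rw [this, hA, Matrix.mul_assoc, Matrix.neg_mul, ← hc, Matrix.mul_neg, ← Matrix.mul_assoc, he,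
        Matrix.one_mul]

/-- The second block column of the generator is `[0; 1] A - [1; 0] S`. As for the position, the term
in `A` cancels; inserting `e eᵀ = 1` turns the remaining term into `-M Ṁᵀ Ṁ`. -/
theorem hasDerivAt_geodVel (hz : z.1ᵀ * z.1 = 1) (hη : z.1ᵀ * η.1 + η.1ᵀ * z.1 = 0) (t : ℝ) :
    HasDerivAt (geodVel z η)
      (-((geod z η t).1 * ((geodVel z η t).1ᵀ * (geodVel z η t).1)), 0) t := by
  refine HasDerivAt.prodMk ?_ (hasDerivAt_const _ _)
  have h := hasDerivAt_matrix_mul (hasDerivAt_matrix_mul (hasDerivAt_geodFrame z η t)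
      (hasDerivAt_const t (Matrix.fromRows (0 : Matrix (Fin p) (Fin p) ℝ)
        (1 : Matrix (Fin p) (Fin p) ℝ)))) (hasDerivAt_exp_neg_smul_matrix (z.1ᵀ * η.1) t)
  refine h.congr_deriv ?_
  symm
  rw [geodVel_gram hz hη]
  have hc := commute_exp_smul (-(z.1ᵀ * η.1)) t
  simp only [smul_neg, Matrix.mul_neg, Matrix.neg_mul, neg_inj] at hc
  have he := mul_eq_one_comm.1 (exp_neg_smul_orthogonal hη t)
  simp only [geod]
  rw [hc]
  set e := NormedSpace.exp (-(t • (z.1ᵀ * η.1)))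
  have hB : geodGen z η * Matrix.fromRows (0 : Matrix (Fin p) (Fin p) ℝ)
      (1 : Matrix (Fin p) (Fin p) ℝ) =
      Matrix.fromRows (0 : Matrix (Fin p) (Fin p) ℝ) (1 : Matrix (Fin p) (Fin p) ℝ) *
        (z.1ᵀ * η.1) - Matrix.fromRows (1 : Matrix (Fin p) (Fin p) ℝ)
          (0 : Matrix (Fin p) (Fin p) ℝ) * (η.1ᵀ * η.1) := by
    rw [geodGen, Matrix.fromBlocks_mul_fromRows, Matrix.fromRows_mul, Matrix.fromRows_mul]
    ext (i | i) j <;> simp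
  rw [Matrix.mul_assoc (geodFrame z η t) (geodGen z η), hB]
  have h2 : ∀ K : Matrix (Fin p) (Fin p) ℝ, e * (eᵀ * K) = K := fun K => by
    rw [← Matrix.mul_assoc, he, Matrix.one_mul]
  simp only [Matrix.mul_sub, Matrix.sub_mul, Matrix.mul_neg, Matrix.mul_zero, add_zero,
    Matrix.mul_assoc, h2]
  abel

theorem eventually_geod_mem (hz : z ∈ SRp m n p) (hη : z.1ᵀ * η.1 + η.1ᵀ * z.1 = 0) :
    ∀ᶠ t in 𝓝 (0 : ℝ), geod z η t ∈ SRp m n p := by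
  have hc : Continuous fun t : ℝ => z.2 + t • η.2 := by fun_prop
  have : ∀ᶠ t in 𝓝 (0 : ℝ), (z.2 + t • η.2).rank = p :=
    hc.continuousAt.eventually_mem (isOpen_rank_eq.mem_nhds (by simpa using hz.2))
  filter_upwards [this] with t ht
  exact ⟨geod_stiefel hz.1 hη t, ht⟩

end Geodesics

/-! ### Tangent, vertical and horizontal vectors of the total space. -/

section TangentSpaces

variable {m n p : ℕ} {z η : Pair m n p}

theorem hasDerivAt_fst {c : ℝ → Pair m n p} {v : Pair m n p} {t : ℝ} (h : HasDerivAt c v t) :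
    HasDerivAt (fun s => (c s).1) v.1 t :=
  (ContinuousLinearMap.fst ℝ (Matrix (Fin m) (Fin p) ℝ) (Matrix (Fin n) (Fin p) ℝ)).hasFDerivAt.comp_hasDerivAt t h

theorem hasDerivAt_snd {c : ℝ → Pair m n p} {v : Pair m n p} {t : ℝ} (h : HasDerivAt c v t) :
    HasDerivAt (fun s => (c s).2) v.2 t :=
  (ContinuousLinearMap.snd ℝ (Matrix (Fin m) (Fin p) ℝ) (Matrix (Fin n) (Fin p) ℝ)).hasFDerivAt.comp_hasDerivAt t h

theorem contDiff_proj : ContDiff ℝ ∞ (proj : Pair m n p → _) := by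
  unfold proj
  fun_prop

theorem hasDerivAt_proj {c : ℝ → Pair m n p} {v : Pair m n p} {t : ℝ} (h : HasDerivAt c v t) :
    HasDerivAt (fun s => proj (c s)) (dproj (c t) v) t :=
  (contDiff_proj.differentiable (by simp) (c t)).hasFDerivAt.comp_hasDerivAt t h

theorem hasDerivAt_proj' {c : ℝ → Pair m n p} {v : Pair m n p} {t : ℝ} (h : HasDerivAt c v t) :
    HasDerivAt (fun s => proj (c s)) (v.1 * (c t).2ᵀ + (c t).1 * v.2ᵀ) t :=
  hasDerivAt_matrix_mul (hasDerivAt_fst h) (hasDerivAt_transpose (hasDerivAt_snd h))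

theorem dproj_eq (z η : Pair m n p) : dproj z η = η.1 * z.2ᵀ + z.1 * η.2ᵀ := by
  have h : HasDerivAt (fun t : ℝ => z + t • η) η 0 := by
    have h := ((hasDerivAt_id (0 : ℝ)).smul_const η).const_add z
    rw [one_smul] at h
    exact h
  simpa using (hasDerivAt_proj h).unique (hasDerivAt_proj' h)

theorem stiefel_deriv {c : ℝ → Pair m n p} {v : Pair m n p} {t : ℝ} (hd : HasDerivAt c v t)
    (hS : ∀ᶠ s in 𝓝 t, c s ∈ SRp m n p) : (c t).1ᵀ * v.1 + v.1ᵀ * (c t).1 = 0 := by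
  have h1 := hasDerivAt_matrix_mul (hasDerivAt_transpose (hasDerivAt_fst hd)) (hasDerivAt_fst hd)
  have h2 : HasDerivAt (fun s => (c s).1ᵀ * (c s).1) 0 t := by
    refine (hasDerivAt_const t (1 : Matrix (Fin p) (Fin p) ℝ)).congr_of_eventuallyEq ?_
    filter_upwards [hS] with s hs using hs.1
  rw [add_comm]
  exact h1.unique h2

/-- Differentiating `Mᵀ M = 1` gives the condition. Conversely, the closed-form geodesic with
velocity `η` is a smooth curve that stays in the total space for small times. -/
theorem mem_tangent_SRp (hz : z ∈ SRp m n p) :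
    η ∈ tangent (SRp m n p) z ↔ z.1ᵀ * η.1 + η.1ᵀ * z.1 = 0 := by
  constructor
  · intro h
    obtain ⟨c, h0, hd, hS, -⟩ := exists_curve_of_mem_tangent h
    simpa [h0] using stiefel_deriv hd hS
  · intro h
    have := mem_tangent_of_curve (S := SRp m n p) (hasDerivAt_geod z η 0) (eventually_geod_mem hz h)
      (Filter.Eventually.of_forall fun t => (contDiff_geod z η).contDiffAt)
    rwa [geod_zero, geodVel_zero] at this

/-- The witness is `Ω = Mᵀ Ṁ`, skew by tangency. Multiplying `Ṁ Nᵀ + M Ṅᵀ = 0` by `Mᵀ` determines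
`Ṅ`; substituting back and cancelling `Nᵀ` by its right inverse determines `Ṁ`. -/
theorem exists_act_of_deriv_proj_eq_zero (hz : z ∈ SRp m n p)
    (ht : z.1ᵀ * η.1 + η.1ᵀ * z.1 = 0) (hp : η.1 * z.2ᵀ + z.1 * η.2ᵀ = 0) :
    ∃ Ω : Matrix (Fin p) (Fin p) ℝ, Ωᵀ = -Ω ∧ η = act z Ω := by
  have hz1 : z.1ᵀ * z.1 = 1 := hz.1
  have hA : η.1ᵀ * z.1 = -(z.1ᵀ * η.1) := eq_neg_of_add_eq_zero_right ht
  refine ⟨z.1ᵀ * η.1, ?_, ?_⟩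
  · rw [Matrix.transpose_mul, Matrix.transpose_transpose, hA]
  · have e2 : η.2 = z.2 * (z.1ᵀ * η.1) := by
      have := congrArg (fun K => z.1ᵀ * K) hp
      simp only [Matrix.mul_add, Matrix.mul_zero] at this
      rw [← Matrix.mul_assoc z.1ᵀ z.1, hz1, Matrix.one_mul] at this
      have h3 := congrArg Matrix.transpose (eq_neg_of_add_eq_zero_right this)
      rw [Matrix.transpose_transpose] at h3
      rw [h3, Matrix.transpose_neg, Matrix.transpose_mul, Matrix.transpose_mul,
        Matrix.transpose_transpose, Matrix.transpose_transpose, Matrix.mul_assoc, hA]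
      simp
    refine Prod.ext ?_ e2
    simp only [act]
    have h4 : (η.1 - z.1 * (z.1ᵀ * η.1)) * z.2ᵀ = 0 := by
      rw [e2, Matrix.transpose_mul, Matrix.transpose_mul, Matrix.transpose_transpose, hA] at hp
      rw [Matrix.sub_mul, Matrix.mul_assoc z.1, sub_eq_add_neg]
      simpa using hp
    have h5 := congrArg (fun K => K * (z.2 * (z.2ᵀ * z.2)⁻¹)) h4
    simp only [Matrix.zero_mul] at h5
    rw [Matrix.mul_assoc, ← Matrix.mul_assoc z.2ᵀ, gram_mul_inv hz.2, Matrix.mul_one] at h5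
    exact sub_eq_zero.1 h5

/-- A velocity in the fiber is killed by `Dπ`, and that kernel has just been computed. Conversely,
`z exp(tΩ)` stays in the fiber since `exp(tΩ)` is orthogonal. -/
theorem mem_vertical (hz : z ∈ SRp m n p) :
    η ∈ vertical z ↔ ∃ Ω : Matrix (Fin p) (Fin p) ℝ, Ωᵀ = -Ω ∧ η = act z Ω := by
  constructor
  · intro h
    obtain ⟨c, h0, hd, hS, -⟩ := exists_curve_of_mem_tangent h
    have ht := stiefel_deriv hd (hS.mono fun _ h => h.1)
    have hp := (hasDerivAt_proj' hd).unique ((hasDerivAt_const (0 : ℝ) (proj z)).congr_of_eventuallyEq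
      (hS.mono fun _ h => h.2))
    rw [h0] at ht hp
    exact exists_act_of_deriv_proj_eq_zero hz ht hp
  · rintro ⟨Ω, hΩ, rfl⟩
    have hd : ∀ t, HasDerivAt (fun t : ℝ => act z (NormedSpace.exp (t • Ω)))
        (act z (NormedSpace.exp (t • Ω) * Ω)) t := fun t => by
      have h := hasDerivAt_exp_smul_matrix Ω t
      refine HasDerivAt.prodMk ?_ ?_
      · exact (hasDerivAt_matrix_mul (hasDerivAt_const t z.1) h).congr_deriv (by simp)
      · exact (hasDerivAt_matrix_mul (hasDerivAt_const t z.2) h).congr_deriv (by simp)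
    have hc : ContDiff ℝ ∞ (fun t : ℝ => act z (NormedSpace.exp (t • Ω))) := by
      have := contDiff_exp_smul Ω
      unfold act
      fun_prop
    have ho : ∀ t : ℝ, (NormedSpace.exp (t • Ω))ᵀ * NormedSpace.exp (t • Ω) = 1 := fun t =>
      exp_transpose_mul_exp (by rw [Matrix.transpose_smul, hΩ, smul_neg])
    have := mem_tangent_of_curve (S := {w | w ∈ SRp m n p ∧ proj w = proj z}) (hd 0)
      (Filter.Eventually.of_forall fun t => ⟨act_mem hz (ho t), proj_act z (ho t)⟩)
      (Filter.Eventually.of_forall fun t => hc.contDiffAt)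
    simpa [vertical, act] using this

theorem trace_mul_skew_eq_zero {K Ω : Matrix (Fin p) (Fin p) ℝ} (hK : Kᵀ = K) (hΩ : Ωᵀ = -Ω) :
    (K * Ω).trace = 0 := by
  have : (K * Ω).trace = -(K * Ω).trace := by
    nth_rewrite 1 [← Matrix.trace_transpose]
    rw [Matrix.transpose_mul, hK, hΩ, Matrix.neg_mul, Matrix.trace_neg,
      Matrix.trace_mul_comm]
  linarith

theorem gBar_act (z η : Pair m n p) (Ω : Matrix (Fin p) (Fin p) ℝ) :
    gBar z η (act z Ω) = ((η.1ᵀ * z.1 + η.2ᵀ * z.2) * Ω).trace := by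
  simp [gBar, act, Matrix.add_mul, Matrix.mul_assoc]

/-- Pairing with `(M Ω, N Ω)` gives `tr(K Ω)` for `K = Ṁᵀ M + Ṅᵀ N`, and the matrices
trace-orthogonal to all skew `Ω` are the symmetric ones. -/
theorem mem_horizontal (hz : z ∈ SRp m n p) :
    η ∈ horizontal z ↔ z.1ᵀ * η.1 + η.1ᵀ * z.1 = 0 ∧
      (η.1ᵀ * z.1 + η.2ᵀ * z.2)ᵀ = η.1ᵀ * z.1 + η.2ᵀ * z.2 := by
  rw [horizontal, Set.mem_ofPred_eq, mem_tangent_SRp hz]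
  refine and_congr_right fun _ => ?_
  constructor
  · intro h
    generalize hK : η.1ᵀ * z.1 + η.2ᵀ * z.2 = K at *
    -- The test matrix is twice the skew part of `K`; its pairing with `K` is a multiple of its own
    -- squared norm.
    have hs : (K - Kᵀ)ᵀ = -(K - Kᵀ) := by rw [Matrix.transpose_sub, Matrix.transpose_transpose]; abel
    have h1 := h _ ((mem_vertical hz).2 ⟨K - Kᵀ, hs, rfl⟩)
    rw [gBar_act, hK] at h1
    have h2 : ((K - Kᵀ)ᵀ * (K - Kᵀ)).trace = 0 := by
      have h3 : ((K + Kᵀ) * (K - Kᵀ)).trace = 0 := trace_mul_skew_eq_zero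
        (by rw [Matrix.transpose_add, Matrix.transpose_transpose, add_comm]) hs
      rw [hs]
      have : -(K - Kᵀ) * (K - Kᵀ) = (K + Kᵀ) * (K - Kᵀ) - (K * (K - Kᵀ) + K * (K - Kᵀ)) := by
        rw [Matrix.neg_mul, Matrix.sub_mul, Matrix.add_mul]; abel
      rw [this, Matrix.trace_sub, Matrix.trace_add, h3, h1]
      simp
    exact (sub_eq_zero.1 (eq_zero_of_trace_transpose_mul_self h2.le)).symm
  · rintro h v hv
    obtain ⟨Ω, hΩ, rfl⟩ := (mem_vertical hz).1 hv
    rw [gBar_act]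
    exact trace_mul_skew_eq_zero h hΩ

end TangentSpaces

/-! ### Smooth orthonormalisation, retractions and local sections of the projection. -/

section Sections

/-- The inverse function theorem, with the derivative prescribed along lines. It serves to invert
the squaring map of matrices at the identity. -/
theorem exists_local_inverse_of_fderiv_eq_two_smul {E : Type*} [NormedAddCommGroup E]
    [NormedSpace ℝ E] [CompleteSpace E] {q : E → E} (hq : ContDiff ℝ ω q) {e : E}
    (hd : ∀ v, HasDerivAt (fun t : ℝ => q (e + t • v)) ((2 : ℝ) • v) 0) :
    ∃ R : E → E, R (q e) = e ∧ (∀ᶠ y in 𝓝 (q e), ContDiffAt ℝ ∞ R y) ∧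
      (∀ᶠ y in 𝓝 (q e), q (R y) = y) ∧ ∀ᶠ x in 𝓝 e, R (q x) = x := by
  let f' : E ≃L[ℝ] E := ContinuousLinearEquiv.smulLeft (Units.mk0 (2 : ℝ) two_ne_zero)
  have hf : HasFDerivAt q (f' : E →L[ℝ] E) e := by
    have h := (hq.differentiable (by simp) e).hasFDerivAt
    have : fderiv ℝ q e = f' := by
      ext v
      have hl : HasDerivAt (fun t : ℝ => e + t • v) v 0 := by
        have h := ((hasDerivAt_id (0 : ℝ)).smul_const v).const_add e
        rw [one_smul] at h
        exact h
      have h1 := h.comp_hasDerivAt_of_eq (0 : ℝ) hl (by simp)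
      exact h1.unique (hd v)
    rwa [this] at h
  have hs := hq.contDiffAt.hasStrictFDerivAt' hf (by simp)
  refine ⟨hs.localInverse, hs.localInverse_apply_image, ?_, hs.eventually_right_inverse,
    hs.eventually_left_inverse⟩
  -- Order `ω` is used because regularity of that order at a point persists on a neighbourhood,
  -- whereas order `∞` at a point only gives, for each finite order, a neighbourhood depending on
  -- it.
  have h := (hq.contDiffAt (x := e)).to_localInverse hf (by simp)
  filter_upwards [h.eventually (by simp)] with y hy
  exact ContDiffAt.of_le hy (by simp)

variable {m n p : ℕ}

/-- Squaring has derivative `2 v` at the identity. The last clause says that square roots near the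
identity are unique, which is what forces the root of a symmetric matrix to be symmetric. -/
theorem exists_matrix_sqrt : ∃ R : Matrix (Fin p) (Fin p) ℝ → Matrix (Fin p) (Fin p) ℝ,
    R 1 = 1 ∧ (∀ᶠ G in 𝓝 1, ContDiffAt ℝ ∞ R G) ∧ (∀ᶠ G in 𝓝 1, R G * R G = G) ∧
      ∀ᶠ A in 𝓝 1, R (A * A) = A := by
  have : CompleteSpace (Matrix (Fin p) (Fin p) ℝ) := FiniteDimensional.complete ℝ _
  have hq : ContDiff ℝ ω (fun A : Matrix (Fin p) (Fin p) ℝ => A * A) := by fun_prop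
  have := exists_local_inverse_of_fderiv_eq_two_smul hq (e := 1) (fun v => by
    have hl : HasDerivAt (fun t : ℝ => (1 : Matrix (Fin p) (Fin p) ℝ) + t • v) v 0 := by
      have h := ((hasDerivAt_id (0 : ℝ)).smul_const v).const_add 1
      rw [one_smul] at h
      exact h
    refine (hasDerivAt_matrix_mul hl hl).congr_deriv ?_
    simp [two_smul])
  simp only [Matrix.mul_one] at this
  exact this

/-- The map is the polar factor `M (Mᵀ M)^(-1/2)`. It multiplies `M` on the right only, so it
creates no new column directions. -/
theorem exists_orthonormalization {M₀ : Matrix (Fin m) (Fin p) ℝ} (h₀ : M₀ᵀ * M₀ = 1) :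
    ∃ O : Matrix (Fin m) (Fin p) ℝ → Matrix (Fin m) (Fin p) ℝ,
      (∀ᶠ M in 𝓝 M₀, ContDiffAt ℝ ∞ O M ∧ (O M)ᵀ * O M = 1) ∧
      (∀ M, ∃ B : Matrix (Fin p) (Fin p) ℝ, O M = M * B) ∧
        ∀ M, Mᵀ * M = 1 → O M = M := by
  obtain ⟨R, h1, hR, hsq, hinv⟩ := exists_matrix_sqrt (p := p)
  refine ⟨fun M => M * (R (Mᵀ * M))⁻¹, ?_, fun M => ⟨_, rfl⟩, fun M hM => by simp [hM, h1]⟩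
  have hg : Filter.Tendsto (fun M : Matrix (Fin m) (Fin p) ℝ => Mᵀ * M) (𝓝 M₀) (𝓝 1) := by
    have : Continuous fun M : Matrix (Fin m) (Fin p) ℝ => Mᵀ * M := by fun_prop
    simpa [h₀] using this.tendsto M₀
  have hRc : Filter.Tendsto R (𝓝 1) (𝓝 1) := by
    have := hR.self_of_nhds.continuousAt.tendsto
    rwa [h1] at this
  have htr : Filter.Tendsto (fun A : Matrix (Fin p) (Fin p) ℝ => Aᵀ) (𝓝 1) (𝓝 1) := by
    have : Continuous fun A : Matrix (Fin p) (Fin p) ℝ => Aᵀ := by fun_prop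
    simpa using this.tendsto 1
  have hdet : ∀ᶠ A in 𝓝 (1 : Matrix (Fin p) (Fin p) ℝ), A.det ≠ 0 :=
    continuous_det'.continuousAt.eventually_ne (by simp)
  filter_upwards [hg.eventually hR, hg.eventually hsq, hg.eventually (hRc.eventually hdet),
    hg.eventually (hRc.eventually (htr.eventually hinv))] with M a1 a2 a3 a4
  have hu : IsUnit (R (Mᵀ * M)).det := isUnit_iff_ne_zero.2 a3
  refine ⟨?_, ?_⟩
  · have hM : ContDiffAt ℝ ∞ (fun M : Matrix (Fin m) (Fin p) ℝ => Mᵀ * M) M := by fun_prop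
    have h2 : ContDiffAt ℝ ∞ (fun M : Matrix (Fin m) (Fin p) ℝ => R (Mᵀ * M)) M :=
      ContDiffAt.comp (f := fun M : Matrix (Fin m) (Fin p) ℝ => Mᵀ * M) M a1 hM
    have h3 : ContDiffAt ℝ ∞ (fun M : Matrix (Fin m) (Fin p) ℝ => (R (Mᵀ * M))⁻¹) M :=
      contDiffWithinAt_univ.1 (contDiffWithinAt_inv h2 hu)
    fun_prop
  -- The transpose of the root squares to the same symmetric matrix and is also near the identity,
  -- so it is the root.
  · have hs : (R (Mᵀ * M))ᵀ = R (Mᵀ * M) := by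
      rw [← Matrix.transpose_mul, a2, Matrix.transpose_mul, Matrix.transpose_transpose] at a4
      exact a4.symm
    have h5 : (M * (R (Mᵀ * M))⁻¹)ᵀ * (M * (R (Mᵀ * M))⁻¹) =
        (R (Mᵀ * M))⁻¹ * (Mᵀ * M) * (R (Mᵀ * M))⁻¹ := by
      rw [Matrix.transpose_mul, Matrix.transpose_nonsing_inv, hs]
      simp only [Matrix.mul_assoc]
    rw [h5]
    generalize R (Mᵀ * M) = S at *
    rw [← a2, Matrix.mul_assoc, Matrix.mul_assoc, Matrix.mul_nonsing_inv _ hu, Matrix.mul_one,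
      Matrix.nonsing_inv_mul _ hu]

/-- Composition with the retraction extends smooth maps on the total space to open sets, where
ordinary derivatives are available. -/
theorem exists_retraction {z₀ : Pair m n p} (h₀ : z₀ ∈ SRp m n p) :
    ∃ ρ : Pair m n p → Pair m n p,
      (∀ᶠ z in 𝓝 z₀, ContDiffAt ℝ ∞ ρ z ∧ ρ z ∈ SRp m n p) ∧ ∀ z ∈ SRp m n p, ρ z = z := by
  obtain ⟨O, hO, -, hid⟩ := exists_orthonormalization h₀.1
  refine ⟨fun z => (O z.1, z.2), ?_, fun z hz => Prod.ext (hid _ hz.1) rfl⟩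
  filter_upwards [continuous_fst.continuousAt.eventually hO,
    continuous_snd.continuousAt.eventually (isOpen_rank_eq.mem_nhds h₀.2)] with z a1 a2
  refine ⟨?_, a1.2, a2⟩
  exact (a1.1.comp z contDiffAt_fst).prodMk contDiffAt_snd

/-- The map `π` has smooth local sections. -/
theorem exists_section {z₀ : Pair m n p} (h₀ : z₀ ∈ SRp m n p) :
    ∃ σ : Matrix (Fin m) (Fin n) ℝ → Pair m n p, σ (proj z₀) = z₀ ∧
      ∀ᶠ X in 𝓝 (proj z₀), ContDiffAt ℝ ∞ σ X ∧
        (X ∈ Mp m n p → σ X ∈ SRp m n p ∧ proj (σ X) = X) := by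
  obtain ⟨O, hO, hB, hid⟩ := exists_orthonormalization h₀.1
  have h1 : z₀.1ᵀ * z₀.1 = 1 := h₀.1
  -- Right multiplication by `B₀`, a right inverse of `z₀.2ᵀ`, sends `proj z₀` to `z₀.1`; so `X B₀`
  -- is close to `z₀.1` and can be orthonormalised to give the first factor.
  set B₀ := z₀.2 * (z₀.2ᵀ * z₀.2)⁻¹ with hB₀
  have hX₀ : proj z₀ * B₀ = z₀.1 := by
    rw [proj, hB₀, Matrix.mul_assoc, ← Matrix.mul_assoc z₀.2ᵀ, gram_mul_inv h₀.2, Matrix.mul_one]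
  refine ⟨fun X => (O (X * B₀), Xᵀ * O (X * B₀)), ?_, ?_⟩
  · beta_reduce
    rw [hX₀, hid _ h1]
    refine Prod.ext rfl ?_
    simp only [proj]
    rw [Matrix.transpose_mul, Matrix.transpose_transpose, Matrix.mul_assoc, h1, Matrix.mul_one]
  · have ht : Filter.Tendsto (fun X : Matrix (Fin m) (Fin n) ℝ => X * B₀) (𝓝 (proj z₀)) (𝓝 z₀.1) := by
      have : Continuous fun X : Matrix (Fin m) (Fin n) ℝ => X * B₀ := by fun_prop
      simpa [hX₀] using this.tendsto (proj z₀)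
    filter_upwards [ht.eventually hO] with X hX
    refine ⟨?_, fun hr => ?_⟩
    · have h2 : ContDiffAt ℝ ∞ (fun X : Matrix (Fin m) (Fin n) ℝ => X * B₀) X := by fun_prop
      have h3 : ContDiffAt ℝ ∞ (fun X : Matrix (Fin m) (Fin n) ℝ => O (X * B₀)) X := hX.1.comp X h2
      exact h3.prodMk (contDiffAt_mul (contDiffAt_transpose contDiffAt_id) h3)
    · obtain ⟨w, hw, hwX⟩ := exists_proj_eq hr
      have hw1 : w.1ᵀ * w.1 = 1 := hw.1
      obtain ⟨B, hB⟩ := hB (X * B₀)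
      have hO2 := hX.2
      set M := O (X * B₀) with hM
      have hMC : M = w.1 * (w.2ᵀ * B₀ * B) := by
        rw [hB, ← hwX, proj]
        simp only [Matrix.mul_assoc]
      generalize w.2ᵀ * B₀ * B = C at hMC
      -- The matrices `M` and `w.1` have orthonormal columns and `M = w.1 C`, so `C` is orthogonal.
      -- Hence `M Mᵀ = w.1 w.1ᵀ`, which fixes `X`.
      have hC : Cᵀ * C = 1 := by
        rw [hMC, Matrix.transpose_mul, Matrix.mul_assoc, ← Matrix.mul_assoc w.1ᵀ, hw1,
          Matrix.one_mul] at hO2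
        exact hO2
      have hC' : C * Cᵀ = 1 := mul_eq_one_comm.1 hC
      have hpr : M * (Xᵀ * M)ᵀ = X := by
        rw [Matrix.transpose_mul, Matrix.transpose_transpose, hMC, ← hwX, proj,
          Matrix.transpose_mul]
        calc w.1 * C * (Cᵀ * w.1ᵀ * (w.1 * w.2ᵀ)) = w.1 * (C * Cᵀ) * (w.1ᵀ * w.1) * w.2ᵀ := by
              simp only [Matrix.mul_assoc]
          _ = w.1 * w.2ᵀ := by rw [hC', hw1, Matrix.mul_one, Matrix.mul_one]
      refine ⟨⟨hO2, ?_⟩, hpr⟩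
      refine rank_of_rank_mul_transpose (M := M) ?_
      rw [hpr]
      exact hr

variable {F : Type*} [NormedAddCommGroup F] [NormedSpace ℝ F]

/-- Near each point `h` is the composite of `h ∘ π` with a smooth local section. This is how
smoothness descends to the quotient. -/
theorem contDiffOn_Mp_of_comp_proj {h : Matrix (Fin m) (Fin n) ℝ → F}
    (hh : ContDiffOn ℝ ∞ (fun z : Pair m n p => h (proj z)) (SRp m n p)) :
    ContDiffOn ℝ ∞ h (Mp m n p) := by
  intro X hX
  obtain ⟨z, hz, rfl⟩ := exists_proj_eq hX
  obtain ⟨σ, h0, hσ⟩ := exists_section hz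
  have h1 : ContDiffWithinAt ℝ ∞ (fun z : Pair m n p => h (proj z)) (SRp m n p) (σ (proj z)) := by
    rw [h0]
    exact hh z hz
  -- The section takes values in the total space only at matrices of rank `p` near the base point,
  -- hence the restricted domain, which is removed afterwards.
  have h2 := h1.comp_of_mem_nhdsWithin_image (proj z) (s := Mp m n p ∩ {X | X ∈ Mp m n p →
    σ X ∈ SRp m n p ∧ proj (σ X) = X}) hσ.self_of_nhds.1.contDiffWithinAt
    (by
      refine Filter.mem_of_superset self_mem_nhdsWithin ?_
      rintro _ ⟨Y, hY, rfl⟩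
      exact (hY.2 hY.1).1)
  have h3 : {X | X ∈ Mp m n p → σ X ∈ SRp m n p ∧ proj (σ X) = X} ∈ 𝓝 (proj z) :=
    hσ.mono fun _ h => h.2
  rw [contDiffWithinAt_inter h3] at h2
  refine h2.congr_of_eventuallyEq ?_ ?_
  · filter_upwards [self_mem_nhdsWithin, mem_nhdsWithin_of_mem_nhds h3] with Y hY hY'
    simp only [Function.comp, (hY' hY).2]
  · simp [h0]

theorem contDiffOn_comp_proj {h : Matrix (Fin m) (Fin n) ℝ → F} (hh : ContDiffOn ℝ ∞ h (Mp m n p)) :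
    ContDiffOn ℝ ∞ (fun z : Pair m n p => h (proj z)) (SRp m n p) :=
  hh.comp contDiff_proj.contDiffOn fun _ hz => proj_mem hz

/-- Curves in `M_p` are lifted by a local section through `z`, and curves in the total space are
pushed down by `π`. -/
theorem mem_tangent_Mp {z : Pair m n p} (hz : z ∈ SRp m n p) {ξ : Matrix (Fin m) (Fin n) ℝ} :
    ξ ∈ tangent (Mp m n p) (proj z) ↔ ∃ η ∈ tangent (SRp m n p) z, dproj z η = ξ := by
  constructor
  · rintro ⟨c, ε, hε, hc, hS, h0, hd⟩
    obtain ⟨σ, hσ0, hσ⟩ := exists_section hz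
    have hnb : Set.Ioo (-ε) ε ∈ 𝓝 (0 : ℝ) := Ioo_mem_nhds (by linarith) hε
    have hct : Filter.Tendsto c (𝓝 0) (𝓝 (proj z)) := by
      have := hd.continuousAt.tendsto
      rwa [h0] at this
    have hσ' := hct.eventually hσ
    have hev : ∀ᶠ t in 𝓝 (0 : ℝ), σ (c t) ∈ SRp m n p ∧ proj (σ (c t)) = c t := by
      filter_upwards [hσ', hnb] with t h1 h2 using h1.2 (hS t h2)
    have hdiff : DifferentiableAt ℝ σ (c 0) := by
      rw [h0]
      exact hσ.self_of_nhds.1.differentiableAt (by simp)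
    have hσc := hdiff.hasFDerivAt.comp_hasDerivAt (0 : ℝ) hd
    have hm := mem_tangent_of_curve (S := SRp m n p) hσc (hev.mono fun _ h => h.1) (by
      filter_upwards [hσ', hnb] with t h1 h2
      have : ContDiffAt ℝ ∞ c t := hc.contDiffAt (Ioo_mem_nhds h2.1 h2.2)
      exact h1.1.comp t this)
    have hz' : (σ ∘ c) 0 = z := by simp [h0, hσ0]
    rw [hz'] at hm
    refine ⟨_, hm, ?_⟩
    have h5 := hasDerivAt_proj hσc
    rw [hz'] at h5
    exact h5.unique (hd.congr_of_eventuallyEq (hev.mono fun _ h => h.2))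
  · rintro ⟨η, ⟨c, ε, hε, hc, hS, h0, hd⟩, rfl⟩
    have h5 := hasDerivAt_proj hd
    rw [h0] at h5
    exact ⟨fun t => proj (c t), ε, hε, contDiff_proj.comp_contDiffOn hc,
      fun t ht => proj_mem (hS t ht), by simp [h0], h5⟩

end Sections

/-! ### Horizontal projection, horizontal lifts and their equivariance. -/

section Lifts

variable {m n p : ℕ} {z η ζ : Pair m n p}

/-- The tangent space to the total space, as a subspace. -/
def tangentSpace (z : Pair m n p) : Submodule ℝ (Pair m n p) where
  carrier := {η | z.1ᵀ * η.1 + η.1ᵀ * z.1 = 0}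
  add_mem' {a b} ha hb := by
    simp only [Set.mem_ofPred_eq, Prod.fst_add, Matrix.transpose_add, Matrix.mul_add,
      Matrix.add_mul] at *
    rw [add_add_add_comm, ha, hb, add_zero]
  zero_mem' := by simp
  smul_mem' c a ha := by
    simp only [Set.mem_ofPred_eq, Prod.smul_fst, Matrix.transpose_smul, Matrix.mul_smul,
      Matrix.smul_mul, ← smul_add] at *
    rw [ha, smul_zero]

/-- The horizontal space, as a subspace. -/
def horizontalSpace (z : Pair m n p) : Submodule ℝ (Pair m n p) where
  carrier := {η | z.1ᵀ * η.1 + η.1ᵀ * z.1 = 0 ∧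
    (η.1ᵀ * z.1 + η.2ᵀ * z.2)ᵀ = η.1ᵀ * z.1 + η.2ᵀ * z.2}
  add_mem' {a b} ha hb := by
    refine ⟨(tangentSpace z).add_mem ha.1 hb.1, ?_⟩
    have e : (a + b).1ᵀ * z.1 + (a + b).2ᵀ * z.2 =
        (a.1ᵀ * z.1 + a.2ᵀ * z.2) + (b.1ᵀ * z.1 + b.2ᵀ * z.2) := by
      simp only [Prod.fst_add, Prod.snd_add, Matrix.transpose_add, Matrix.add_mul]
      abel
    rw [e, Matrix.transpose_add, ha.2, hb.2]
  zero_mem' := by simp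
  smul_mem' c a ha := by
    refine ⟨(tangentSpace z).smul_mem c ha.1, ?_⟩
    have e : (c • a).1ᵀ * z.1 + (c • a).2ᵀ * z.2 = c • (a.1ᵀ * z.1 + a.2ᵀ * z.2) := by
      simp
    rw [e, Matrix.transpose_smul, ha.2]

theorem mem_tangent_iff (hz : z ∈ SRp m n p) :
    η ∈ tangent (SRp m n p) z ↔ η ∈ tangentSpace z := mem_tangent_SRp hz

theorem mem_horizontal_iff (hz : z ∈ SRp m n p) :
    η ∈ horizontal z ↔ η ∈ horizontalSpace z := mem_horizontal hz

theorem horizontalSpace_le (z : Pair m n p) : horizontalSpace z ≤ tangentSpace z := fun _ h => h.1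

theorem gBar_comm (z η ζ : Pair m n p) : gBar z η ζ = gBar z ζ η := by
  simp only [gBar, Matrix.trace_add]
  rw [← Matrix.trace_transpose (η.1ᵀ * ζ.1), ← Matrix.trace_transpose (η.2ᵀ * ζ.2)]
  simp

theorem gBar_add_left (z η ζ χ : Pair m n p) : gBar z (η + ζ) χ = gBar z η χ + gBar z ζ χ := by
  simp only [gBar, Prod.fst_add, Prod.snd_add, Matrix.transpose_add, Matrix.add_mul,
    Matrix.trace_add]
  ring

theorem gBar_smul_left (z : Pair m n p) (c : ℝ) (η χ : Pair m n p) :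
    gBar z (c • η) χ = c * gBar z η χ := by
  simp [gBar, mul_add]

theorem gBar_sub_left (z η ζ χ : Pair m n p) : gBar z (η - ζ) χ = gBar z η χ - gBar z ζ χ := by
  rw [eq_sub_iff_add_eq, ← gBar_add_left, sub_add_cancel]

theorem eq_zero_of_gBar_self (h : gBar z η η = 0) : η = 0 := by
  simp only [gBar, Matrix.trace_add] at h
  have h1 := trace_transpose_mul_self_nonneg η.1
  have h2 := trace_transpose_mul_self_nonneg η.2
  exact Prod.ext (eq_zero_of_trace_transpose_mul_self (by linarith))
    (eq_zero_of_trace_transpose_mul_self (by linarith))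

theorem gBar_self_pos (h : η ≠ 0) : 0 < gBar z η η := by
  refine lt_of_le_of_ne ?_ fun h0 => h (eq_zero_of_gBar_self h0.symm)
  simp only [gBar, Matrix.trace_add]
  exact add_nonneg (trace_transpose_mul_self_nonneg _) (trace_transpose_mul_self_nonneg _)

theorem act_neg_right (z : Pair m n p) (Q : Matrix (Fin p) (Fin p) ℝ) :
    act z (-Q) = -act z Q := by
  simp [act]

theorem dproj_add (z η ζ : Pair m n p) : dproj z (η + ζ) = dproj z η + dproj z ζ := by
  simp [dproj]

theorem dproj_sub (z η ζ : Pair m n p) : dproj z (η - ζ) = dproj z η - dproj z ζ := by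
  simp [dproj]

theorem dproj_neg (z η : Pair m n p) : dproj z (-η) = -dproj z η := by
  simp [dproj]

theorem dproj_smul (z : Pair m n p) (c : ℝ) (η : Pair m n p) :
    dproj z (c • η) = c • dproj z η := by
  simp [dproj]

theorem dproj_act_act (z η : Pair m n p) {Q : Matrix (Fin p) (Fin p) ℝ} (hQ : Qᵀ * Q = 1) :
    dproj (act z Q) (act η Q) = dproj z η := by
  have hQ' : Q * Qᵀ = 1 := mul_eq_one_comm.1 hQ
  simp only [dproj_eq, act, Matrix.transpose_mul]
  rw [Matrix.mul_assoc, Matrix.mul_assoc, ← Matrix.mul_assoc Q, ← Matrix.mul_assoc Q, hQ',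
    Matrix.one_mul, Matrix.one_mul]

theorem gBar_act_act (z w η ζ : Pair m n p) {Q : Matrix (Fin p) (Fin p) ℝ} (hQ : Qᵀ * Q = 1) :
    gBar w (act η Q) (act ζ Q) = gBar z η ζ := by
  have hQ' : Q * Qᵀ = 1 := mul_eq_one_comm.1 hQ
  have key : ∀ {k : ℕ} (A B : Matrix (Fin k) (Fin p) ℝ),
      ((A * Q)ᵀ * (B * Q)).trace = (Aᵀ * B).trace := fun A B => by
    rw [Matrix.transpose_mul, Matrix.mul_assoc, Matrix.trace_mul_comm]
    simp only [Matrix.mul_assoc, hQ', Matrix.mul_one]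
  simp only [gBar, Matrix.trace_add, act, key]

theorem dproj_vertical (hz : z ∈ SRp m n p) (h : η ∈ vertical z) : dproj z η = 0 := by
  obtain ⟨Ω, hΩ, rfl⟩ := (mem_vertical hz).1 h
  simp only [dproj_eq, act, Matrix.transpose_mul, hΩ]
  simp [Matrix.mul_assoc]

theorem vertical_of_dproj (hz : z ∈ SRp m n p) (h : η ∈ tangentSpace z) (h0 : dproj z η = 0) :
    η ∈ vertical z := by
  rw [dproj_eq] at h0
  exact (mem_vertical hz).2 (exists_act_of_deriv_proj_eq_zero hz h h0)

theorem vertical_subset_tangentSpace (h : η ∈ vertical z) :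
    η ∈ tangentSpace z := by
  obtain ⟨c, h0, hd, hS, -⟩ := exists_curve_of_mem_tangent h
  have := stiefel_deriv hd (hS.mono fun _ h => h.1)
  rwa [h0] at this

theorem gBar_horizontal_vertical (hz : z ∈ SRp m n p) (hη : η ∈ horizontalSpace z)
    (hζ : ζ ∈ vertical z) : gBar z η ζ = 0 :=
  ((mem_horizontal_iff hz).2 hη).2 ζ hζ

theorem eq_zero_of_horizontal_vertical (hz : z ∈ SRp m n p) (hη : η ∈ horizontalSpace z)
    (hζ : η ∈ vertical z) : η = 0 :=
  eq_zero_of_gBar_self (gBar_horizontal_vertical hz hη hζ)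

/-- The difference is tangent and killed by `Dπ`, hence vertical; being horizontal too, it is
orthogonal to itself. -/
theorem horizontal_ext (hz : z ∈ SRp m n p) (hη : η ∈ horizontalSpace z)
    (hζ : ζ ∈ horizontalSpace z) (h : dproj z η = dproj z ζ) : η = ζ := by
  have hs := (horizontalSpace z).sub_mem hη hζ
  rw [← sub_eq_zero]
  exact eq_zero_of_horizontal_vertical hz hs (vertical_of_dproj hz (horizontalSpace_le z hs)
    (by rw [dproj_sub, h, sub_self]))

/-- The skew-symmetric matrix of the vertical part of a tangent vector. -/
def omegaOf (z η : Pair m n p) : Matrix (Fin p) (Fin p) ℝ :=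
  sylvester z.2 (η.1ᵀ * z.1 - z.1ᵀ * η.1 + η.2ᵀ * z.2 - z.2ᵀ * η.2)

/-- The closed form of the horizontal projection. -/
def horPart (z η : Pair m n p) : Pair m n p := η + act z (omegaOf z η)

theorem omegaOf_skew (z η : Pair m n p) : (omegaOf z η)ᵀ = -omegaOf z η := by
  refine sylvester_skew ?_
  simp only [Matrix.transpose_add, Matrix.transpose_sub, Matrix.transpose_mul,
    Matrix.transpose_transpose]
  abel

/-- Adding `(M Ω, N Ω)` changes `Ṁᵀ M + Ṅᵀ N` by `-Ω (Nᵀ N + 1)`. Symmetry of the result is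
precisely the Sylvester equation defining `omegaOf`. -/
theorem horPart_mem (hz : z ∈ SRp m n p) (hη : η ∈ tangentSpace z) :
    horPart z η ∈ horizontalSpace z := by
  have hz1 : z.1ᵀ * z.1 = 1 := hz.1
  have hs := omegaOf_skew z η
  have hsp := sylvester_spec z.2 (η.1ᵀ * z.1 - z.1ᵀ * η.1 + η.2ᵀ * z.2 - z.2ᵀ * η.2)
  refine ⟨(tangentSpace z).add_mem hη
    (vertical_subset_tangentSpace ((mem_vertical hz).2 ⟨_, hs, rfl⟩)), ?_⟩
  change _ * omegaOf z η + omegaOf z η * _ = _ at hsp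
  have e : (horPart z η).1ᵀ * z.1 + (horPart z η).2ᵀ * z.2 =
      (η.1ᵀ * z.1 + η.2ᵀ * z.2) - omegaOf z η * (z.2ᵀ * z.2 + 1) := by
    simp only [horPart, act, Prod.fst_add, Prod.snd_add, Matrix.transpose_add, Matrix.add_mul,
      Matrix.transpose_mul, hs, Matrix.neg_mul, Matrix.mul_assoc, hz1, Matrix.mul_add]
    abel
  rw [e]
  simp only [Matrix.transpose_sub, Matrix.transpose_add, Matrix.transpose_mul,
    Matrix.transpose_transpose, Matrix.transpose_one, hs, Matrix.mul_neg, sub_neg_eq_add]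
  rw [← sub_eq_zero] at hsp ⊢
  rw [← hsp]
  abel

theorem sub_horPart_mem (hz : z ∈ SRp m n p) (η : Pair m n p) : η - horPart z η ∈ vertical z := by
  refine (mem_vertical hz).2 ⟨-omegaOf z η, ?_, ?_⟩
  · rw [Matrix.transpose_neg, omegaOf_skew]
  · rw [act_neg_right, horPart]
    abel

theorem hproj_unique (hz : z ∈ SRp m n p) (h1 : ζ ∈ horizontalSpace z)
    (h2 : η - ζ ∈ vertical z) : hproj z η = ζ := by
  have h := Classical.epsilon_spec (p := fun h => h ∈ horizontal z ∧ η - h ∈ vertical z)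
    ⟨ζ, (mem_horizontal_iff hz).2 h1, h2⟩
  refine horizontal_ext hz ((mem_horizontal_iff hz).1 h.1) h1 ?_
  have e1 := dproj_vertical hz h.2
  have e2 := dproj_vertical hz h2
  rw [dproj_sub, sub_eq_zero] at e1 e2
  exact e1.symm.trans e2

theorem hproj_eq (hz : z ∈ SRp m n p) (hη : η ∈ tangentSpace z) : hproj z η = horPart z η :=
  hproj_unique hz (horPart_mem hz hη) (sub_horPart_mem hz η)

theorem hproj_mem (hz : z ∈ SRp m n p) (hη : η ∈ tangentSpace z) :
    hproj z η ∈ horizontalSpace z := by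
  rw [hproj_eq hz hη]
  exact horPart_mem hz hη

theorem sub_hproj_mem (hz : z ∈ SRp m n p) (hη : η ∈ tangentSpace z) :
    η - hproj z η ∈ vertical z := by
  rw [hproj_eq hz hη]
  exact sub_horPart_mem hz η

theorem dproj_hproj (hz : z ∈ SRp m n p) (hη : η ∈ tangentSpace z) :
    dproj z (hproj z η) = dproj z η := by
  have := dproj_vertical hz (sub_hproj_mem hz hη)
  rw [dproj_sub, sub_eq_zero] at this
  exact this.symm

theorem gBar_hproj (hz : z ∈ SRp m n p) (hη : η ∈ tangentSpace z) (hζ : ζ ∈ horizontalSpace z) :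
    gBar z (hproj z η) ζ = gBar z η ζ := by
  have := gBar_horizontal_vertical hz hζ (sub_hproj_mem hz hη)
  rw [gBar_comm, gBar_sub_left, sub_eq_zero] at this
  exact this.symm

theorem mem_tangent_Mp_iff (hz : z ∈ SRp m n p) {ξ : Matrix (Fin m) (Fin n) ℝ} :
    ξ ∈ tangent (Mp m n p) (proj z) ↔ ∃ η ∈ horizontalSpace z, dproj z η = ξ := by
  rw [mem_tangent_Mp hz]
  constructor
  · rintro ⟨η, hη, rfl⟩
    rw [mem_tangent_iff hz] at hη
    exact ⟨hproj z η, hproj_mem hz hη, dproj_hproj hz hη⟩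
  · rintro ⟨η, hη, h⟩
    exact ⟨η, (mem_tangent_iff hz).2 (horizontalSpace_le z hη), h⟩

theorem dproj_mem_tangent (hz : z ∈ SRp m n p) (hη : η ∈ tangentSpace z) :
    dproj z η ∈ tangent (Mp m n p) (proj z) :=
  (mem_tangent_Mp hz).2 ⟨η, (mem_tangent_iff hz).2 hη, rfl⟩

variable {ξ ξ' : Matrix (Fin m) (Fin n) ℝ}

theorem lift_spec (hz : z ∈ SRp m n p) (hξ : ξ ∈ tangent (Mp m n p) (proj z)) :
    lift z ξ ∈ horizontalSpace z ∧ dproj z (lift z ξ) = ξ := by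
  obtain ⟨η, hη, h⟩ := (mem_tangent_Mp_iff hz).1 hξ
  have := Classical.epsilon_spec (p := fun η => η ∈ horizontal z ∧ dproj z η = ξ)
    ⟨η, (mem_horizontal_iff hz).2 hη, h⟩
  exact ⟨(mem_horizontal_iff hz).1 this.1, this.2⟩

theorem lift_mem (hz : z ∈ SRp m n p) (hξ : ξ ∈ tangent (Mp m n p) (proj z)) :
    lift z ξ ∈ horizontalSpace z := (lift_spec hz hξ).1

theorem dproj_lift (hz : z ∈ SRp m n p) (hξ : ξ ∈ tangent (Mp m n p) (proj z)) :
    dproj z (lift z ξ) = ξ := (lift_spec hz hξ).2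

theorem lift_eq (hz : z ∈ SRp m n p) (hη : η ∈ horizontalSpace z) (h : dproj z η = ξ) :
    lift z ξ = η := by
  have := lift_spec hz ((mem_tangent_Mp_iff hz).2 ⟨η, hη, h⟩)
  exact horizontal_ext hz this.1 hη (this.2.trans h.symm)

theorem lift_dproj (hz : z ∈ SRp m n p) (hη : η ∈ tangentSpace z) :
    lift z (dproj z η) = hproj z η :=
  lift_eq hz (hproj_mem hz hη) (dproj_hproj hz hη)

/-- Right multiplication by `Q` carries horizontal vectors at `z` to horizontal vectors at `z Q`
with the same image under `Dπ`, so uniqueness of lifts applies. -/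
theorem lift_act (hz : z ∈ SRp m n p) (hξ : ξ ∈ tangent (Mp m n p) (proj z))
    {Q : Matrix (Fin p) (Fin p) ℝ} (hQ : Qᵀ * Q = 1) :
    lift (act z Q) ξ = act (lift z ξ) Q := by
  obtain ⟨h1, h2⟩ := lift_spec hz hξ
  refine lift_eq (act_mem hz hQ) ?_ (by rw [dproj_act_act _ _ hQ, h2])
  generalize lift z ξ = η at *
  have e1 : ∀ {k : ℕ} (A B : Matrix (Fin k) (Fin p) ℝ), (A * Q)ᵀ * (B * Q) = Qᵀ * (Aᵀ * B) * Q :=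
    fun A B => by simp only [Matrix.transpose_mul, Matrix.mul_assoc]
  refine ⟨?_, ?_⟩
  · simp only [act, e1]
    rw [← Matrix.add_mul, ← Matrix.mul_add, h1.1, Matrix.mul_zero, Matrix.zero_mul]
  · simp only [act, e1]
    rw [← Matrix.add_mul, ← Matrix.mul_add, Matrix.transpose_mul, Matrix.transpose_mul, h1.2,
      Matrix.transpose_transpose, Matrix.mul_assoc]

theorem tangent_Mp_add (hz : z ∈ SRp m n p) (hξ : ξ ∈ tangent (Mp m n p) (proj z))
    (hξ' : ξ' ∈ tangent (Mp m n p) (proj z)) : ξ + ξ' ∈ tangent (Mp m n p) (proj z) := by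
  rw [mem_tangent_Mp_iff hz] at *
  obtain ⟨a, ha, rfl⟩ := hξ
  obtain ⟨b, hb, rfl⟩ := hξ'
  exact ⟨a + b, add_mem ha hb, dproj_add _ _ _⟩

theorem tangent_Mp_smul (hz : z ∈ SRp m n p) (c : ℝ) (hξ : ξ ∈ tangent (Mp m n p) (proj z)) :
    c • ξ ∈ tangent (Mp m n p) (proj z) := by
  rw [mem_tangent_Mp_iff hz] at *
  obtain ⟨a, ha, rfl⟩ := hξ
  exact ⟨c • a, Submodule.smul_mem _ c ha, dproj_smul _ _ _⟩

theorem lift_add (hz : z ∈ SRp m n p) (hξ : ξ ∈ tangent (Mp m n p) (proj z))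
    (hξ' : ξ' ∈ tangent (Mp m n p) (proj z)) : lift z (ξ + ξ') = lift z ξ + lift z ξ' := by
  refine lift_eq hz (add_mem (lift_mem hz hξ) (lift_mem hz hξ')) ?_
  rw [dproj_add, dproj_lift hz hξ, dproj_lift hz hξ']

theorem lift_smul (hz : z ∈ SRp m n p) (c : ℝ) (hξ : ξ ∈ tangent (Mp m n p) (proj z)) :
    lift z (c • ξ) = c • lift z ξ := by
  refine lift_eq hz (Submodule.smul_mem _ c (lift_mem hz hξ)) ?_
  rw [dproj_smul, dproj_lift hz hξ]

/-- A tangent vector over `z`, defined for all `ξ`, whose image under `Dπ(z)` is `ξ` for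
tangent `ξ`. -/
def tangentLift (z : Pair m n p) (ξ : Matrix (Fin m) (Fin n) ℝ) : Pair m n p :=
  ((1 - z.1 * z.1ᵀ) * ξ * (z.2 * (z.2ᵀ * z.2)⁻¹), ξᵀ * z.1)

theorem tangentLift_mem (hz : z ∈ SRp m n p) (ξ : Matrix (Fin m) (Fin n) ℝ) :
    tangentLift z ξ ∈ tangentSpace z := by
  have hz1 : z.1ᵀ * z.1 = 1 := hz.1
  have h : z.1ᵀ * (tangentLift z ξ).1 = 0 := by
    simp only [tangentLift]
    have h2 : z.1ᵀ * (1 - z.1 * z.1ᵀ) = 0 := by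
      rw [Matrix.mul_sub, ← Matrix.mul_assoc, hz1]
      simp
    rw [Matrix.mul_assoc, ← Matrix.mul_assoc, h2, Matrix.zero_mul]
  have h' := congrArg Matrix.transpose h
  rw [Matrix.transpose_mul, Matrix.transpose_transpose, Matrix.transpose_zero] at h'
  change _ + _ = _
  rw [h, h', add_zero]

/-- For `ξ = Ṁ Nᵀ + M Ṅᵀ`, the part `(1 - M Mᵀ) ξ` has the form `K Nᵀ` and comes from the first
component, while the second component produces `M Mᵀ ξ`. -/
theorem dproj_tangentLift (hz : z ∈ SRp m n p) (hξ : ξ ∈ tangent (Mp m n p) (proj z)) :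
    dproj z (tangentLift z ξ) = ξ := by
  have hz1 : z.1ᵀ * z.1 = 1 := hz.1
  obtain ⟨η, hη, rfl⟩ := (mem_tangent_Mp_iff hz).1 hξ
  simp only [dproj_eq, tangentLift]
  set G := (z.2ᵀ * z.2)⁻¹ with hG
  have h1 : z.2ᵀ * (z.2 * G) = 1 := by rw [← Matrix.mul_assoc, gram_mul_inv hz.2]
  have h2 : (1 - z.1 * z.1ᵀ) * z.1 = 0 := by
    rw [Matrix.sub_mul, Matrix.mul_assoc, hz1]
    simp
  have h3 : (1 - z.1 * z.1ᵀ) * (η.1 * z.2ᵀ + z.1 * η.2ᵀ) = (1 - z.1 * z.1ᵀ) * η.1 * z.2ᵀ := by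
    rw [Matrix.mul_add, ← Matrix.mul_assoc _ z.1, h2, Matrix.zero_mul, add_zero, Matrix.mul_assoc]
  rw [h3, Matrix.mul_assoc _ z.2ᵀ, h1, Matrix.mul_one, ← h3, Matrix.transpose_mul,
    Matrix.transpose_transpose, ← Matrix.mul_assoc z.1 z.1ᵀ, ← Matrix.add_mul]
  simp

theorem tangentLift_act (z : Pair m n p) (ξ : Matrix (Fin m) (Fin n) ℝ)
    {Q : Matrix (Fin p) (Fin p) ℝ} (hQ : Qᵀ * Q = 1) :
    tangentLift (act z Q) ξ = act (tangentLift z ξ) Q := by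
  have hQ' : Q * Qᵀ = 1 := mul_eq_one_comm.1 hQ
  have hi : Q⁻¹ = Qᵀ := Matrix.inv_eq_left_inv hQ
  have hi' : (Qᵀ)⁻¹ = Q := Matrix.inv_eq_left_inv hQ'
  have h1 : z.1 * Q * (z.1 * Q)ᵀ = z.1 * z.1ᵀ := by
    rw [Matrix.transpose_mul, Matrix.mul_assoc, ← Matrix.mul_assoc Q, hQ', Matrix.one_mul]
  have h2 : z.2 * Q * ((z.2 * Q)ᵀ * (z.2 * Q))⁻¹ = z.2 * (z.2ᵀ * z.2)⁻¹ * Q := by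
    have : (z.2 * Q)ᵀ * (z.2 * Q) = Qᵀ * ((z.2ᵀ * z.2) * Q) := by
      simp only [Matrix.transpose_mul, Matrix.mul_assoc]
    rw [this, Matrix.mul_inv_rev, Matrix.mul_inv_rev, hi, hi', Matrix.mul_assoc,
      ← Matrix.mul_assoc Q, ← Matrix.mul_assoc Q, hQ', Matrix.one_mul, Matrix.mul_assoc]
  simp only [tangentLift, act, h1, h2, Matrix.mul_assoc]

/-- The lift, defined by a choice, is replaced by an explicit formula from which its smoothness
follows. -/
theorem lift_eq_horPart (hz : z ∈ SRp m n p) (hξ : ξ ∈ tangent (Mp m n p) (proj z)) :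
    lift z ξ = horPart z (tangentLift z ξ) := by
  have h := lift_dproj hz (tangentLift_mem hz ξ)
  rwa [dproj_tangentLift hz hξ, hproj_eq hz (tangentLift_mem hz ξ)] at h

variable {E : Type*} [NormedAddCommGroup E] [NormedSpace ℝ E] {s : Set E}

theorem contDiffOn_lift {Z : E → Pair m n p} {Ξ : E → Matrix (Fin m) (Fin n) ℝ}
    (hZ : ContDiffOn ℝ ∞ Z s) (hΞ : ContDiffOn ℝ ∞ Ξ s) (h : ∀ y ∈ s, Z y ∈ SRp m n p)
    (h' : ∀ y ∈ s, Ξ y ∈ tangent (Mp m n p) (proj (Z y))) :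
    ContDiffOn ℝ ∞ (fun y => lift (Z y) (Ξ y)) s := by
  have hG : ContDiffOn ℝ ∞ (fun y => ((Z y).2ᵀ * (Z y).2)⁻¹) s := fun y hy =>
    contDiffWithinAt_inv ((by fun_prop : ContDiffOn ℝ ∞ (fun y => (Z y).2ᵀ * (Z y).2) s) y hy)
      (rank_eq_iff_isUnit_gram.1 (h y hy).2)
  have hT : ContDiffOn ℝ ∞ (fun y => tangentLift (Z y) (Ξ y)) s := by
    unfold tangentLift
    fun_prop
  have hO : ContDiffOn ℝ ∞ (fun y => omegaOf (Z y) (tangentLift (Z y) (Ξ y))) s := fun y hy => by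
    refine contDiffWithinAt_sylvester (hZ y hy).snd ?_
    exact (by fun_prop : ContDiffOn ℝ ∞ (fun y => (tangentLift (Z y) (Ξ y)).1ᵀ * (Z y).1 -
      (Z y).1ᵀ * (tangentLift (Z y) (Ξ y)).1 + (tangentLift (Z y) (Ξ y)).2ᵀ * (Z y).2 -
      (Z y).2ᵀ * (tangentLift (Z y) (Ξ y)).2) s) y hy
  refine ContDiffOn.congr (f := fun y => horPart (Z y) (tangentLift (Z y) (Ξ y))) ?_
    fun y hy => lift_eq_horPart (h y hy) (h' y hy)
  unfold horPart act
  fun_prop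

theorem contDiffOn_dproj {Z H : E → Pair m n p} (hZ : ContDiffOn ℝ ∞ Z s)
    (hH : ContDiffOn ℝ ∞ H s) : ContDiffOn ℝ ∞ (fun y => dproj (Z y) (H y)) s := by
  simp only [dproj_eq]
  fun_prop

/-- A point of the fiber over `X`. -/
def fiberPoint (p : ℕ) (X : Matrix (Fin m) (Fin n) ℝ) : Pair m n p :=
  Classical.epsilon fun z => z ∈ SRp m n p ∧ proj z = X

/-- The chosen point of a fiber varies without any regularity, but it is an orthogonal translate of
any prescribed `z`. Equivariant constructions can therefore be evaluated at `z` instead. -/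
theorem fiberPoint_proj (hz : z ∈ SRp m n p) : ∃ Q : Matrix (Fin p) (Fin p) ℝ,
    Qᵀ * Q = 1 ∧ fiberPoint p (proj z) = act z Q ∧ fiberPoint p (proj z) ∈ SRp m n p ∧
      proj (fiberPoint p (proj z)) = proj z := by
  have h := Classical.epsilon_spec (p := fun w => w ∈ SRp m n p ∧ proj w = proj z) ⟨z, hz, rfl⟩
  obtain ⟨Q, hQ, e⟩ := exists_act_eq hz h.1 h.2
  exact ⟨Q, hQ, e, h⟩

theorem quotMetric_proj (hz : z ∈ SRp m n p) (hξ : ξ ∈ tangent (Mp m n p) (proj z))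
    (hξ' : ξ' ∈ tangent (Mp m n p) (proj z)) :
    quotMetric p (proj z) ξ ξ' = gBar z (lift z ξ) (lift z ξ') := by
  obtain ⟨Q, hQ, e, -⟩ := fiberPoint_proj hz
  change gBar (fiberPoint p (proj z)) (lift (fiberPoint p (proj z)) ξ)
    (lift (fiberPoint p (proj z)) ξ') = _
  rw [e, lift_act hz hξ hQ, lift_act hz hξ' hQ, gBar_act_act z _ _ _ hQ]

/-- The tangent vector field on the matrices of rank `p` obtained by projecting a constant one. -/
def frameField (p : ℕ) (w X : Matrix (Fin m) (Fin n) ℝ) : Matrix (Fin m) (Fin n) ℝ :=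
  dproj (fiberPoint p X) (tangentLift (fiberPoint p X) w)

theorem frameField_proj (hz : z ∈ SRp m n p) (w : Matrix (Fin m) (Fin n) ℝ) :
    frameField p w (proj z) = dproj z (tangentLift z w) := by
  obtain ⟨Q, hQ, e, -⟩ := fiberPoint_proj hz
  rw [frameField, e, tangentLift_act _ _ hQ, dproj_act_act _ _ hQ]

theorem frameField_self (hz : z ∈ SRp m n p) (hξ : ξ ∈ tangent (Mp m n p) (proj z)) :
    frameField p ξ (proj z) = ξ := by
  rw [frameField_proj hz, dproj_tangentLift hz hξ]

/-- These fields extend every tangent vector and, for a basis of constants `w`, span each tangent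
space. They feed both the uniqueness of the connection and the expansion of fields along curves. -/
theorem isField_frameField (w : Matrix (Fin m) (Fin n) ℝ) :
    IsField (Mp m n p) (frameField p w) := by
  constructor
  · refine contDiffOn_Mp_of_comp_proj ?_
    refine ContDiffOn.congr (f := fun z : Pair m n p => dproj z (tangentLift z w)) ?_
      fun z hz => frameField_proj hz w
    have hG : ContDiffOn ℝ ∞ (fun z : Pair m n p => (z.2ᵀ * z.2)⁻¹) (SRp m n p) := fun z hz =>
      contDiffWithinAt_inv
        ((by fun_prop : ContDiff ℝ ∞ (fun z : Pair m n p => z.2ᵀ * z.2)).contDiffWithinAt)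
        (rank_eq_iff_isUnit_gram.1 hz.2)
    refine contDiffOn_dproj contDiffOn_id ?_
    unfold tangentLift
    fun_prop
  · intro X hX
    obtain ⟨z, hz, rfl⟩ := exists_proj_eq hX
    rw [frameField_proj hz]
    exact dproj_mem_tangent hz (tangentLift_mem hz w)

theorem tproj_eq (z η : Pair m n p) :
    tproj z η = η - (z.1 * ((1 / 2 : ℝ) • (z.1ᵀ * η.1 + η.1ᵀ * z.1)), 0) := by
  refine Prod.ext ?_ (by simp [tproj])
  simp only [tproj, Prod.fst_sub, Matrix.sub_mul, Matrix.one_mul, Matrix.mul_smul, smul_sub,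
    smul_add, Matrix.mul_sub, Matrix.mul_add, Matrix.transpose_mul, Matrix.transpose_transpose,
    Matrix.mul_assoc]
  module

theorem tproj_mem (hz : z ∈ SRp m n p) (η : Pair m n p) : tproj z η ∈ tangentSpace z := by
  have hz1 : z.1ᵀ * z.1 = 1 := hz.1
  rw [tproj_eq]
  change _ + _ = (0 : Matrix (Fin p) (Fin p) ℝ)
  simp only [Prod.fst_sub, Matrix.mul_sub, Matrix.transpose_sub, Matrix.sub_mul,
    Matrix.transpose_mul, Matrix.transpose_smul, Matrix.transpose_add, Matrix.transpose_transpose,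
    Matrix.mul_assoc, hz1, Matrix.mul_one]
  rw [← Matrix.mul_assoc, hz1, Matrix.one_mul]
  module

theorem tproj_of_mem (hη : η ∈ tangentSpace z) : tproj z η = η := by
  have h : z.1ᵀ * η.1 + η.1ᵀ * z.1 = 0 := hη
  rw [tproj_eq, h]
  simp

theorem tproj_add (z η ζ : Pair m n p) : tproj z (η + ζ) = tproj z η + tproj z ζ := by
  refine Prod.ext ?_ rfl
  simp only [tproj, Prod.fst_add, Matrix.mul_add, Matrix.transpose_add, Matrix.transpose_mul,
    smul_add, smul_sub, Matrix.mul_sub]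
  abel

theorem tproj_smul (z : Pair m n p) (c : ℝ) (η : Pair m n p) : tproj z (c • η) = c • tproj z η := by
  refine Prod.ext ?_ rfl
  simp only [tproj, Prod.smul_fst, Matrix.mul_smul, Matrix.transpose_smul, smul_add, smul_sub,
    Matrix.mul_sub]
  module

theorem tproj_sub (z η ζ : Pair m n p) : tproj z (η - ζ) = tproj z η - tproj z ζ := by
  rw [eq_sub_iff_add_eq, ← tproj_add, sub_add_cancel]

theorem tproj_act_act (z η : Pair m n p) {Q : Matrix (Fin p) (Fin p) ℝ} (hQ : Qᵀ * Q = 1) :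
    tproj (act z Q) (act η Q) = act (tproj z η) Q := by
  have hQ' : Q * Qᵀ = 1 := mul_eq_one_comm.1 hQ
  have e1 : ∀ A B : Matrix (Fin m) (Fin p) ℝ, (A * Q)ᵀ * (B * Q) = Qᵀ * (Aᵀ * B) * Q :=
    fun A B => by simp only [Matrix.transpose_mul, Matrix.mul_assoc]
  have e2 : ∀ (A : Matrix (Fin m) (Fin p) ℝ) (C : Matrix (Fin p) (Fin p) ℝ),
      A * Q * (Qᵀ * C * Q) = A * C * Q := fun A C => by
    calc A * Q * (Qᵀ * C * Q) = A * (Q * Qᵀ) * C * Q := by simp only [Matrix.mul_assoc]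
      _ = _ := by rw [hQ', Matrix.mul_one]
  rw [tproj_eq, tproj_eq]
  refine Prod.ext ?_ (by simp [act])
  simp only [act, Prod.fst_sub, e1, ← Matrix.add_mul, ← Matrix.mul_add, Matrix.mul_smul, e2,
    Matrix.sub_mul, Matrix.smul_mul]

/-- The removed part is `M C` with `C` symmetric, and for tangent `ζ` the matrix `Mᵀ ζ.1` is skew,
so their trace pairing vanishes. -/
theorem gBar_tproj (η : Pair m n p) (hζ : ζ ∈ tangentSpace z) :
    gBar z (tproj z η) ζ = gBar z η ζ := by
  have h : z.1ᵀ * ζ.1 + ζ.1ᵀ * z.1 = 0 := hζ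
  rw [tproj_eq, gBar_sub_left, sub_eq_self]
  set C := (1 / 2 : ℝ) • (z.1ᵀ * η.1 + η.1ᵀ * z.1) with hC
  have hs : Cᵀ = C := by
    rw [hC, Matrix.transpose_smul, Matrix.transpose_add]
    simp only [Matrix.transpose_mul, Matrix.transpose_transpose]
    rw [add_comm]
  simp only [gBar, Matrix.transpose_mul, hs, Matrix.transpose_zero, Matrix.zero_mul, add_zero,
    Matrix.mul_assoc]
  refine trace_mul_skew_eq_zero hs ?_
  rw [Matrix.transpose_mul, Matrix.transpose_transpose]
  exact eq_neg_of_add_eq_zero_right h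

theorem contDiffOn_tproj {Z H : E → Pair m n p} (hZ : ContDiffOn ℝ ∞ Z s)
    (hH : ContDiffOn ℝ ∞ H s) : ContDiffOn ℝ ∞ (fun y => tproj (Z y) (H y)) s := by
  unfold tproj
  fun_prop

end Lifts

/-! ### Derivatives within a set, and covariant derivatives along curves. -/

section EmbeddedSubmanifolds

variable {E F : Type*} [NormedAddCommGroup E] [NormedSpace ℝ E] [NormedAddCommGroup F]
  [NormedSpace ℝ F] {S : Set E} {x ξ : E}

theorem fderivWithin_eq_of_curve {φ : E → F} (hφ : ContDiffOn ℝ ∞ φ S) (hx : x ∈ S)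
    (hξ : ξ ∈ tangent S x) {L : F}
    (h : ∀ c : ℝ → E, c 0 = x → HasDerivAt c ξ 0 → (∀ᶠ t in 𝓝 0, c t ∈ S) →
      HasDerivAt (fun t => φ (c t)) L 0) : fderivWithin ℝ φ S x ξ = L := by
  obtain ⟨c, rfl, hd, hS, -⟩ := exists_curve_of_mem_tangent hξ
  exact (hasDerivAt_comp_curve (contDiffOn_differentiableWithinAt hφ hx) hd hS).unique
    (h c rfl hd hS)

theorem fderivWithin_congr_apply {φ ψ : E → F} (h : Set.EqOn φ ψ S) (hx : x ∈ S) (ξ : E) :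
    fderivWithin ℝ φ S x ξ = fderivWithin ℝ ψ S x ξ := by
  rw [fderivWithin_congr h (h hx)]

/-- A local smooth retraction `ρ` makes `W ∘ ρ` a smooth extension of `W` to an open set. In tangent
directions its ordinary derivative agrees with the derivative within `S`, and it depends smoothly on
the point. -/
theorem contDiffOn_fderivWithin_apply
    (hret : ∀ x₀ ∈ S, ∃ ρ : E → E, (∀ᶠ z in 𝓝 x₀, ContDiffAt ℝ ∞ ρ z ∧ ρ z ∈ S) ∧ ∀ z ∈ S, ρ z = z)
    {W : E → F} {V : E → E} (hW : ContDiffOn ℝ ∞ W S) (hV : IsField S V) :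
    ContDiffOn ℝ ∞ (fun x => fderivWithin ℝ W S x (V x)) S := by
  intro x₀ hx₀
  obtain ⟨ρ, hρ, hid⟩ := hret x₀ hx₀
  have hg : ∀ᶠ z in 𝓝 x₀, ContDiffAt ℝ ∞ (fun y => W (ρ y)) z := by
    filter_upwards [hρ.eventually_nhds] with z hz
    have h2 := (hW (ρ z) hz.self_of_nhds.2).comp_of_mem_nhdsWithin_image z (s := {y | ρ y ∈ S})
      (f := ρ) hz.self_of_nhds.1.contDiffWithinAt
      (Filter.mem_of_superset self_mem_nhdsWithin (by rintro _ ⟨y, hy, rfl⟩; exact hy))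
    exact h2.contDiffAt (hz.mono fun _ h => h.2)
  have h3 : ContDiffWithinAt ℝ ∞ (fun z => fderiv ℝ (fun y => W (ρ y)) z (V z)) S x₀ :=
    ((hg.self_of_nhds.fderiv_right (m := ∞) (by simp)).contDiffWithinAt).clm_apply (hV.1 x₀ hx₀)
  have key : ∀ z ∈ S, ContDiffAt ℝ ∞ (fun y => W (ρ y)) z →
      fderivWithin ℝ W S z (V z) = fderiv ℝ (fun y => W (ρ y)) z (V z) := fun z hz h => by
    refine fderivWithin_eq_of_curve hW hz (hV.2 z hz) fun c hc hd hS => ?_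
    have h5 := ((h.differentiableAt (by simp)).hasFDerivAt).comp_hasDerivAt_of_eq (0 : ℝ) hd hc.symm
    exact h5.congr_of_eventuallyEq (hS.mono fun t ht => by simp [hid _ ht])
  refine h3.congr_of_eventuallyEq ?_ (key x₀ hx₀ hg.self_of_nhds)
  filter_upwards [self_mem_nhdsWithin, mem_nhdsWithin_of_mem_nhds hg] with z hz h
  exact key z hz h

theorem HasExp.exists_geodesic {nabla : E → E → (E → E) → E} {y : E} (h : HasExp S nabla x ξ y) :
    ∃ (γ v : ℝ → E) (J : Set ℝ) (D : (ℝ → E) → ℝ → E), IsOpen J ∧ Set.Icc 0 1 ⊆ J ∧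
      ContDiffOn ℝ ∞ γ J ∧ (∀ t ∈ J, γ t ∈ S) ∧ ContDiffOn ℝ ∞ v J ∧
      (∀ t ∈ J, HasDerivAt γ (v t) t) ∧ (∀ t ∈ J, v t ∈ tangent S (γ t)) ∧
      (∀ t ∈ J, v t = deriv γ t) ∧
      IsCovDerivAlong S nabla γ J D ∧ (∀ t ∈ J, D v t = 0) ∧ γ 0 = x ∧ v 0 = ξ ∧ γ 1 = y := by
  obtain ⟨γ, J, hJ, -, hJ1, ⟨hγ, hS, D, hD, hD0⟩, h0, hd0, h1⟩ := h
  have hat : ∀ t ∈ J, HasDerivAt γ (deriv γ t) t := fun t ht =>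
    ((hγ.contDiffAt (hJ.mem_nhds ht)).differentiableAt (by simp)).hasDerivAt
  refine ⟨γ, deriv γ, J, D, hJ, hJ1, hγ, hS, hγ.deriv_of_isOpen hJ (by simp), hat,
    fun t ht => ?_, fun _ _ => rfl, hD, hD0, h0, hd0, h1⟩
  refine mem_tangent_of_curve (hat t ht) (Filter.mem_of_superset (hJ.mem_nhds ht) hS) ?_
  filter_upwards [hJ.mem_nhds ht] with s hs using hγ.contDiffAt (hJ.mem_nhds hs)

theorem HasExp.of_geodesic {nabla : E → E → (E → E) → E} {γ v : ℝ → E} {J : Set ℝ}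
    {D : (ℝ → E) → ℝ → E} (hJ : IsOpen J) (hJc : J.OrdConnected) (hJ1 : Set.Icc 0 1 ⊆ J)
    (hγ : ContDiffOn ℝ ∞ γ J) (hS : ∀ t ∈ J, γ t ∈ S) (hv : ∀ t, HasDerivAt γ (v t) t)
    (hD : IsCovDerivAlong S nabla γ J D) (hD0 : ∀ t ∈ J, D v t = 0) :
    HasExp S nabla (γ 0) (v 0) (γ 1) := by
  have e : deriv γ = v := funext fun t => (hv t).deriv
  exact ⟨γ, J, hJ, hJc, hJ1, ⟨hγ, hS, D, hD, by rwa [e]⟩, rfl, by rw [e], rfl⟩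

variable [FiniteDimensional ℝ E]

/-- The covariant derivative of a vector field along a curve, in terms of a global frame. -/
theorem covDeriv_eq_sum {P : E → E → E} (hP : ∀ w, IsField S (P w))
    (hlin : ∀ x ∈ S, IsLinearMap ℝ fun w => P w x)
    (hid : ∀ x ∈ S, ∀ ξ ∈ tangent S x, P ξ x = ξ) {nabla : E → E → (E → E) → E} {γ : ℝ → E}
    {J : Set ℝ} (hγ : ContDiffOn ℝ ∞ γ J) (hS : ∀ t ∈ J, γ t ∈ S)
    {D : (ℝ → E) → ℝ → E} (hD : IsCovDerivAlong S nabla γ J D) {Z : ℝ → E}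
    (hZ : IsFieldAlong S γ J Z)
    {ι : Type*} [Fintype ι] (b : Module.Basis ι ℝ E) {t : ℝ} (ht : t ∈ J) :
    D Z t = ∑ i, (deriv (fun s => b.coord i (Z s)) t • P (b i) (γ t) +
      b.coord i (Z t) • nabla (γ t) (deriv γ t) (P (b i))) := by
  classical
  have hcoord : ∀ i, ContDiffOn ℝ ∞ (fun s => b.coord i (Z s)) J := fun i =>
    (LinearMap.toContinuousLinearMap (b.coord i)).contDiff.comp_contDiffOn hZ.1
  have hVf : ∀ i, IsFieldAlong S γ J (fun s => P (b i) (γ s)) := fun i =>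
    ⟨(hP (b i)).1.comp hγ hS, fun s hs => (hP (b i)).2 _ (hS s hs)⟩
  -- The fields `P (b i)` span but need not be independent; since `P` reproduces tangent vectors,
  -- the ambient coordinates of `Z` serve as coefficients.
  have hsum : ∀ s ∈ J, ∑ i, b.coord i (Z s) • P (b i) (γ s) = Z s := fun s hs => by
    have h1 := hid _ (hS s hs) _ (hZ.2 s hs)
    have h2 := congrArg (fun w => (hlin _ (hS s hs)).mk' _ w) (b.sum_repr (Z s))
    rw [map_sum] at h2
    simp only [map_smul, IsLinearMap.mk'_apply] at h2
    rw [h1] at h2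
    exact h2
  have hadd : ∀ s ∈ J, ∀ ξ ∈ tangent S (γ s), ∀ ζ ∈ tangent S (γ s), ξ + ζ ∈ tangent S (γ s) := by
    intro s hs ξ hξ ζ hζ
    have h1 := (hP (ξ + ζ)).2 _ (hS s hs)
    rwa [(hlin _ (hS s hs)).map_add, hid _ (hS s hs) _ hξ, hid _ (hS s hs) _ hζ] at h1
  have hsmul : ∀ s ∈ J, ∀ (a : ℝ), ∀ ξ ∈ tangent S (γ s), a • ξ ∈ tangent S (γ s) := by
    intro s hs a ξ hξ
    have h1 := (hP (a • ξ)).2 _ (hS s hs)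
    rwa [(hlin _ (hS s hs)).map_smul, hid _ (hS s hs) _ hξ] at h1
  -- The expansion of `Z` holds only on `J`, while `D` acts on functions on the whole line.
  -- Multiplying by the indicator of `J`, which is smooth on `J`, makes the two functions equal
  -- everywhere, and the Leibniz rule compares the results.
  have hcongr : ∀ Y : ℝ → E, IsFieldAlong S γ J Y → Set.EqOn Y Z J → D Y t = D Z t := by
    intro Y hY hYZ
    have hφ : ContDiffOn ℝ ∞ (J.indicator fun _ => (1 : ℝ)) J :=
      contDiffOn_const.congr fun s hs => Set.indicator_of_mem hs _
    have h1 := hD.leibniz _ Y hφ hY t ht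
    have h2 := hD.leibniz _ Z hφ hZ t ht
    have e : (fun s => (J.indicator fun _ => (1 : ℝ)) s • Y s) =
        fun s => (J.indicator fun _ => (1 : ℝ)) s • Z s := funext fun s => by
      by_cases hs : s ∈ J
      · rw [hYZ hs]
      · simp [hs]
    rw [e, h2, hYZ ht, Set.indicator_of_mem ht, one_smul, one_smul] at h1
    exact (add_left_cancel h1).symm
  have hone : ∀ i, D (fun s => b.coord i (Z s) • P (b i) (γ s)) t =
      deriv (fun s => b.coord i (Z s)) t • P (b i) (γ t) +
        b.coord i (Z t) • nabla (γ t) (deriv γ t) (P (b i)) := fun i => by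
    rw [hD.leibniz _ _ (hcoord i) (hVf i) t ht, hD.comp _ (hP (b i)) t ht]
  have hterm : ∀ i, IsFieldAlong S γ J (fun s => b.coord i (Z s) • P (b i) (γ s)) := fun i =>
    ⟨(hcoord i).smul (hVf i).1, fun s hs => hsmul s hs _ _ ((hVf i).2 s hs)⟩
  -- The Leibniz rule with the zero coefficient; it starts the induction over finite sums.
  have hzero : D (fun _ => 0) t = 0 := by
    have := hD.leibniz (fun _ => 0) Z contDiffOn_const hZ t ht
    simpa using this
  have hfin : ∀ A : Finset ι, IsFieldAlong S γ J
      (fun s => ∑ i ∈ A, b.coord i (Z s) • P (b i) (γ s)) ∧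
      D (fun s => ∑ i ∈ A, b.coord i (Z s) • P (b i) (γ s)) t =
        ∑ i ∈ A, D (fun s => b.coord i (Z s) • P (b i) (γ s)) t := by
    intro A
    induction A using Finset.induction_on with
    | empty =>
      refine ⟨⟨by simpa using contDiffOn_const, fun s hs => ?_⟩, by simpa using hzero⟩
      have := hsmul s hs 0 _ (hZ.2 s hs)
      simpa using this
    | insert i A hi ih =>
      simp only [Finset.sum_insert hi]
      refine ⟨⟨(hterm i).1.add ih.1.1, fun s hs => hadd s hs _ ((hterm i).2 s hs) _ (ih.1.2 s hs)⟩, ?_⟩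
      rw [hD.add _ _ (hterm i) ih.1 t ht, ih.2]
  rw [← hcongr _ (hfin Finset.univ).1 hsum, (hfin Finset.univ).2]
  exact Finset.sum_congr rfl fun i _ => hone i

end EmbeddedSubmanifolds

/-! ### Levi-Civita connection and exponential of the total space. -/

section TotalSpace

variable {m n p : ℕ}

theorem hasDerivAt_gBar {z : Pair m n p} {A B : ℝ → Pair m n p} {A' B' : Pair m n p} {t : ℝ}
    (hA : HasDerivAt A A' t) (hB : HasDerivAt B B' t) :
    HasDerivAt (fun s => gBar z (A s) (B s)) (gBar z A' (B t) + gBar z (A t) B') t := by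
  have h1 := hasDerivAt_matrix_mul (hasDerivAt_transpose (hasDerivAt_fst hA)) (hasDerivAt_fst hB)
  have h2 := hasDerivAt_matrix_mul (hasDerivAt_transpose (hasDerivAt_snd hA)) (hasDerivAt_snd hB)
  refine (hasDerivAt_trace (h1.add h2)).congr_deriv ?_
  simp only [gBar, Matrix.trace_add]
  ring

theorem contDiffOn_gBar {E : Type*} [NormedAddCommGroup E] [NormedSpace ℝ E] {s : Set E}
    {Z A B : E → Pair m n p} (hA : ContDiffOn ℝ ∞ A s) (hB : ContDiffOn ℝ ∞ B s) :
    ContDiffOn ℝ ∞ (fun y => gBar (Z y) (A y) (B y)) s := fun y hy => by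
  unfold gBar
  refine contDiffWithinAt_trace ?_
  exact (by fun_prop : ContDiffOn ℝ ∞ (fun y => (A y).1ᵀ * (B y).1 + (A y).2ᵀ * (B y).2) s) y hy

theorem isRiemannianMetric_gBar : IsRiemannianMetric (SRp m n p) gBar where
  add_left _ _ _ _ _ _ _ _ := gBar_add_left _ _ _ _
  smul_left _ _ _ _ _ _ _ := gBar_smul_left _ _ _ _
  symm _ _ _ _ _ _ := gBar_comm _ _ _
  pos _ _ _ _ h := gBar_self_pos h
  smooth _ _ hV hW := contDiffOn_gBar hV.1 hW.1

/-- The derivative of the tangency condition along a curve. -/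
theorem tangent_deriv {c Z : ℝ → Pair m n p} {v w : Pair m n p} {t : ℝ} (hc : HasDerivAt c v t)
    (hZ : HasDerivAt Z w t) (h : ∀ᶠ s in 𝓝 t, Z s ∈ tangentSpace (c s)) :
    (c t).1ᵀ * w.1 + w.1ᵀ * (c t).1 + (v.1ᵀ * (Z t).1 + (Z t).1ᵀ * v.1) = 0 := by
  have h1 := hasDerivAt_matrix_mul (hasDerivAt_transpose (hasDerivAt_fst hc)) (hasDerivAt_fst hZ)
  have h2 := hasDerivAt_matrix_mul (hasDerivAt_transpose (hasDerivAt_fst hZ)) (hasDerivAt_fst hc)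
  have h3 := (h1.add h2).unique ((hasDerivAt_const t (0 : Matrix (Fin p) (Fin p) ℝ)).congr_of_eventuallyEq
    (h.mono fun _ h => h))
  rw [← h3]
  abel

/-- The derivative of the horizontality condition along a curve. -/
theorem horizontal_deriv {c Z : ℝ → Pair m n p} {v w : Pair m n p} {t : ℝ} (hc : HasDerivAt c v t)
    (hZ : HasDerivAt Z w t) (h : ∀ᶠ s in 𝓝 t, Z s ∈ horizontalSpace (c s)) :
    (w.1ᵀ * (c t).1 + (Z t).1ᵀ * v.1 + (w.2ᵀ * (c t).2 + (Z t).2ᵀ * v.2))ᵀ =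
      w.1ᵀ * (c t).1 + (Z t).1ᵀ * v.1 + (w.2ᵀ * (c t).2 + (Z t).2ᵀ * v.2) := by
  have h1 := hasDerivAt_matrix_mul (hasDerivAt_transpose (hasDerivAt_fst hZ)) (hasDerivAt_fst hc)
  have h2 := hasDerivAt_matrix_mul (hasDerivAt_transpose (hasDerivAt_snd hZ)) (hasDerivAt_snd hc)
  exact (hasDerivAt_transpose (h1.add h2)).unique
    ((h1.add h2).congr_of_eventuallyEq (h.mono fun _ h => h.2))

theorem field_deriv {W : Pair m n p → Pair m n p} (hW : IsField (SRp m n p) W) {z η : Pair m n p}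
    (hz : z ∈ SRp m n p) (hη : η ∈ tangent (SRp m n p) z) :
    z.1ᵀ * (fderivWithin ℝ W (SRp m n p) z η).1 + (fderivWithin ℝ W (SRp m n p) z η).1ᵀ * z.1 +
      (η.1ᵀ * (W z).1 + (W z).1ᵀ * η.1) = 0 := by
  obtain ⟨c, rfl, hd, hS, -⟩ := exists_curve_of_mem_tangent hη
  exact tangent_deriv hd
    (hasDerivAt_comp_curve (contDiffOn_differentiableWithinAt hW.1 hz) hd hS)
    (hS.mono fun t ht => (mem_tangent_iff ht).1 (hW.2 _ ht))

theorem nablaBar_congr {V W : Pair m n p → Pair m n p} (h : Set.EqOn V W (SRp m n p))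
    {z : Pair m n p} (hz : z ∈ SRp m n p) (η : Pair m n p) : nablaBar z η V = nablaBar z η W := by
  rw [nablaBar, nablaBar, fderivWithin_congr h (h hz)]

theorem isLeviCivita_nablaBar : IsLeviCivita (SRp m n p) gBar nablaBar where
  mem_tangent _ hz _ _ _ _ := (mem_tangent_iff hz).2 (tproj_mem hz _)
  smooth V W hV hW := contDiffOn_tproj contDiffOn_id
    (contDiffOn_fderivWithin_apply (fun _ h => exists_retraction h) hW.1 hV)
  congr z hz η _ V W _ _ h := nablaBar_congr h hz η
  add_left z hz η _ ζ _ V _ := by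
    rw [nablaBar, map_add, tproj_add]
    rfl
  smul_left z hz a η _ V _ := by
    rw [nablaBar, map_smul, tproj_smul]
    rfl
  add_right z hz η hη V W hV hW := by
    have : fderivWithin ℝ (fun y => V y + W y) (SRp m n p) z η =
        fderivWithin ℝ V (SRp m n p) z η + fderivWithin ℝ W (SRp m n p) z η := by
      refine fderivWithin_eq_of_curve (hV.1.add hW.1) hz hη fun c hc hd hS => ?_
      subst hc
      exact (hasDerivAt_comp_curve (contDiffOn_differentiableWithinAt hV.1 hz) hd hS).add
        (hasDerivAt_comp_curve (contDiffOn_differentiableWithinAt hW.1 hz) hd hS)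
    rw [nablaBar, this, tproj_add]
    rfl
  leibniz z hz η hη φ V hφ hV := by
    have : fderivWithin ℝ (fun y => φ y • V y) (SRp m n p) z η =
        φ z • fderivWithin ℝ V (SRp m n p) z η + fderivWithin ℝ φ (SRp m n p) z η • V z := by
      refine fderivWithin_eq_of_curve (hφ.smul hV.1) hz hη fun c hc hd hS => ?_
      subst hc
      exact (hasDerivAt_comp_curve (contDiffOn_differentiableWithinAt hφ hz) hd hS).smul
        (hasDerivAt_comp_curve (contDiffOn_differentiableWithinAt hV.1 hz) hd hS)
    rw [nablaBar, this, tproj_add, tproj_smul, tproj_smul,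
      tproj_of_mem ((mem_tangent_iff hz).1 (hV.2 z hz)), add_comm]
    rfl
  torsion_free z hz V W hV hW := by
    rw [nablaBar, nablaBar, ← tproj_sub, VectorField.lieBracketWithin]
    -- The Lie bracket is tangent: differentiating the tangency condition for `V` and for `W` leaves
    -- correction terms symmetric in the two fields, and these cancel in the difference.
    refine tproj_of_mem ?_
    have h1 := field_deriv hW hz (hV.2 z hz)
    have h2 := field_deriv hV hz (hW.2 z hz)
    change _ + _ = (0 : Matrix (Fin p) (Fin p) ℝ)
    rw [← sub_eq_zero.2 (h1.trans h2.symm)]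
    simp only [Prod.fst_sub, Matrix.mul_sub, Matrix.transpose_sub, Matrix.sub_mul]
    abel
  metric z hz η hη V W hV hW := by
    rw [nablaBar, nablaBar, gBar_tproj _ ((mem_tangent_iff hz).1 (hW.2 z hz)), gBar_comm z (V z),
      gBar_tproj _ ((mem_tangent_iff hz).1 (hV.2 z hz)), gBar_comm z _ (V z)]
    refine fderivWithin_eq_of_curve (contDiffOn_gBar hV.1 hW.1) hz hη fun c hc hd hS => ?_
    subst hc
    exact hasDerivAt_gBar (hasDerivAt_comp_curve (contDiffOn_differentiableWithinAt hV.1 hz) hd hS)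
      (hasDerivAt_comp_curve (contDiffOn_differentiableWithinAt hW.1 hz) hd hS)

theorem isCovDerivAlong_tproj {γ : ℝ → Pair m n p} {J : Set ℝ} (hJ : IsOpen J)
    (hγ : ContDiffOn ℝ ∞ γ J) (hS : ∀ t ∈ J, γ t ∈ SRp m n p) :
    IsCovDerivAlong (SRp m n p) nablaBar γ J fun Z t => tproj (γ t) (deriv Z t) where
  field Z hZ := ⟨contDiffOn_tproj hγ (hZ.1.deriv_of_isOpen hJ (by simp)),
    fun t ht => (mem_tangent_iff (hS t ht)).2 (tproj_mem (hS t ht) _)⟩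
  add Y Z hY hZ t ht := by
    have h1 := (hY.1.contDiffAt (hJ.mem_nhds ht)).differentiableAt (by simp)
    have h2 := (hZ.1.contDiffAt (hJ.mem_nhds ht)).differentiableAt (by simp)
    rw [← tproj_add]
    exact congrArg _ (h1.hasDerivAt.add h2.hasDerivAt).deriv
  leibniz φ Z hφ hZ t ht := by
    have h1 := (hφ.contDiffAt (hJ.mem_nhds ht)).differentiableAt (by simp)
    have h2 := (hZ.1.contDiffAt (hJ.mem_nhds ht)).differentiableAt (by simp)
    have h3 : Z t ∈ tangentSpace (γ t) := (mem_tangent_iff (hS t ht)).1 (hZ.2 t ht)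
    have h4 := congrArg (tproj (γ t)) (h1.hasDerivAt.smul h2.hasDerivAt).deriv
    rw [tproj_add, tproj_smul, tproj_smul, tproj_of_mem h3, add_comm] at h4
    exact h4
  comp V hV t ht := by
    have h1 := (hγ.contDiffAt (hJ.mem_nhds ht)).differentiableAt (by simp)
    exact congrArg (tproj (γ t)) (hasDerivAt_comp_curve
      (contDiffOn_differentiableWithinAt hV.1 (hS t ht)) h1.hasDerivAt
      (Filter.mem_of_superset (hJ.mem_nhds ht) hS)).deriv

theorem isField_tproj (w : Pair m n p) : IsField (SRp m n p) fun z => tproj z w :=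
  ⟨contDiffOn_tproj contDiffOn_id contDiffOn_const,
    fun _ hz => (mem_tangent_iff hz).2 (tproj_mem hz w)⟩

/-- The frame expansion determines a covariant derivative along `γ` from the connection, so any `D`
agrees with the explicit one. -/
theorem covDeriv_total {γ : ℝ → Pair m n p} {J : Set ℝ} (hJ : IsOpen J)
    (hγ : ContDiffOn ℝ ∞ γ J) (hS : ∀ t ∈ J, γ t ∈ SRp m n p)
    {D : (ℝ → Pair m n p) → ℝ → Pair m n p} (hD : IsCovDerivAlong (SRp m n p) nablaBar γ J D)
    {Z : ℝ → Pair m n p} (hZ : IsFieldAlong (SRp m n p) γ J Z) {t : ℝ} (ht : t ∈ J)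
    {w : Pair m n p} (hw : HasDerivAt Z w t) : D Z t = tproj (γ t) w := by
  have key : ∀ {D' : (ℝ → Pair m n p) → ℝ → Pair m n p},
      IsCovDerivAlong (SRp m n p) nablaBar γ J D' → D' Z t = _ := fun hD' =>
    covDeriv_eq_sum (P := fun w z => tproj z w) isField_tproj
      (fun _ _ => ⟨tproj_add _, tproj_smul _⟩)
      (fun _ hz _ hξ => tproj_of_mem ((mem_tangent_iff hz).1 hξ)) hγ hS hD' hZ
      (Module.finBasis ℝ (Pair m n p)) ht
  rw [key hD, ← key (isCovDerivAlong_tproj hJ hγ hS)]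
  exact congrArg (tproj (γ t)) hw.deriv

/-- The vector field of the geodesic equation of the total space. -/
def geodesicSpray (q : Pair m n p × Pair m n p) : Pair m n p × Pair m n p :=
  (q.2, (-(q.1.1 * (q.2.1ᵀ * q.2.1)), 0))

theorem contDiff_geodesicSpray : ContDiff ℝ 1 (geodesicSpray (m := m) (n := n) (p := p)) := by
  unfold geodesicSpray
  fun_prop

theorem exists_open_interval {U : Set ℝ} (hU : IsOpen U) (h : Set.Icc (0 : ℝ) 1 ⊆ U) :
    ∃ J : Set ℝ, IsOpen J ∧ J.OrdConnected ∧ Set.Icc 0 1 ⊆ J ∧ J ⊆ U := by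
  obtain ⟨δ, hδ, hs⟩ := isCompact_Icc.exists_thickening_subset_open hU h
  refine ⟨Set.Ioo (-δ) (1 + δ), isOpen_Ioo, Set.ordConnected_Ioo,
    fun t ht => ⟨by linarith [ht.1], by linarith [ht.2]⟩, fun t ht => hs ?_⟩
  rw [Metric.mem_thickening_iff]
  rcases le_total t 0 with h0 | h0
  · exact ⟨0, by simp, by rw [Real.dist_eq, abs_lt]; constructor <;> linarith [ht.1]⟩
  rcases le_total t 1 with h1 | h1
  · exact ⟨t, ⟨h0, h1⟩, by simpa using hδ⟩
  · exact ⟨1, by simp, by rw [Real.dist_eq, abs_lt]; constructor <;> linarith [ht.2]⟩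

variable {z η : Pair m n p}

theorem geod_mem_interval (hz : z ∈ SRp m n p) (hη : η ∈ tangentSpace z)
    (hr : StaysFullRank z η) : ∃ J : Set ℝ, IsOpen J ∧ J.OrdConnected ∧ Set.Icc 0 1 ⊆ J ∧
      ∀ t ∈ J, geod z η t ∈ SRp m n p := by
  have hc : Continuous fun t : ℝ => z.2 + t • η.2 := by fun_prop
  obtain ⟨J, h1, h2, h3, h4⟩ := exists_open_interval (isOpen_rank_eq.preimage hc) hr
  exact ⟨J, h1, h2, h3, fun t ht => ⟨geod_stiefel hz.1 hη t, h4 ht⟩⟩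

theorem tproj_geod_acceleration (hz : z ∈ SRp m n p) (hη : η ∈ tangentSpace z) (t : ℝ) :
    tproj (geod z η t)
      (-((geod z η t).1 * ((geodVel z η t).1ᵀ * (geodVel z η t).1)), 0) = 0 := by
  have h := geod_stiefel hz.1 hη t
  rw [tproj_eq]
  refine Prod.ext ?_ (by simp)
  simp only [Matrix.mul_neg, Matrix.transpose_neg, Matrix.neg_mul, Matrix.transpose_mul,
    Matrix.transpose_transpose, Prod.fst_sub, Prod.fst_zero]
  rw [Matrix.mul_assoc _ (geod z η t).1ᵀ, h, ← Matrix.mul_assoc (geod z η t).1ᵀ, h, Matrix.one_mul,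
    Matrix.mul_one, ← neg_add, smul_neg, ← two_smul ℝ, smul_smul]
  norm_num

/-- Position and velocity of a geodesic solve the same first-order equation as the closed form, so
they coincide on `[0, 1]`. The rank condition then expresses that the second component `N + t Ṅ`
stays admissible. -/
theorem hasExp_total_iff (hz : z ∈ SRp m n p) (hη : η ∈ tangent (SRp m n p) z) (w : Pair m n p) :
    HasExp (SRp m n p) nablaBar z η w ↔ StaysFullRank z η ∧ w = expTotal z η := by
  have hη' := (mem_tangent_iff hz).1 hη
  constructor
  · intro h
    obtain ⟨γ, v, J, D, hJ, hJ1, hγ, hS, hv, hat, hmem, -, hD, hD0, h0, hd0, h1⟩ :=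
      h.exists_geodesic
    have hode : ∀ t ∈ Set.Icc (0 : ℝ) 1, HasDerivAt (fun t => (γ t, v t))
        (geodesicSpray (γ t, v t)) t := fun t ht => by
      have htJ := hJ1 ht
      obtain ⟨w, hw⟩ : ∃ w, HasDerivAt v w t :=
        ⟨_, ((hv.contDiffAt (hJ.mem_nhds htJ)).differentiableAt (by simp)).hasDerivAt⟩
      refine (hat t htJ).prodMk (hw.congr_deriv ?_)
      have h3 := covDeriv_total hJ hγ hS hD ⟨hv, hmem⟩ htJ hw
      -- Vanishing tangential acceleration leaves only the normal part `M sym(Mᵀ Γ)` of the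
      -- acceleration `Γ`. The differentiated tangency condition evaluates the symmetric factor as
      -- `-Ṁᵀ Ṁ`.
      rw [hD0 t htJ, tproj_eq] at h3
      have h4 := tangent_deriv (hat t htJ) hw (Filter.mem_of_superset (hJ.mem_nhds htJ)
        fun s hs => (mem_tangent_iff (hS s hs)).1 (hmem s hs))
      rw [eq_neg_of_add_eq_zero_left h4] at h3
      rw [sub_eq_zero.1 h3.symm, ← two_smul ℝ ((v t).1ᵀ * _), smul_neg, smul_smul]
      norm_num
    have heq := eqOn_of_hasDerivAt contDiff_geodesicSpray hode
      (g := fun t => (geod z η t, geodVel z η t))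
      (fun t _ => (hasDerivAt_geod z η t).prodMk (hasDerivAt_geodVel hz.1 hη' t))
      (by simp [h0, hd0, geod_zero, geodVel_zero])
    have heq' : ∀ t ∈ Set.Icc (0 : ℝ) 1, γ t = geod z η t := fun t ht => congrArg Prod.fst (heq ht)
    refine ⟨fun t ht => ?_, ?_⟩
    · have := (hS t (hJ1 ht)).2
      rw [heq' t ht] at this
      exact this
    · rw [← h1, heq' 1 (Set.right_mem_Icc.2 zero_le_one), ← geod_one]
  · rintro ⟨hr, rfl⟩
    obtain ⟨J, hJ, hJc, hJ1, hS⟩ := geod_mem_interval hz hη' hr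
    have h := HasExp.of_geodesic hJ hJc hJ1 (contDiff_geod z η).contDiffOn hS (hasDerivAt_geod z η)
      (isCovDerivAlong_tproj hJ (contDiff_geod z η).contDiffOn hS) fun t _ =>
        (congrArg (tproj (geod z η t)) (hasDerivAt_geodVel hz.1 hη' t).deriv).trans
          (tproj_geod_acceleration hz hη' t)
    rwa [geod_zero, geodVel_zero, geod_one] at h

end TotalSpace

/-! ### Uniqueness of the Levi-Civita connection. -/

section LeviCivitaUnique

variable {E : Type*} [NormedAddCommGroup E] [NormedSpace ℝ E] {S : Set E}
  {g : E → E → E → ℝ} {nabla₁ nabla₂ : E → E → (E → E) → E}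

/-- The difference of two connections, paired with a third field, is symmetric in its first two
arguments by torsion-freeness and antisymmetric in the last two by metric compatibility. Alternating
the two symmetries shows that it equals its own negative. -/
theorem IsLeviCivita.unique (hg : IsRiemannianMetric S g)
    (hsub : ∀ x ∈ S, ∀ ξ ∈ tangent S x, ∀ ζ ∈ tangent S x, ξ - ζ ∈ tangent S x)
    (hext : ∀ x ∈ S, ∀ ξ ∈ tangent S x, ∃ V, IsField S V ∧ V x = ξ)
    (h₁ : IsLeviCivita S g nabla₁) (h₂ : IsLeviCivita S g nabla₂) {x ξ : E} (hx : x ∈ S)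
    (hξ : ξ ∈ tangent S x) {V : E → E} (hV : IsField S V) : nabla₁ x ξ V = nabla₂ x ξ V := by
  have gsub : ∀ a ∈ tangent S x, ∀ b ∈ tangent S x, ∀ u ∈ tangent S x,
      g x (a - b) u = g x a u - g x b u := fun a ha b hb u hu => by
    have := hg.add_left x hx _ (hsub x hx a ha b hb) b hb u hu
    rw [sub_add_cancel] at this
    linarith
  have m1 : ∀ A B, IsField S A → IsField S B → nabla₁ x (A x) B ∈ tangent S x := fun A B hA hB =>
    h₁.mem_tangent x hx _ (hA.2 x hx) B hB
  have m2 : ∀ A B, IsField S A → IsField S B → nabla₂ x (A x) B ∈ tangent S x := fun A B hA hB =>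
    h₂.mem_tangent x hx _ (hA.2 x hx) B hB
  let c : (E → E) → (E → E) → (E → E) → ℝ := fun A B C =>
    g x (nabla₁ x (A x) B - nabla₂ x (A x) B) (C x)
  have hsymm : ∀ A B C, IsField S A → IsField S B → c A B C = c B A C := fun A B C hA hB => by
    have e1 := h₁.torsion_free x hx A B hA hB
    have e2 := h₂.torsion_free x hx A B hA hB
    have : nabla₁ x (A x) B - nabla₂ x (A x) B = nabla₁ x (B x) A - nabla₂ x (B x) A := by
      rw [sub_eq_iff_eq_add] at e1 e2
      rw [e1, e2]
      abel
    simp only [c, this]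
  have hanti : ∀ A B C, IsField S A → IsField S B → IsField S C → c A B C = -c A C B :=
    fun A B C hA hB hC => by
      have e1 := h₁.metric x hx _ (hA.2 x hx) B C hB hC
      have e2 := h₂.metric x hx _ (hA.2 x hx) B C hB hC
      simp only [c]
      rw [gsub _ (m1 A B hA hB) _ (m2 A B hA hB) _ (hC.2 x hx),
        gsub _ (m1 A C hA hC) _ (m2 A C hA hC) _ (hB.2 x hx),
        hg.symm x hx _ (m1 A C hA hC) _ (hB.2 x hx), hg.symm x hx _ (m2 A C hA hC) _ (hB.2 x hx)]
      linarith
  have hzero : ∀ A B C, IsField S A → IsField S B → IsField S C → c A B C = 0 :=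
    fun A B C hA hB hC => by
      have e1 := hanti A B C hA hB hC
      have e2 := hsymm A C B hA hC
      have e3 := hanti C A B hC hA hB
      have e4 := hsymm C B A hC hB
      have e5 := hanti B C A hB hC hA
      have e6 := hsymm B A C hB hA
      linarith
  obtain ⟨A, hA, rfl⟩ := hext x hx ξ hξ
  have hd := hsub x hx _ (m1 A V hA hV) _ (m2 A V hA hV)
  -- Taking for the third field an extension of the difference itself turns the vanishing pairing
  -- into a vanishing squared norm.
  obtain ⟨C, hC, hCx⟩ := hext x hx _ hd
  by_contra hne
  have hpos := hg.pos x hx _ hd (sub_ne_zero.2 hne)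
  have := hzero A V C hA hV hC
  simp only [c, hCx] at this
  linarith

end LeviCivitaUnique

/-! ### The quotient metric and its Levi-Civita connection. -/

section Quotient

variable {m n p : ℕ} {z η : Pair m n p} {ξ : Matrix (Fin m) (Fin n) ℝ}
  {V W : Matrix (Fin m) (Fin n) ℝ → Matrix (Fin m) (Fin n) ℝ}

/-- The horizontal lift of a vector field. -/
def liftField (p : ℕ) (V : Matrix (Fin m) (Fin n) ℝ → Matrix (Fin m) (Fin n) ℝ) (z : Pair m n p) :
    Pair m n p := lift z (V (proj z))

theorem IsField.tangent_proj (hV : IsField (Mp m n p) V) (hz : z ∈ SRp m n p) :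
    V (proj z) ∈ tangent (Mp m n p) (proj z) := hV.2 _ (proj_mem hz)

theorem liftField_mem (hV : IsField (Mp m n p) V) (hz : z ∈ SRp m n p) :
    liftField p V z ∈ horizontalSpace z := lift_mem hz (hV.tangent_proj hz)

theorem isField_liftField (hV : IsField (Mp m n p) V) : IsField (SRp m n p) (liftField p V) :=
  ⟨contDiffOn_lift contDiffOn_id (contDiffOn_comp_proj hV.1) (fun _ h => h)
    fun _ h => hV.tangent_proj h,
    fun _ hz => (mem_tangent_iff hz).2 (horizontalSpace_le _ (liftField_mem hV hz))⟩

theorem hasDerivAt_act {c : ℝ → Pair m n p} {v : Pair m n p} {t : ℝ} (hc : HasDerivAt c v t)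
    (Q : Matrix (Fin p) (Fin p) ℝ) : HasDerivAt (fun s => act (c s) Q) (act v Q) t := by
  have h1 := hasDerivAt_matrix_mul (hasDerivAt_fst hc) (hasDerivAt_const t Q)
  have h2 := hasDerivAt_matrix_mul (hasDerivAt_snd hc) (hasDerivAt_const t Q)
  refine (h1.prodMk h2).congr_deriv ?_
  simp [act]

/-- The lifted field is equivariant, so its derivative along a curve translated by the fixed matrix
`Q` is the translated derivative; `tproj` commutes with the translation. -/
theorem nablaBar_liftField_act (hV : IsField (Mp m n p) V) (hz : z ∈ SRp m n p)
    (hη : η ∈ tangentSpace z) {Q : Matrix (Fin p) (Fin p) ℝ} (hQ : Qᵀ * Q = 1) :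
    nablaBar (act z Q) (act η Q) (liftField p V) = act (nablaBar z η (liftField p V)) Q := by
  have hdiff := fun (x : Pair m n p) (hx : x ∈ SRp m n p) =>
    contDiffOn_differentiableWithinAt (isField_liftField hV).1 hx
  obtain ⟨c, rfl, hd, hS, -⟩ := exists_curve_of_mem_tangent ((mem_tangent_iff hz).2 hη)
  have h1 := hasDerivAt_comp_curve (c := fun s => act (c s) Q) (hdiff _ (act_mem hz hQ))
    (hasDerivAt_act hd Q) (hS.mono fun _ h => act_mem h hQ)
  have h2 := hasDerivAt_act (hasDerivAt_comp_curve (hdiff _ hz) hd hS) Q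
  have h3 := h1.unique (h2.congr_of_eventuallyEq (hS.mono fun t ht => by
    simp only [liftField, proj_act _ hQ]
    exact lift_act ht (hV.tangent_proj ht) hQ))
  rw [nablaBar, nablaBar, ← tproj_act_act _ _ hQ]
  exact congrArg (tproj _) h3

/-- The quotient connection: the image under `Dπ` of the covariant derivative of the horizontal
lifts. -/
def nablaQuot (p : ℕ) (X ξ : Matrix (Fin m) (Fin n) ℝ)
    (V : Matrix (Fin m) (Fin n) ℝ → Matrix (Fin m) (Fin n) ℝ) : Matrix (Fin m) (Fin n) ℝ :=
  dproj (fiberPoint p X) (nablaBar (fiberPoint p X) (lift (fiberPoint p X) ξ) (liftField p V))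

theorem nablaQuot_proj (hz : z ∈ SRp m n p) (hξ : ξ ∈ tangent (Mp m n p) (proj z))
    (hV : IsField (Mp m n p) V) :
    nablaQuot p (proj z) ξ V = dproj z (nablaBar z (lift z ξ) (liftField p V)) := by
  obtain ⟨Q, hQ, e, -⟩ := fiberPoint_proj hz
  rw [nablaQuot, e, lift_act hz hξ hQ,
    nablaBar_liftField_act hV hz (horizontalSpace_le z (lift_mem hz hξ)) hQ, dproj_act_act _ _ hQ]

theorem fderivWithin_comp_proj {F : Type*} [NormedAddCommGroup F] [NormedSpace ℝ F]
    {φ : Matrix (Fin m) (Fin n) ℝ → F} (hφ : ContDiffOn ℝ ∞ φ (Mp m n p)) (hz : z ∈ SRp m n p)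
    (hη : η ∈ tangentSpace z) :
    fderivWithin ℝ (fun w : Pair m n p => φ (proj w)) (SRp m n p) z η =
      fderivWithin ℝ φ (Mp m n p) (proj z) (dproj z η) := by
  refine fderivWithin_eq_of_curve (contDiffOn_comp_proj hφ) hz ((mem_tangent_iff hz).2 hη)
    fun c hc hd hS => ?_
  subst hc
  exact hasDerivAt_comp_curve (c := fun t => proj (c t))
    (contDiffOn_differentiableWithinAt hφ (proj_mem hz)) (hasDerivAt_proj hd)
    (hS.mono fun _ h => proj_mem h)

/-- Differentiating `Dπ(c)[lift of V] = V(π(c))` along a curve. The second-order correction is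
symmetric in `η` and the lift, hence disappears from the torsion. -/
theorem dproj_fderivWithin_liftField (hV : IsField (Mp m n p) V) (hz : z ∈ SRp m n p)
    (hη : η ∈ tangentSpace z) :
    dproj z (fderivWithin ℝ (liftField p V) (SRp m n p) z η) =
      fderivWithin ℝ V (Mp m n p) (proj z) (dproj z η) -
        ((liftField p V z).1 * η.2ᵀ + η.1 * (liftField p V z).2ᵀ) := by
  obtain ⟨c, rfl, hd, hS, -⟩ := exists_curve_of_mem_tangent ((mem_tangent_iff hz).2 hη)
  have h1 := hasDerivAt_comp_curve
    (contDiffOn_differentiableWithinAt (isField_liftField hV).1 hz) hd hS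
  have h2 := (hasDerivAt_matrix_mul (hasDerivAt_fst h1) (hasDerivAt_transpose (hasDerivAt_snd hd))).add
    (hasDerivAt_matrix_mul (hasDerivAt_fst hd) (hasDerivAt_transpose (hasDerivAt_snd h1)))
  have h3 := hasDerivAt_comp_curve (c := fun t => proj (c t))
    (contDiffOn_differentiableWithinAt hV.1 (proj_mem hz)) (hasDerivAt_proj hd)
    (hS.mono fun _ h => proj_mem h)
  have h4 := h2.unique (h3.congr_of_eventuallyEq (hS.mono fun t ht => by
    have := dproj_lift ht (hV.tangent_proj ht)
    rw [dproj_eq] at this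
    exact this))
  rw [eq_sub_iff_add_eq]
  refine Eq.trans ?_ h4
  have key : ∀ A B C D : Matrix (Fin m) (Fin n) ℝ, A + B + (C + D) = A + C + (D + B) := by
    intros
    abel
  rw [dproj_eq]
  exact key _ _ _ _

theorem contDiffOn_quotMetric (hV : IsField (Mp m n p) V) (hW : IsField (Mp m n p) W) :
    ContDiffOn ℝ ∞ (fun X => quotMetric p X (V X) (W X)) (Mp m n p) :=
  contDiffOn_Mp_of_comp_proj ((contDiffOn_gBar (Z := id) (isField_liftField hV).1
    (isField_liftField hW).1).congr fun _ hz =>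
      quotMetric_proj hz (hV.tangent_proj hz) (hW.tangent_proj hz))

theorem isRiemannianMetric_quotMetric :
    IsRiemannianMetric (Mp m n p) (quotMetric p) where
  add_left X hX ξ hξ ζ hζ η hη := by
    obtain ⟨z, hz, rfl⟩ := exists_proj_eq hX
    rw [quotMetric_proj hz (tangent_Mp_add hz hξ hζ) hη, quotMetric_proj hz hξ hη,
      quotMetric_proj hz hζ hη, lift_add hz hξ hζ, gBar_add_left]
  smul_left X hX a ξ hξ η hη := by
    obtain ⟨z, hz, rfl⟩ := exists_proj_eq hX
    rw [quotMetric_proj hz (tangent_Mp_smul hz a hξ) hη, quotMetric_proj hz hξ hη,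
      lift_smul hz a hξ, gBar_smul_left]
  symm X hX ξ hξ η hη := by
    obtain ⟨z, hz, rfl⟩ := exists_proj_eq hX
    rw [quotMetric_proj hz hξ hη, quotMetric_proj hz hη hξ, gBar_comm]
  pos X hX ξ hξ h := by
    obtain ⟨z, hz, rfl⟩ := exists_proj_eq hX
    rw [quotMetric_proj hz hξ hξ]
    refine gBar_self_pos fun h0 => h ?_
    rw [← dproj_lift hz hξ, h0, ← sub_self (0 : Pair m n p), dproj_sub, sub_self]
  smooth V W hV hW := contDiffOn_quotMetric hV hW

theorem quotMetric_dproj_left (hz : z ∈ SRp m n p) (hη : η ∈ tangentSpace z)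
    (hξ : ξ ∈ tangent (Mp m n p) (proj z)) :
    quotMetric p (proj z) (dproj z η) ξ = gBar z η (lift z ξ) := by
  rw [quotMetric_proj hz (dproj_mem_tangent hz hη) hξ, lift_dproj hz hη,
    gBar_hproj hz hη (lift_mem hz hξ)]

theorem nablaBar_mem (hz : z ∈ SRp m n p) (η : Pair m n p) (V : Pair m n p → Pair m n p) :
    nablaBar z η V ∈ tangentSpace z := tproj_mem hz _

theorem lift_mem_tangent (hz : z ∈ SRp m n p) (hξ : ξ ∈ tangent (Mp m n p) (proj z)) :
    lift z ξ ∈ tangent (SRp m n p) z :=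
  (mem_tangent_iff hz).2 (horizontalSpace_le z (lift_mem hz hξ))

/-- Each axiom is checked at a point `z` of the fiber, where it becomes the axiom for `nablaBar` on
lifted fields. In the metric identity, `Dπ` may discard vertical parts because they are orthogonal
to lifts. -/
theorem isLeviCivita_nablaQuot : IsLeviCivita (Mp m n p) (quotMetric p) (nablaQuot p) where
  mem_tangent X hX ξ hξ V hV := by
    obtain ⟨z, hz, rfl⟩ := exists_proj_eq hX
    rw [nablaQuot_proj hz hξ hV]
    exact dproj_mem_tangent hz (nablaBar_mem hz _ _)
  smooth V W hV hW :=
    contDiffOn_Mp_of_comp_proj ((contDiffOn_dproj contDiffOn_id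
      (isLeviCivita_nablaBar.smooth _ _ (isField_liftField hV) (isField_liftField hW))).congr
        fun z hz => nablaQuot_proj hz (hV.tangent_proj hz) hW)
  congr X hX ξ hξ V W hV hW h := by
    obtain ⟨z, hz, rfl⟩ := exists_proj_eq hX
    rw [nablaQuot_proj hz hξ hV, nablaQuot_proj hz hξ hW, nablaBar_congr (fun w hw => ?_) hz]
    rw [liftField, h (proj_mem hw), liftField]
  add_left X hX ξ hξ ζ hζ V hV := by
    obtain ⟨z, hz, rfl⟩ := exists_proj_eq hX
    rw [nablaQuot_proj hz hξ hV, nablaQuot_proj hz hζ hV,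
      nablaQuot_proj hz (tangent_Mp_add hz hξ hζ) hV, lift_add hz hξ hζ,
      isLeviCivita_nablaBar.add_left z hz _ (lift_mem_tangent hz hξ) _ (lift_mem_tangent hz hζ) _
        (isField_liftField hV), dproj_add]
  smul_left X hX a ξ hξ V hV := by
    obtain ⟨z, hz, rfl⟩ := exists_proj_eq hX
    rw [nablaQuot_proj hz hξ hV, nablaQuot_proj hz (tangent_Mp_smul hz a hξ) hV,
      lift_smul hz a hξ, isLeviCivita_nablaBar.smul_left z hz a _ (lift_mem_tangent hz hξ) _
        (isField_liftField hV), dproj_smul]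
  add_right X hX ξ hξ V W hV hW := by
    obtain ⟨z, hz, rfl⟩ := exists_proj_eq hX
    have hVW : IsField (Mp m n p) fun y => V y + W y := ⟨hV.1.add hW.1, fun Y hY => by
      obtain ⟨w, hw, rfl⟩ := exists_proj_eq hY
      exact tangent_Mp_add hw (hV.tangent_proj hw) (hW.tangent_proj hw)⟩
    rw [nablaQuot_proj hz hξ hV, nablaQuot_proj hz hξ hW, nablaQuot_proj hz hξ hVW,
      nablaBar_congr (V := liftField p fun y => V y + W y)
        (W := fun w => liftField p V w + liftField p W w)
        (fun w hw => lift_add hw (hV.tangent_proj hw) (hW.tangent_proj hw)) hz,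
      isLeviCivita_nablaBar.add_right z hz _ (lift_mem_tangent hz hξ) _ _ (isField_liftField hV)
        (isField_liftField hW), dproj_add]
  leibniz X hX ξ hξ φ V hφ hV := by
    obtain ⟨z, hz, rfl⟩ := exists_proj_eq hX
    have hVW : IsField (Mp m n p) fun y => φ y • V y := ⟨hφ.smul hV.1, fun Y hY => by
      obtain ⟨w, hw, rfl⟩ := exists_proj_eq hY
      exact tangent_Mp_smul hw _ (hV.tangent_proj hw)⟩
    rw [nablaQuot_proj hz hξ hV, nablaQuot_proj hz hξ hVW,
      nablaBar_congr (V := liftField p fun y => φ y • V y)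
        (W := fun w => φ (proj w) • liftField p V w)
        (fun w hw => lift_smul hw _ (hV.tangent_proj hw)) hz,
      isLeviCivita_nablaBar.leibniz z hz _ (lift_mem_tangent hz hξ) (fun w => φ (proj w)) _
        (contDiffOn_comp_proj hφ) (isField_liftField hV), dproj_add, dproj_smul, dproj_smul]
    have e1 := fderivWithin_comp_proj hφ hz (horizontalSpace_le z (lift_mem hz hξ))
    rw [dproj_lift hz hξ] at e1
    have e2 : dproj z (liftField p V z) = V (proj z) := dproj_lift hz (hV.tangent_proj hz)
    rw [e2]
    exact congrArg (fun a : ℝ => a • V (proj z) + _) e1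
  torsion_free X hX V W hV hW := by
    obtain ⟨z, hz, rfl⟩ := exists_proj_eq hX
    have e := isLeviCivita_nablaBar.torsion_free z hz _ _ (isField_liftField hV)
      (isField_liftField hW)
    have hv := horizontalSpace_le z (liftField_mem hV hz)
    have hw := horizontalSpace_le z (liftField_mem hW hz)
    rw [nablaQuot_proj hz (hV.tangent_proj hz) hW, nablaQuot_proj hz (hW.tangent_proj hz) hV,
      ← dproj_sub]
    change dproj z (nablaBar z (liftField p V z) (liftField p W) -
      nablaBar z (liftField p W z) (liftField p V)) = _
    rw [e, VectorField.lieBracketWithin, VectorField.lieBracketWithin, dproj_sub]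
    have a1 := dproj_fderivWithin_liftField hW hz hv
    have a2 := dproj_fderivWithin_liftField hV hz hw
    have ev : dproj z (liftField p V z) = V (proj z) := dproj_lift hz (hV.tangent_proj hz)
    have ew : dproj z (liftField p W z) = W (proj z) := dproj_lift hz (hW.tangent_proj hz)
    rw [ev] at a1
    rw [ew] at a2
    have key : ∀ A B C D : Matrix (Fin m) (Fin n) ℝ, A - (C + D) - (B - (D + C)) = A - B := by
      intros
      abel
    exact (congrArg₂ (· - ·) a1 a2).trans (key _ _ _ _)
  metric X hX ξ hξ V W hV hW := by
    obtain ⟨z, hz, rfl⟩ := exists_proj_eq hX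
    have e1 := fderivWithin_comp_proj (contDiffOn_quotMetric hV hW) hz
      (horizontalSpace_le z (lift_mem hz hξ))
    rw [dproj_lift hz hξ] at e1
    have hc : Set.EqOn (fun w : Pair m n p => quotMetric p (proj w) (V (proj w)) (W (proj w)))
        (fun w => gBar w (liftField p V w) (liftField p W w)) (SRp m n p) := fun w hw =>
      quotMetric_proj hw (hV.tangent_proj hw) (hW.tangent_proj hw)
    have hg := isRiemannianMetric_quotMetric (m := m) (n := n) (p := p)
    have ht := dproj_mem_tangent hz (nablaBar_mem hz (lift z ξ) (liftField p W))
    refine e1.symm.trans ?_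
    refine (fderivWithin_congr_apply hc hz _).trans ?_
    refine (isLeviCivita_nablaBar.metric z hz _ (lift_mem_tangent hz hξ) _ _
      (isField_liftField hV) (isField_liftField hW)).trans ?_
    rw [nablaQuot_proj hz hξ hV, nablaQuot_proj hz hξ hW,
      quotMetric_dproj_left hz (nablaBar_mem hz _ _) (hW.tangent_proj hz),
      hg.symm _ hX _ (hV.tangent_proj hz) _ ht,
      quotMetric_dproj_left hz (nablaBar_mem hz _ _) (hV.tangent_proj hz),
      gBar_comm z (liftField p V z)]
    rfl

/-- The later results concern an arbitrary Levi-Civita connection; uniqueness lets all of them be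
computed through horizontal lifts. -/
theorem nabla_proj {nabla : Matrix (Fin m) (Fin n) ℝ → Matrix (Fin m) (Fin n) ℝ →
      (Matrix (Fin m) (Fin n) ℝ → Matrix (Fin m) (Fin n) ℝ) → Matrix (Fin m) (Fin n) ℝ}
    (h : IsLeviCivita (Mp m n p) (quotMetric p) nabla) (hz : z ∈ SRp m n p)
    (hξ : ξ ∈ tangent (Mp m n p) (proj z)) (hV : IsField (Mp m n p) V) :
    nabla (proj z) ξ V = dproj z (nablaBar z (lift z ξ) (liftField p V)) := by
  rw [← nablaQuot_proj hz hξ hV]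
  refine IsLeviCivita.unique isRiemannianMetric_quotMetric ?_ ?_ h isLeviCivita_nablaQuot
    (proj_mem hz) hξ hV
  · intro X hX ξ hξ ζ hζ
    obtain ⟨w, hw, rfl⟩ := exists_proj_eq hX
    have := tangent_Mp_add hw hξ (tangent_Mp_smul hw (-1) hζ)
    simpa [sub_eq_add_neg] using this
  · intro X hX ξ hξ
    obtain ⟨w, hw, rfl⟩ := exists_proj_eq hX
    exact ⟨frameField p ξ, isField_frameField ξ, frameField_self hw hξ⟩

end Quotient

/-! ### Geodesics and exponential of the manifold of rank `p` matrices. -/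

section QuotientGeodesics

variable {m n p : ℕ} {z η : Pair m n p} {ξ : Matrix (Fin m) (Fin n) ℝ}
  {nabla : Matrix (Fin m) (Fin n) ℝ → Matrix (Fin m) (Fin n) ℝ →
    (Matrix (Fin m) (Fin n) ℝ → Matrix (Fin m) (Fin n) ℝ) → Matrix (Fin m) (Fin n) ℝ}

/-- Along the geodesic `Ṁᵀ M` is constant, and `Ṅᵀ N` changes by `t Ṅᵀ Ṅ`, which is symmetric. -/
theorem geodVel_mem_horizontal (hz : z ∈ SRp m n p) (hη : η ∈ horizontalSpace z) (t : ℝ) :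
    geodVel z η t ∈ horizontalSpace (geod z η t) := by
  have h1 := geodVel_mul_geod hz.1 (horizontalSpace_le z hη) t
  have h2 := congrArg Matrix.transpose h1
  have h3 : z.1ᵀ * η.1 + η.1ᵀ * z.1 = 0 := horizontalSpace_le z hη
  have h4 : (η.1ᵀ * z.1 + η.2ᵀ * z.2)ᵀ = η.1ᵀ * z.1 + η.2ᵀ * z.2 := hη.2
  simp only [Matrix.transpose_mul, Matrix.transpose_transpose] at h2
  refine ⟨?_, ?_⟩
  · rw [h1, h2, h3]
  · rw [h1]
    change (η.1ᵀ * z.1 + η.2ᵀ * (z.2 + t • η.2))ᵀ = η.1ᵀ * z.1 + η.2ᵀ * (z.2 + t • η.2)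
    rw [Matrix.mul_add, ← add_assoc, Matrix.transpose_add, h4]
    simp

theorem lift_dproj_horizontal (hz : z ∈ SRp m n p) (hη : η ∈ horizontalSpace z) :
    lift z (dproj z η) = η := lift_eq hz hη rfl

/-- The covariant derivative along the projection of a horizontal curve. -/
theorem isCovDerivAlong_proj (hL : IsLeviCivita (Mp m n p) (quotMetric p) nabla)
    {c v : ℝ → Pair m n p} {J : Set ℝ} (hJ : IsOpen J) (hc : ContDiffOn ℝ ∞ c J)
    (hS : ∀ t ∈ J, c t ∈ SRp m n p) (hv : ∀ t ∈ J, HasDerivAt c (v t) t)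
    (hh : ∀ t ∈ J, v t ∈ horizontalSpace (c t)) :
    IsCovDerivAlong (Mp m n p) nabla (fun t => proj (c t)) J fun Z t =>
      dproj (c t) (tproj (c t) (deriv (fun s => lift (c s) (Z s)) t)) := by
  have hlift : ∀ Z, IsFieldAlong (Mp m n p) (fun t => proj (c t)) J Z →
      ContDiffOn ℝ ∞ (fun s => lift (c s) (Z s)) J := fun Z hZ =>
    contDiffOn_lift hc hZ.1 hS hZ.2
  have hd : ∀ Z, IsFieldAlong (Mp m n p) (fun t => proj (c t)) J Z → ∀ t ∈ J,
      ∃ w, HasDerivAt (fun s => lift (c s) (Z s)) w t := fun Z hZ t ht =>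
    ⟨_, (((hlift Z hZ).contDiffAt (hJ.mem_nhds ht)).differentiableAt (by simp)).hasDerivAt⟩
  have hD : ∀ {Z : ℝ → Pair m n p} {w : Pair m n p} {t : ℝ}, HasDerivAt Z w t →
      dproj (c t) (tproj (c t) (deriv Z t)) = dproj (c t) (tproj (c t) w) := fun {Z w t} h =>
    congrArg (fun u => dproj (c t) (tproj (c t) u)) h.deriv
  refine ⟨fun Z hZ => ⟨?_, fun t ht => ?_⟩, fun Y Z hY hZ t ht => ?_, fun φ Z hφ hZ t ht => ?_,
    fun V hV t ht => ?_⟩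
  · exact contDiffOn_dproj hc
      (contDiffOn_tproj hc ((hlift Z hZ).deriv_of_isOpen hJ (by simp)))
  · exact dproj_mem_tangent (hS t ht) (tproj_mem (hS t ht) _)
  · obtain ⟨w₁, h₁⟩ := hd Y hY t ht
    obtain ⟨w₂, h₂⟩ := hd Z hZ t ht
    have h₃ := (h₁.add h₂).congr_of_eventuallyEq (Filter.mem_of_superset (hJ.mem_nhds ht)
      fun s hs => lift_add (hS s hs) (hY.2 s hs) (hZ.2 s hs))
    refine (hD h₃).trans ?_
    refine Eq.trans ?_ (congrArg₂ (· + ·) (hD h₁) (hD h₂)).symm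
    rw [← dproj_add, ← tproj_add]
  · obtain ⟨w, h⟩ := hd Z hZ t ht
    have hφ' := ((hφ.contDiffAt (hJ.mem_nhds ht)).differentiableAt (by simp)).hasDerivAt
    have h₃ := (hφ'.smul h).congr_of_eventuallyEq (Filter.mem_of_superset (hJ.mem_nhds ht)
      fun s hs => lift_smul (hS s hs) (φ s) (hZ.2 s hs))
    refine (hD h₃).trans ?_
    refine Eq.trans ?_ (congrArg (fun u => deriv φ t • Z t + φ t • u) (hD h)).symm
    have hm := lift_mem (hS t ht) (hZ.2 t ht)
    have e := dproj_lift (hS t ht) (hZ.2 t ht)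
    have key : dproj (c t) (tproj (c t) (φ t • w + deriv φ t • lift (c t) (Z t))) =
        deriv φ t • Z t + φ t • dproj (c t) (tproj (c t) w) := by
      rw [tproj_add, tproj_smul, tproj_smul, dproj_add, dproj_smul, dproj_smul,
        tproj_of_mem (horizontalSpace_le _ hm), e, add_comm]
    exact key
  -- Compatibility with fields of `M_p` is where horizontality of `c` enters: the lift of the
  -- velocity of `π ∘ c` is then the velocity of `c`.
  · have h₁ := hasDerivAt_comp_curve
      (contDiffOn_differentiableWithinAt (isField_liftField hV).1 (hS t ht)) (hv t ht)
      (Filter.mem_of_superset (hJ.mem_nhds ht) hS)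
    refine (hD h₁).trans ?_
    refine Eq.trans ?_ (congrArg (fun u => nabla (proj (c t)) u V)
      (hasDerivAt_proj (hv t ht)).deriv).symm
    have key := nabla_proj hL (hS t ht)
      (dproj_mem_tangent (hS t ht) (horizontalSpace_le _ (hh t ht))) hV
    rw [lift_dproj_horizontal (hS t ht) (hh t ht)] at key
    exact key.symm

theorem hasExp_proj_of_staysFullRank (hL : IsLeviCivita (Mp m n p) (quotMetric p) nabla)
    (hz : z ∈ SRp m n p) (hη : η ∈ horizontalSpace z) (hr : StaysFullRank z η) :
    HasExp (Mp m n p) nabla (proj z) (dproj z η) (proj (expTotal z η)) := by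
  have hη' := horizontalSpace_le z hη
  obtain ⟨J, hJ, hJc, hJ1, hS⟩ := geod_mem_interval hz hη' hr
  have hh := geodVel_mem_horizontal hz hη
  have hc := (contDiff_geod z η).contDiffOn (s := J)
  have hv := hasDerivAt_geod z η
  have hacc : ∀ t ∈ J, dproj (geod z η t) (tproj (geod z η t)
      (deriv (fun s => lift (geod z η s) (dproj (geod z η s) (geodVel z η s))) t)) = 0 := by
    intro t ht
    -- The lift of the projected velocity is the velocity upstairs, so the acceleration to project
    -- is the known normal one.
    have h1 := (hasDerivAt_geodVel hz.1 hη' t).congr_of_eventuallyEq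
      (Filter.mem_of_superset (hJ.mem_nhds ht)
        fun s hs => lift_dproj_horizontal (hS s hs) (hh s))
    refine (congrArg (fun u => dproj (geod z η t) (tproj (geod z η t) u)) h1.deriv).trans ?_
    refine (congrArg (dproj (geod z η t)) (tproj_geod_acceleration hz hη' t)).trans ?_
    rw [← sub_self (0 : Pair m n p), dproj_sub, sub_self]
  have h := HasExp.of_geodesic hJ hJc hJ1 (contDiff_proj.comp_contDiffOn hc)
    (fun t ht => proj_mem (hS t ht)) (fun t => hasDerivAt_proj (hv t))
    (isCovDerivAlong_proj hL hJ hc hS (fun t _ => hv t) fun t _ => hh t) hacc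
  simp only [Function.comp_apply] at h
  rwa [geod_zero, geodVel_zero, geod_one] at h

/-- Every curve in `M_p` has a lift through a given point of the fiber whose velocity at that point
is horizontal. -/
theorem exists_horizontal_curve {γ v : ℝ → Matrix (Fin m) (Fin n) ℝ} {t : ℝ}
    (hγ : ∀ᶠ s in 𝓝 t, ContDiffAt ℝ ∞ γ s ∧ γ s ∈ Mp m n p) (hv : HasDerivAt γ (v t) t) :
    ∃ c : ℝ → Pair m n p, HasDerivAt c (lift (c t) (v t)) t ∧
      ∀ᶠ s in 𝓝 t, ContDiffAt ℝ ∞ c s ∧ c s ∈ SRp m n p ∧ proj (c s) = γ s := by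
  obtain ⟨z, hz, hzt⟩ := exists_proj_eq hγ.self_of_nhds.2
  obtain ⟨σ, h0, hσ⟩ := exists_section hz
  rw [hzt] at h0 hσ
  have hev : ∀ᶠ s in 𝓝 t, ContDiffAt ℝ ∞ (fun s => σ (γ s)) s ∧ σ (γ s) ∈ SRp m n p ∧
      proj (σ (γ s)) = γ s := by
    filter_upwards [hγ, hv.continuousAt.eventually hσ] with s h1 h2
    exact ⟨h2.1.comp s h1.1, h2.2 h1.2⟩
  obtain ⟨w, hw⟩ : ∃ w, HasDerivAt (fun s => σ (γ s)) w t :=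
    ⟨_, (hev.self_of_nhds.1.differentiableAt (by simp)).hasDerivAt⟩
  have hwt : w ∈ tangentSpace z := by
    have := stiefel_deriv hw (hev.mono fun _ h => h.2.1)
    rw [h0] at this
    exact this
  have hwv : dproj z w = v t := by
    have h1 := (hasDerivAt_proj hw).unique (hv.congr_of_eventuallyEq (hev.mono fun _ h => h.2.2))
    rw [h0] at h1
    exact h1
  -- The lift provided by the section has velocity with vertical part `z Ω` at time `t`. Rotating it
  -- by `exp(-(s - t) Ω)` removes this part at that time without changing the projection.
  obtain ⟨Ω, hΩ, e⟩ := (mem_vertical hz).1 (sub_hproj_mem hz hwt)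
  have hQ : ∀ s : ℝ, (NormedSpace.exp ((s - t) • (-Ω)))ᵀ * NormedSpace.exp ((s - t) • (-Ω)) = 1 :=
    fun s => exp_transpose_mul_exp (by rw [Matrix.transpose_smul, Matrix.transpose_neg, hΩ, smul_neg])
  have hlift : lift z (v t) = hproj z w := by rw [← hwv, lift_dproj hz hwt]
  have hct : act (σ (γ t)) (NormedSpace.exp ((t - t) • (-Ω))) = z := by
    rw [h0]
    simp [act]
  have hexp : ContDiff ℝ ∞ (fun s : ℝ => NormedSpace.exp ((s - t) • (-Ω))) :=
    (contDiff_exp_smul (-Ω)).comp (contDiff_id.sub contDiff_const)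
  refine ⟨fun s => act (σ (γ s)) (NormedSpace.exp ((s - t) • (-Ω))), ?_, ?_⟩
  · simp only [hct]
    have hE : HasDerivAt (fun s : ℝ => NormedSpace.exp ((s - t) • (-Ω))) (-Ω) t := by
      have h1 := (hasDerivAt_exp_smul_matrix (-Ω) (t - t)).comp_sub_const t t
      refine h1.congr_deriv ?_
      simp
    have h1 := (hasDerivAt_matrix_mul (hasDerivAt_fst hw) hE).prodMk
      (hasDerivAt_matrix_mul (hasDerivAt_snd hw) hE)
    refine h1.congr_deriv ?_
    rw [h0, hlift, sub_self, zero_smul, NormedSpace.exp_zero, Matrix.mul_one, Matrix.mul_one]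
    rw [sub_eq_iff_eq_add] at e
    nth_rewrite 1 [e]
    nth_rewrite 2 [e]
    simp [act]
  · filter_upwards [hev] with s h
    refine ⟨?_, act_mem h.2.1 (hQ s), (proj_act _ (hQ s)).trans h.2.2⟩
    have h1 : ContDiffAt ℝ ∞ (fun s => (σ (γ s)).1) s := contDiffAt_fst.comp s h.1
    have h2 : ContDiffAt ℝ ∞ (fun s => (σ (γ s)).2) s := contDiffAt_snd.comp s h.1
    have h3 := hexp.contDiffAt (x := s)
    unfold act
    exact (contDiffWithinAt_mul h1.contDiffWithinAt h3.contDiffWithinAt).contDiffAt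
      Filter.univ_mem |>.prodMk <|
      (contDiffWithinAt_mul h2.contDiffWithinAt h3.contDiffWithinAt).contDiffAt
        Filter.univ_mem

/-- Here `c` lifts `γ` only near `t` and is horizontal only at `t`, so the explicit covariant
derivative along a horizontal curve is not available. The value of an arbitrary `D` is found by
expanding `Z` in the frame fields. -/
theorem covDeriv_proj (hL : IsLeviCivita (Mp m n p) (quotMetric p) nabla)
    {γ : ℝ → Matrix (Fin m) (Fin n) ℝ} {J : Set ℝ} (hJ : IsOpen J) (hγ : ContDiffOn ℝ ∞ γ J)
    (hS : ∀ t ∈ J, γ t ∈ Mp m n p)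
    {D : (ℝ → Matrix (Fin m) (Fin n) ℝ) → ℝ → Matrix (Fin m) (Fin n) ℝ}
    (hD : IsCovDerivAlong (Mp m n p) nabla γ J D) {Z : ℝ → Matrix (Fin m) (Fin n) ℝ}
    (hZ : IsFieldAlong (Mp m n p) γ J Z) {t : ℝ} (ht : t ∈ J) {c : ℝ → Pair m n p}
    {u w : Pair m n p} (hc : HasDerivAt c u t) (hu : u ∈ horizontalSpace (c t))
    (hcS : ∀ᶠ s in 𝓝 t, c s ∈ SRp m n p ∧ proj (c s) = γ s)
    (hw : HasDerivAt (fun s => lift (c s) (Z s)) w t) :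
    D Z t = dproj (c t) (tproj (c t) w) := by
  let b := Module.finBasis ℝ (Matrix (Fin m) (Fin n) ℝ)
  have hlin : ∀ X ∈ Mp m n p, IsLinearMap ℝ fun w => frameField p w X := by
    intro X hX
    obtain ⟨z, hz, rfl⟩ := exists_proj_eq hX
    simp only [frameField_proj hz]
    constructor
    · intro x y
      rw [← dproj_add]
      congr 1
      ext1 <;> simp [tangentLift, Matrix.mul_add, Matrix.add_mul]
    · intro a x
      rw [← dproj_smul]
      congr 1
      ext1 <;> simp [tangentLift]
  have hid : ∀ X ∈ Mp m n p, ∀ ξ ∈ tangent (Mp m n p) X, frameField p ξ X = ξ := by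
    intro X hX ξ hξ
    obtain ⟨z, hz, rfl⟩ := exists_proj_eq hX
    exact frameField_self hz hξ
  have hz := hcS.self_of_nhds.1
  have hzγ := hcS.self_of_nhds.2
  -- The lift is linear on tangent vectors, so the lift of `Z` has the same coefficients in the
  -- lifted frame.
  have hsum : ∀ᶠ s in 𝓝 t, lift (c s) (Z s) =
      ∑ i, b.coord i (Z s) • liftField p (frameField p (b i)) (c s) := by
    filter_upwards [hcS, hJ.mem_nhds ht] with s hs hsJ
    have hZs := hZ.2 s hsJ
    rw [← hs.2] at hZs
    refine lift_eq hs.1 (Submodule.sum_mem _ fun i _ => Submodule.smul_mem _ _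
      (liftField_mem (isField_frameField _) hs.1)) ?_
    let T : Pair m n p →ₗ[ℝ] Matrix (Fin m) (Fin n) ℝ :=
      IsLinearMap.mk' (dproj (c s)) ⟨dproj_add _, dproj_smul _⟩
    have h1 : T (∑ i, b.coord i (Z s) • liftField p (frameField p (b i)) (c s)) =
        ∑ i, b.coord i (Z s) • frameField p (b i) (proj (c s)) := by
      rw [map_sum]
      refine Finset.sum_congr rfl fun i _ => ?_
      rw [map_smul]
      exact congrArg _ (dproj_lift hs.1 ((isField_frameField (b i)).tangent_proj hs.1))
    refine h1.trans ?_
    have h2 := congrArg (fun w => (hlin _ (proj_mem hs.1)).mk' _ w) (b.sum_repr (Z s))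
    simp only [map_sum, map_smul, IsLinearMap.mk'_apply] at h2
    exact h2.trans (hid _ (proj_mem hs.1) _ hZs)
  have hcoord : ∀ i, HasDerivAt (fun s => b.coord i (Z s)) (deriv (fun s => b.coord i (Z s)) t) t :=
    fun i => ((((LinearMap.toContinuousLinearMap (b.coord i)).contDiff.comp_contDiffOn
      hZ.1).contDiffAt (hJ.mem_nhds ht)).differentiableAt (by simp)).hasDerivAt
  have hfield : ∀ i, HasDerivAt (fun s => liftField p (frameField p (b i)) (c s)) _ t := fun i =>
    hasDerivAt_comp_curve (contDiffOn_differentiableWithinAt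
      (isField_liftField (isField_frameField (b i))).1 hz) hc (hcS.mono fun _ h => h.1)
  have hw' := hw.unique ((HasDerivAt.fun_sum fun i _ =>
    (hcoord i).smul (hfield i)).congr_of_eventuallyEq hsum)
  let T : Pair m n p →ₗ[ℝ] Matrix (Fin m) (Fin n) ℝ :=
    IsLinearMap.mk' (fun w => dproj (c t) (tproj (c t) w))
      ⟨fun x y => by rw [tproj_add, dproj_add], fun a x => by rw [tproj_smul, dproj_smul]⟩
  have hγ' : deriv γ t = dproj (c t) u := ((hasDerivAt_proj hc).congr_of_eventuallyEq
    (hcS.mono fun _ h => h.2.symm)).deriv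
  rw [covDeriv_eq_sum isField_frameField hlin hid hγ hS hD hZ b ht]
  refine Eq.trans ?_ (congrArg T hw').symm
  rw [map_sum]
  refine Finset.sum_congr rfl fun i _ => ?_
  have hi := isField_frameField (m := m) (n := n) (p := p) (b i)
  have h1 : nabla (γ t) (dproj (c t) u) (frameField p (b i)) =
      T (fderivWithin ℝ (liftField p (frameField p (b i))) (SRp m n p) (c t) u) := by
    rw [← hzγ, nabla_proj hL hz (dproj_mem_tangent hz (horizontalSpace_le _ hu)) hi,
      lift_dproj_horizontal hz hu]
    rfl
  have h2 : frameField p (b i) (γ t) = T (liftField p (frameField p (b i)) (c t)) := by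
    rw [← hzγ]
    change _ = dproj (c t) (tproj (c t) (liftField p (frameField p (b i)) (c t)))
    rw [tproj_of_mem (horizontalSpace_le _ (liftField_mem hi hz))]
    exact (dproj_lift hz (hi.tangent_proj hz)).symm
  rw [map_add, map_smul, map_smul, add_comm]
  exact congrArg₂ (· + ·) (congrArg _ ((congrArg (nabla (γ t) · (frameField p (b i))) hγ').trans h1))
    (congrArg _ h2)

/-- The horizontal lift of the velocity of a geodesic of `M_p` satisfies the geodesic equation of the
total space. -/
theorem deriv_lift_velocity {γ v : ℝ → Matrix (Fin m) (Fin n) ℝ} {t : ℝ} {c : ℝ → Pair m n p}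
    {w : Pair m n p} (hv : ∀ᶠ s in 𝓝 t, v s ∈ tangent (Mp m n p) (γ s))
    (hc : HasDerivAt c (lift (c t) (v t)) t)
    (hcS : ∀ᶠ s in 𝓝 t, c s ∈ SRp m n p ∧ proj (c s) = γ s)
    (hw : HasDerivAt (fun s => lift (c s) (v s)) w t)
    (h0 : dproj (c t) (tproj (c t) w) = 0) :
    w = (-((c t).1 * ((lift (c t) (v t)).1ᵀ * (lift (c t) (v t)).1)), 0) := by
  have hz := hcS.self_of_nhds.1
  have hmem : ∀ᶠ s in 𝓝 t, lift (c s) (v s) ∈ horizontalSpace (c s) := by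
    filter_upwards [hv, hcS] with s h1 h2
    exact lift_mem h2.1 (h2.2.symm ▸ h1)
  have ht := tangent_deriv hc hw (hmem.mono fun _ h => horizontalSpace_le _ h)
  have hh := horizontal_deriv hc hw hmem
  -- Vanishing covariant derivative downstairs only says that the tangential acceleration is
  -- vertical.
  obtain ⟨Ω, hΩ, e⟩ := (mem_vertical hz).1 (vertical_of_dproj hz (tproj_mem hz w) h0)
  have hz1 : (c t).1ᵀ * (c t).1 = 1 := hz.1
  generalize lift (c t) (v t) = η at *
  generalize c t = z at *
  have hS : (η.1ᵀ * η.1)ᵀ = η.1ᵀ * η.1 := by simp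
  have hw1 : w.1 = z.1 * Ω - z.1 * (η.1ᵀ * η.1) := by
    have h1 := congrArg Prod.fst e
    rw [tproj_eq, eq_neg_of_add_eq_zero_left ht, ← two_smul ℝ (η.1ᵀ * η.1), smul_neg, smul_smul] at h1
    norm_num at h1
    rw [eq_sub_iff_add_eq]
    exact h1
  have hw2 : w.2 = z.2 * Ω := congrArg Prod.snd e
  have e1 : w.1ᵀ * z.1 = -Ω - η.1ᵀ * η.1 := by
    rw [hw1, Matrix.transpose_sub, Matrix.transpose_mul, Matrix.transpose_mul z.1, Matrix.sub_mul,
      Matrix.mul_assoc, Matrix.mul_assoc, hz1, hΩ, hS, Matrix.mul_one, Matrix.mul_one]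
  have e2 : w.2ᵀ * z.2 = -(Ω * (z.2ᵀ * z.2)) := by
    rw [hw2, Matrix.transpose_mul, hΩ, Matrix.mul_assoc, Matrix.neg_mul]
  -- Differentiating horizontality leaves symmetric quadratic terms in the velocity, which drop out,
  -- and what remains is the homogeneous Sylvester equation for `Ω`.
  have hΩ0 : Ω = 0 := by
    refine sylvester_injective z.2 ?_
    rw [e1, e2] at hh
    simp only [Matrix.transpose_add, Matrix.transpose_sub, Matrix.transpose_neg, hΩ, hS,
      Matrix.transpose_mul, Matrix.transpose_transpose, Matrix.mul_neg] at hh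
    rw [← sub_eq_zero] at hh
    rw [← hh, Matrix.add_mul, Matrix.mul_add, Matrix.one_mul, Matrix.mul_one]
    abel
  rw [hΩ0] at hw1 hw2
  refine Prod.ext ?_ ?_
  · simpa using hw1
  · simpa using hw2

/-- The quantities `M Nᵀ, Ṁ Nᵀ, M Ṅᵀ, Ṁ Ṅᵀ, M Ṁᵀ, Ṁ Ṁᵀ`, which are invariant under the action of the
orthogonal group. -/
def orthInvariants (z η : Pair m n p) : Matrix (Fin m) (Fin n) ℝ × Matrix (Fin m) (Fin n) ℝ ×
    Matrix (Fin m) (Fin n) ℝ × Matrix (Fin m) (Fin n) ℝ × Matrix (Fin m) (Fin m) ℝ ×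
    Matrix (Fin m) (Fin m) ℝ :=
  (z.1 * z.2ᵀ, η.1 * z.2ᵀ, z.1 * η.2ᵀ, η.1 * η.2ᵀ, z.1 * η.1ᵀ, η.1 * η.1ᵀ)

/-- The geodesic vector field in terms of `orthInvariants`. -/
def invariantSpray (q : Matrix (Fin m) (Fin n) ℝ × Matrix (Fin m) (Fin n) ℝ ×
    Matrix (Fin m) (Fin n) ℝ × Matrix (Fin m) (Fin n) ℝ × Matrix (Fin m) (Fin m) ℝ ×
    Matrix (Fin m) (Fin m) ℝ) : Matrix (Fin m) (Fin n) ℝ × Matrix (Fin m) (Fin n) ℝ ×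
    Matrix (Fin m) (Fin n) ℝ × Matrix (Fin m) (Fin n) ℝ × Matrix (Fin m) (Fin m) ℝ ×
    Matrix (Fin m) (Fin m) ℝ :=
  let (_, e, f, h, b, d) := q
  (e + f, h - b * e, h, -(b * h), d - b * bᵀ, -(b * d) - d * bᵀ)

theorem contDiff_invariantSpray : ContDiff ℝ 1 (invariantSpray (m := m) (n := n)) := by
  unfold invariantSpray
  fun_prop

theorem orthInvariants_act (z η : Pair m n p) {Q : Matrix (Fin p) (Fin p) ℝ} (hQ : Qᵀ * Q = 1) :
    orthInvariants (act z Q) (act η Q) = orthInvariants z η := by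
  have hQ' : Q * Qᵀ = 1 := mul_eq_one_comm.1 hQ
  have key : ∀ {k l : ℕ} (A : Matrix (Fin k) (Fin p) ℝ) (B : Matrix (Fin l) (Fin p) ℝ),
      A * Q * (B * Q)ᵀ = A * Bᵀ := fun A B => by
    rw [Matrix.transpose_mul, Matrix.mul_assoc, ← Matrix.mul_assoc Q, hQ', Matrix.one_mul]
  simp only [orthInvariants, act, key]

/-- With `M'' = -M Ṁᵀ Ṁ` and `N'' = 0`, each derivative regroups into products of the listed
invariants; for instance `(Ṁ Nᵀ)' = Ṁ Ṅᵀ - (M Ṁᵀ)(Ṁ Nᵀ)`. -/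
theorem hasDerivAt_orthInvariants {c Z : ℝ → Pair m n p} {t : ℝ} (hc : HasDerivAt c (Z t) t)
    (hZ : HasDerivAt Z (-((c t).1 * ((Z t).1ᵀ * (Z t).1)), 0) t) :
    HasDerivAt (fun s => orthInvariants (c s) (Z s)) (invariantSpray (orthInvariants (c t) (Z t)))
      t := by
  have c1 := hasDerivAt_fst hc
  have c2 := hasDerivAt_snd hc
  have z1 := hasDerivAt_fst hZ
  have z2 := hasDerivAt_snd hZ
  refine ((hasDerivAt_matrix_mul c1 (hasDerivAt_transpose c2)).congr_deriv ?_).prodMk <|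
    ((hasDerivAt_matrix_mul z1 (hasDerivAt_transpose c2)).congr_deriv ?_).prodMk <|
    ((hasDerivAt_matrix_mul c1 (hasDerivAt_transpose z2)).congr_deriv ?_).prodMk <|
    ((hasDerivAt_matrix_mul z1 (hasDerivAt_transpose z2)).congr_deriv ?_).prodMk <|
    ((hasDerivAt_matrix_mul c1 (hasDerivAt_transpose z1)).congr_deriv ?_).prodMk <|
    (hasDerivAt_matrix_mul z1 (hasDerivAt_transpose z1)).congr_deriv ?_
  all_goals
    simp only [Matrix.transpose_neg, Matrix.transpose_mul,
      Matrix.transpose_transpose, Matrix.neg_mul, Matrix.mul_neg, Matrix.mul_assoc,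
      Matrix.transpose_zero, Matrix.mul_zero]
  all_goals abel

/-- The invariants do not see the choice of lift, so they are well defined along the whole geodesic
of `M_p`, and their equation can be verified at each time with a lift adapted to that time.
Uniqueness then matches them with the invariants of the closed-form geodesic. -/
theorem hasExp_Mp_iff (hL : IsLeviCivita (Mp m n p) (quotMetric p) nabla) (hz : z ∈ SRp m n p)
    (hξ : ξ ∈ tangent (Mp m n p) (proj z)) (Y : Matrix (Fin m) (Fin n) ℝ) :
    HasExp (Mp m n p) nabla (proj z) ξ Y ↔
      StaysFullRank z (lift z ξ) ∧ Y = proj (expTotal z (lift z ξ)) := by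
  have hη := lift_mem hz hξ
  constructor
  · intro h
    obtain ⟨γ, v, J, D, hJ, hJ1, hγ, hS, hv, hat, hmem, -, hD, hD0, h0, hd0, h1⟩ :=
      h.exists_geodesic
    have hfib : ∀ {w : Pair m n p} {X : Matrix (Fin m) (Fin n) ℝ}, w ∈ SRp m n p →
        X ∈ tangent (Mp m n p) (proj w) →
        orthInvariants (fiberPoint p (proj w)) (lift (fiberPoint p (proj w)) X) =
          orthInvariants w (lift w X) := fun {w X} hw hX => by
      obtain ⟨Q, hQ, e, -⟩ := fiberPoint_proj hw
      rw [e, lift_act hw hX hQ, orthInvariants_act _ _ hQ]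
    have hode : ∀ t ∈ Set.Icc (0 : ℝ) 1, HasDerivAt
        (fun t => orthInvariants (fiberPoint p (γ t)) (lift (fiberPoint p (γ t)) (v t)))
        (invariantSpray (orthInvariants (fiberPoint p (γ t)) (lift (fiberPoint p (γ t)) (v t))))
        t := fun t ht => by
      have htJ := hJ1 ht
      have hJt := hJ.mem_nhds htJ
      obtain ⟨c, hc, hcS⟩ := exists_horizontal_curve (p := p) (Filter.mem_of_superset hJt
        fun s hs => ⟨hγ.contDiffAt (hJ.mem_nhds hs), hS s hs⟩) (hat t htJ)
      have hcS' := hcS.mono fun _ h => h.2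
      have hmem' : ∀ᶠ s in 𝓝 t, v s ∈ tangent (Mp m n p) (γ s) :=
        Filter.mem_of_superset hJt hmem
      have hvt : v t ∈ tangent (Mp m n p) (proj (c t)) :=
        hcS'.self_of_nhds.2.symm ▸ hmem t htJ
      obtain ⟨w, hw⟩ : ∃ w, HasDerivAt (fun s => lift (c s) (v s)) w t := by
        obtain ⟨U, hU, hUo, htU⟩ := eventually_nhds_iff.1 (hcS.and
          (Filter.inter_mem hJt hmem' : ∀ᶠ s in 𝓝 t, s ∈ J ∧ v s ∈ tangent (Mp m n p) (γ s)))
        have := contDiffOn_lift (s := U) (Z := c) (Ξ := v)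
          (fun s hs => (hU s hs).1.1.contDiffWithinAt)
          (fun s hs => (hv.contDiffAt (hJ.mem_nhds (hU s hs).2.1)).contDiffWithinAt)
          (fun s hs => (hU s hs).1.2.1) fun s hs => (hU s hs).1.2.2.symm ▸ (hU s hs).2.2
        exact ⟨_, ((this.contDiffAt (hUo.mem_nhds htU)).differentiableAt (by simp)).hasDerivAt⟩
      have h3 := covDeriv_proj hL hJ hγ hS hD ⟨hv, hmem⟩ htJ hc
        (lift_mem hcS'.self_of_nhds.1 hvt) hcS' hw
      rw [hD0 t htJ] at h3
      have h4 := hasDerivAt_orthInvariants hc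
        (hw.congr_deriv (deriv_lift_velocity hmem' hc hcS' hw h3.symm))
      have hev : ∀ᶠ s in 𝓝 t,
          orthInvariants (fiberPoint p (γ s)) (lift (fiberPoint p (γ s)) (v s)) =
            orthInvariants (c s) (lift (c s) (v s)) := by
        filter_upwards [hcS', hmem'] with s h5 h6
        rw [← h5.2] at h6 ⊢
        exact hfib h5.1 h6
      exact (h4.congr_of_eventuallyEq hev).congr_deriv (congrArg _ hev.self_of_nhds.symm)
    have heq := eqOn_of_hasDerivAt contDiff_invariantSpray hode
      (g := fun t => orthInvariants (geod z (lift z ξ) t) (geodVel z (lift z ξ) t))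
      (fun t _ => hasDerivAt_orthInvariants (hasDerivAt_geod z _ t)
        (hasDerivAt_geodVel hz.1 (horizontalSpace_le _ hη) t))
      (by
        simp only [h0, hd0, geod_zero, geodVel_zero]
        exact hfib hz hξ)
    have heq' : ∀ t ∈ Set.Icc (0 : ℝ) 1, γ t = proj (geod z (lift z ξ) t) := fun t ht => by
      obtain ⟨w, hw, e⟩ := exists_proj_eq (hS t (hJ1 ht))
      obtain ⟨Q, hQ, e', -, e''⟩ := fiberPoint_proj hw
      rw [e] at e''
      -- The first invariant is the projected point itself.
      exact e''.symm.trans (congrArg Prod.fst (heq ht))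
    refine ⟨fun t ht => ?_, ?_⟩
    · have := hS t (hJ1 ht)
      rw [heq' t ht] at this
      exact rank_of_rank_mul_transpose this
    · rw [← h1, heq' 1 (Set.right_mem_Icc.2 zero_le_one), ← geod_one]
  · rintro ⟨hr, rfl⟩
    have h := hasExp_proj_of_staysFullRank hL hz hη hr
    rwa [dproj_lift hz hξ] at h

end QuotientGeodesics

/-! ### Gradients and the Newton equation. -/

section Newton

variable {m n p : ℕ} {z η : Pair m n p} {ξ : Matrix (Fin m) (Fin n) ℝ}
  {f : Matrix (Fin m) (Fin n) ℝ → ℝ}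
  {nabla : Matrix (Fin m) (Fin n) ℝ → Matrix (Fin m) (Fin n) ℝ →
    (Matrix (Fin m) (Fin n) ℝ → Matrix (Fin m) (Fin n) ℝ) → Matrix (Fin m) (Fin n) ℝ}

/-- Although `f` is only smooth on `M_p`, the projection maps the open set of pairs of full-rank
factors into `M_p`. So the composite is smooth on an open set and has a Euclidean gradient. -/
theorem contDiffAt_comp_proj (hf : ContDiffOn ℝ ∞ f (Mp m n p)) (hz : z ∈ SRp m n p) :
    ContDiffAt ℝ ∞ (fun w : Pair m n p => f (proj w)) z := by
  have hU : IsOpen {w : Pair m n p | w.1.rank = p ∧ w.2.rank = p} :=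
    (isOpen_rank_eq.preimage continuous_fst).inter (isOpen_rank_eq.preimage continuous_snd)
  exact (hf.comp contDiff_proj.contDiffOn fun w hw => rank_mul_transpose hw.1 hw.2).contDiffAt
    (hU.mem_nhds ⟨rank_of_stiefel hz.1, hz.2⟩)

theorem gBar_of_linearMap (L : Pair m n p →ₗ[ℝ] ℝ) (z η : Pair m n p) :
    gBar z (Matrix.of fun i j => L (Matrix.single i j 1, 0),
      Matrix.of fun i j => L (0, Matrix.single i j 1)) η = L η := by
  have h1 : ∀ {k : ℕ} (l : Matrix (Fin k) (Fin p) ℝ →ₗ[ℝ] ℝ) (A : Matrix (Fin k) (Fin p) ℝ),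
      ((Matrix.of fun i j => l (Matrix.single i j 1))ᵀ * A).trace = l A := fun l A => by
    conv_rhs => rw [Matrix.matrix_eq_sum_single A]
    simp only [map_sum, Matrix.trace, Matrix.diag_apply, Matrix.mul_apply, Matrix.transpose_apply,
      Matrix.of_apply]
    rw [Finset.sum_comm]
    refine Finset.sum_congr rfl fun i _ => Finset.sum_congr rfl fun j _ => ?_
    have : Matrix.single i j (A i j) = A i j • Matrix.single i j (1 : ℝ) := by simp
    rw [this, map_smul, smul_eq_mul, mul_comm]
  have e1 := h1 (L ∘ₗ LinearMap.inl ℝ _ _) η.1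
  have e2 := h1 (L ∘ₗ LinearMap.inr ℝ _ _) η.2
  rw [gBar, Matrix.trace_add]
  refine (congrArg₂ (· + ·) e1 e2).trans ?_
  rw [LinearMap.comp_apply, LinearMap.comp_apply, ← map_add]
  simp

theorem tproj_euclGrad_spec (hf : ContDiffOn ℝ ∞ f (Mp m n p)) (hz : z ∈ SRp m n p)
    (hη : η ∈ tangentSpace z) :
    gBar z (tproj z (euclGrad (fun w => f (proj w)) z)) η =
      fderivWithin ℝ (fun w => f (proj w)) (SRp m n p) z η := by
  have hd := ((contDiffAt_comp_proj hf hz).differentiableAt (by simp)).hasFDerivAt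
  rw [gBar_tproj _ hη]
  refine (gBar_of_linearMap (fderiv ℝ (fun w : Pair m n p => f (proj w)) z).toLinearMap z η).trans ?_
  refine (fderivWithin_eq_of_curve (contDiffOn_comp_proj hf) hz ((mem_tangent_iff hz).2 hη)
    fun c hc hcd _ => ?_).symm
  exact hd.comp_hasDerivAt_of_eq (0 : ℝ) hcd hc.symm

theorem gradBar_eq (hf : ContDiffOn ℝ ∞ f (Mp m n p)) (hz : z ∈ SRp m n p) :
    gradBar f z = tproj z (euclGrad (fun w => f (proj w)) z) := by
  have h := Classical.epsilon_spec (p := fun v => v ∈ tangent (SRp m n p) z ∧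
      ∀ ξ ∈ tangent (SRp m n p) z,
        gBar z v ξ = fderivWithin ℝ (fun w => f (proj w)) (SRp m n p) z ξ)
    ⟨_, (mem_tangent_iff hz).2 (tproj_mem hz _),
      fun ξ hξ => tproj_euclGrad_spec hf hz ((mem_tangent_iff hz).1 hξ)⟩
  change gradBar f z ∈ _ ∧ (∀ ξ ∈ _, gBar z (gradBar f z) ξ = _) at h
  have hm := (mem_tangent_iff hz).1 h.1
  rw [← sub_eq_zero]
  have hs := sub_mem hm (tproj_mem hz (euclGrad (fun w => f (proj w)) z))
  refine eq_zero_of_gBar_self (z := z) ?_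
  rw [gBar_sub_left, h.2 _ ((mem_tangent_iff hz).2 hs), tproj_euclGrad_spec hf hz hs, sub_self]

theorem gBar_gradBar (hf : ContDiffOn ℝ ∞ f (Mp m n p)) (hz : z ∈ SRp m n p)
    (hη : η ∈ tangentSpace z) :
    gBar z (gradBar f z) η = fderivWithin ℝ f (Mp m n p) (proj z) (dproj z η) := by
  rw [gradBar_eq hf hz, tproj_euclGrad_spec hf hz hη]
  exact fderivWithin_comp_proj hf hz hη

/-- The derivative of `f ∘ π` vanishes on vertical vectors, which are killed by `Dπ`. -/
theorem gradBar_mem (hf : ContDiffOn ℝ ∞ f (Mp m n p)) (hz : z ∈ SRp m n p) :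
    gradBar f z ∈ horizontalSpace z := by
  refine (mem_horizontal_iff hz).1 ⟨(mem_tangent_iff hz).2 ?_, fun v hv => ?_⟩
  · rw [gradBar_eq hf hz]
    exact tproj_mem hz _
  · rw [gBar_gradBar hf hz (vertical_subset_tangentSpace hv), dproj_vertical hz hv]
    exact map_zero _

theorem contDiffOn_gradBar (hf : ContDiffOn ℝ ∞ f (Mp m n p)) :
    ContDiffOn ℝ ∞ (gradBar f) (SRp m n p) := by
  have h : ContDiffOn ℝ ∞ (euclGrad fun w : Pair m n p => f (proj w)) (SRp m n p) := by
    intro z hz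
    have h1 : ∀ v, ContDiffWithinAt ℝ ∞
        (fun w => fderiv ℝ (fun w : Pair m n p => f (proj w)) w v) (SRp m n p) z := fun v =>
      (((contDiffAt_comp_proj hf hz).fderiv_right (m := ∞) (by simp)).clm_apply
        contDiffAt_const).contDiffWithinAt
    exact (contDiffWithinAt_matrix_iff.2 fun i j => h1 _).prodMk
      (contDiffWithinAt_matrix_iff.2 fun i j => h1 _)
  exact (contDiffOn_tproj contDiffOn_id h).congr fun z hz => gradBar_eq hf hz

/-- The horizontal vector `gradBar f z` pairs with lifts as the gradient of `f` should; definiteness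
of the metric identifies the two. -/
theorem rgrad_proj (hf : ContDiffOn ℝ ∞ f (Mp m n p)) (hz : z ∈ SRp m n p) :
    rgrad (Mp m n p) (quotMetric p) f (proj z) = dproj z (gradBar f z) := by
  have hG := gradBar_mem hf hz
  have h := Classical.epsilon_spec (p := fun v => v ∈ tangent (Mp m n p) (proj z) ∧
      ∀ ξ ∈ tangent (Mp m n p) (proj z),
        quotMetric p (proj z) v ξ = fderivWithin ℝ f (Mp m n p) (proj z) ξ)
    ⟨dproj z (gradBar f z), dproj_mem_tangent hz (horizontalSpace_le _ hG), fun ξ hξ => by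
      rw [quotMetric_dproj_left hz (horizontalSpace_le _ hG) hξ,
        gBar_gradBar hf hz (horizontalSpace_le _ (lift_mem hz hξ)), dproj_lift hz hξ]⟩
  change rgrad (Mp m n p) (quotMetric p) f (proj z) ∈ _ ∧
    (∀ ξ ∈ _, quotMetric p (proj z) (rgrad (Mp m n p) (quotMetric p) f (proj z)) ξ = _) at h
  generalize rgrad (Mp m n p) (quotMetric p) f (proj z) = v at h
  have hs := sub_mem (lift_mem hz h.1) hG
  have hs' := dproj_mem_tangent hz (horizontalSpace_le _ hs)
  have h0 : lift z v - gradBar f z = 0 := by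
    refine eq_zero_of_gBar_self (z := z) ?_
    have h1 := h.2 _ hs'
    rw [quotMetric_proj hz h.1 hs', lift_dproj_horizontal hz hs] at h1
    rw [gBar_sub_left, h1, gBar_gradBar hf hz (horizontalSpace_le _ hs), sub_self]
  rw [← sub_eq_zero.1 h0, dproj_lift hz h.1]

theorem isField_rgrad (hf : ContDiffOn ℝ ∞ f (Mp m n p)) :
    IsField (Mp m n p) (rgrad (Mp m n p) (quotMetric p) f) := by
  refine ⟨contDiffOn_Mp_of_comp_proj ((contDiffOn_dproj contDiffOn_id (contDiffOn_gradBar hf)).congr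
    fun z hz => rgrad_proj hf hz), fun X hX => ?_⟩
  obtain ⟨z, hz, rfl⟩ := exists_proj_eq hX
  rw [rgrad_proj hf hz]
  exact dproj_mem_tangent hz (horizontalSpace_le _ (gradBar_mem hf hz))

theorem liftField_rgrad (hf : ContDiffOn ℝ ∞ f (Mp m n p)) :
    Set.EqOn (liftField p (rgrad (Mp m n p) (quotMetric p) f)) (gradBar f) (SRp m n p) :=
  fun z hz => by
    rw [liftField, rgrad_proj hf hz, lift_dproj_horizontal hz (gradBar_mem hf hz)]

/-- Both sides of the equation on `M_p` are images under `Dπ` of the corresponding tangent vectors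
upstairs. Passing to lifts replaces `nablaBar` of the gradient by its horizontal projection and
leaves the horizontal gradient unchanged. -/
theorem isNewtonVector_iff (hL : IsLeviCivita (Mp m n p) (quotMetric p) nabla)
    (hf : ContDiffOn ℝ ∞ f (Mp m n p)) (hz : z ∈ SRp m n p)
    (hξ : ξ ∈ tangent (Mp m n p) (proj z)) :
    IsNewtonVector (Mp m n p) (quotMetric p) nabla f (proj z) ξ ↔
      IsLiftedNewtonVector f z (lift z ξ) := by
  rw [IsNewtonVector, and_iff_right hξ, IsLiftedNewtonVector,
    and_iff_right ((mem_horizontal_iff hz).2 (lift_mem hz hξ)), nabla_proj hL hz hξ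
    (isField_rgrad hf), nablaBar_congr (liftField_rgrad hf) hz, rgrad_proj hf hz, ← dproj_neg]
  have hn := nablaBar_mem hz (lift z ξ) (gradBar f)
  constructor
  · intro h
    rw [← lift_dproj hz hn, h, lift_dproj_horizontal hz (neg_mem (gradBar_mem hf hz))]
  · intro h
    rw [← h, dproj_hproj hz hn]

theorem isNewtonStep_iff (hL : IsLeviCivita (Mp m n p) (quotMetric p) nabla)
    (hf : ContDiffOn ℝ ∞ f (Mp m n p)) (hz : z ∈ SRp m n p) (Y : Matrix (Fin m) (Fin n) ℝ) :
    IsNewtonStep (Mp m n p) (quotMetric p) nabla f (proj z) Y ↔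
      ∃ η : Pair m n p, IsLiftedNewtonVector f z η ∧ StaysFullRank z η ∧
        Y = proj (expTotal z η) := by
  constructor
  · rintro ⟨ξ, h, hY⟩
    exact ⟨lift z ξ, (isNewtonVector_iff hL hf hz h.1).1 h, (hasExp_Mp_iff hL hz h.1 Y).1 hY⟩
  · rintro ⟨η, h, hr⟩
    have hη := (mem_horizontal_iff hz).1 h.1
    have hξ := dproj_mem_tangent hz (horizontalSpace_le _ hη)
    rw [← lift_dproj_horizontal hz hη] at h hr
    exact ⟨dproj z η, (isNewtonVector_iff hL hf hz hξ).2 h, (hasExp_Mp_iff hL hz hξ Y).2 hr⟩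

end Newton

/-! ### The projection as a submersion, and the closed form of the horizontal projection. -/

section Submersion

variable {m n p : ℕ} {z η : Pair m n p}

theorem image_proj : proj '' SRp m n p = Mp m n p :=
  Set.Subset.antisymm (Set.image_subset_iff.2 fun _ hz => proj_mem hz) fun _ hX => exists_proj_eq hX

theorem bijOn_dproj (hz : z ∈ SRp m n p) :
    Set.BijOn (dproj z) (horizontal z) (tangent (Mp m n p) (proj z)) := by
  refine ⟨fun η hη => ?_, fun η hη ζ hζ h => ?_, fun ξ hξ => ?_⟩
  · exact dproj_mem_tangent hz (horizontalSpace_le _ ((mem_horizontal_iff hz).1 hη))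
  · exact horizontal_ext hz ((mem_horizontal_iff hz).1 hη) ((mem_horizontal_iff hz).1 hζ) h
  · exact ⟨lift z ξ, (mem_horizontal_iff hz).2 (lift_mem hz hξ), dproj_lift hz hξ⟩

theorem existsUnique_sylvester (z η : Pair m n p) :
    ∃! Ω : Matrix (Fin p) (Fin p) ℝ, Ωᵀ = -Ω ∧
      (z.2ᵀ * z.2 + 1) * Ω + Ω * (z.2ᵀ * z.2 + 1) =
        η.1ᵀ * z.1 - z.1ᵀ * η.1 + η.2ᵀ * z.2 - z.2ᵀ * η.2 :=
  ⟨omegaOf z η, ⟨omegaOf_skew z η, sylvester_spec _ _⟩, fun _ h => sylvester_unique h.2⟩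

theorem hproj_eq_of_sylvester (hz : z ∈ SRp m n p) (hη : η ∈ tangentSpace z)
    {Ω : Matrix (Fin p) (Fin p) ℝ} (h : (z.2ᵀ * z.2 + 1) * Ω + Ω * (z.2ᵀ * z.2 + 1) =
      η.1ᵀ * z.1 - z.1ᵀ * η.1 + η.2ᵀ * z.2 - z.2ᵀ * η.2) :
    hproj z η = (η.1 + z.1 * Ω, η.2 + z.2 * Ω) := by
  rw [hproj_eq hz hη, sylvester_unique h]
  rfl

end Submersion

end FixedRank

end

theorem mainTheorem1 (m n p : ℕ) (hp : 0 < p) (hpm : p ≤ m) (hpn : p ≤ n) :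
    -- the quotient metric is a Riemannian metric on `M_p` and `π` is a Riemannian submersion
    IsRiemannianMetric (SRp m n p) gBar ∧
    IsRiemannianMetric (Mp m n p) (quotMetric p) ∧
    proj '' SRp m n p = Mp m n p ∧
    (∀ z ∈ SRp m n p,
      Set.BijOn (dproj z) (horizontal z) (tangent (Mp m n p) (proj z)) ∧
      (∀ ξ ∈ tangent (Mp m n p) (proj z), lift z ξ ∈ horizontal z ∧ dproj z (lift z ξ) = ξ) ∧
      ∀ ξ ∈ tangent (Mp m n p) (proj z), ∀ ζ ∈ tangent (Mp m n p) (proj z),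
        quotMetric p (proj z) ξ ζ = gBar z (lift z ξ) (lift z ζ)) ∧
    -- the horizontal projection
    (∀ z ∈ SRp m n p, ∀ η ∈ tangent (SRp m n p) z,
      (hproj z η ∈ horizontal z ∧ η - hproj z η ∈ vertical z) ∧
      (∃! Ω : Matrix (Fin p) (Fin p) ℝ, Ωᵀ = -Ω ∧
        (z.2ᵀ * z.2 + 1) * Ω + Ω * (z.2ᵀ * z.2 + 1) =
          η.1ᵀ * z.1 - z.1ᵀ * η.1 + η.2ᵀ * z.2 - z.2ᵀ * η.2) ∧
      ∀ Ω : Matrix (Fin p) (Fin p) ℝ, Ωᵀ = -Ω →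
        (z.2ᵀ * z.2 + 1) * Ω + Ω * (z.2ᵀ * z.2 + 1) =
          η.1ᵀ * z.1 - z.1ᵀ * η.1 + η.2ᵀ * z.2 - z.2ᵀ * η.2 →
        hproj z η = (η.1 + z.1 * Ω, η.2 + z.2 * Ω)) ∧
    -- the Riemannian connection and the Riemannian exponential of the total space
    IsLeviCivita (SRp m n p) gBar nablaBar ∧
    (∀ z ∈ SRp m n p, ∀ η ∈ tangent (SRp m n p) z, ∀ w : Pair m n p,
      HasExp (SRp m n p) nablaBar z η w ↔ StaysFullRank z η ∧ w = expTotal z η) ∧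
    -- the Riemannian connection of `M_p`
    (∃ nabla, IsLeviCivita (Mp m n p) (quotMetric p) nabla) ∧
    ∀ nabla, IsLeviCivita (Mp m n p) (quotMetric p) nabla →
      -- the Riemannian exponential of `M_p`
      (∀ z ∈ SRp m n p, ∀ ξ ∈ tangent (Mp m n p) (proj z), ∀ Y : Matrix (Fin m) (Fin n) ℝ,
        HasExp (Mp m n p) nabla (proj z) ξ Y ↔
          StaysFullRank z (lift z ξ) ∧ Y = proj (expTotal z (lift z ξ))) ∧
      -- the Riemannian Newton method
      ∀ f : Matrix (Fin m) (Fin n) ℝ → ℝ, ContDiffOn ℝ ∞ f (Mp m n p) →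
        ∀ z ∈ SRp m n p,
          gradBar f z = tproj z (euclGrad (fun w => f (proj w)) z) ∧
          (∀ ξ ∈ tangent (Mp m n p) (proj z),
            IsNewtonVector (Mp m n p) (quotMetric p) nabla f (proj z) ξ ↔
              IsLiftedNewtonVector f z (lift z ξ)) ∧
          ∀ Y : Matrix (Fin m) (Fin n) ℝ,
            IsNewtonStep (Mp m n p) (quotMetric p) nabla f (proj z) Y ↔
              ∃ η : Pair m n p, IsLiftedNewtonVector f z η ∧ StaysFullRank z η ∧
                Y = proj (expTotal z η) := by
  refine ⟨isRiemannianMetric_gBar, isRiemannianMetric_quotMetric, image_proj, fun z hz => ⟨bijOn_dproj hz,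
    fun ξ hξ => ⟨(mem_horizontal_iff hz).2 (lift_mem hz hξ), dproj_lift hz hξ⟩,
    fun ξ hξ ζ hζ => quotMetric_proj hz hξ hζ⟩, fun z hz η hη => ?_, isLeviCivita_nablaBar,
    fun z hz η hη w => hasExp_total_iff hz hη w, ⟨nablaQuot p, isLeviCivita_nablaQuot⟩,
    fun nabla hL => ⟨fun z hz ξ hξ Y => hasExp_Mp_iff hL hz hξ Y, fun f hf z hz =>
      ⟨gradBar_eq hf hz, fun ξ hξ => isNewtonVector_iff hL hf hz hξ,
        fun Y => isNewtonStep_iff hL hf hz Y⟩⟩⟩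
  rw [mem_tangent_iff hz] at hη
  exact ⟨⟨(mem_horizontal_iff hz).2 (hproj_mem hz hη), sub_hproj_mem hz hη⟩,
    existsUnique_sylvester z η, fun Ω _ h => hproj_eq_of_sylvester hz hη h⟩
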